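/- **Proposition 7.1 (Localized virial identities).** Let $\|V\|_{\mathcal K}:=\sup_{x\in\mathbb R^3}\int_{\mathbb R^3}\frac{|V(y)|}{|x-y|}\,dy$ be the global Kato norm and let $\mathcal K_0$ be the closure in this norm of the bounded, compactly supported functions. Let $V:\mathbb R^3\to\mathbb R$ satisfy $V\in\mathcal K_0\cap L^{3/2}(\mathbb R^3)$ and $\|V_-\|_{\mathcal K}<4\pi$, where $V_-:=\min(V,0)$. Let $I\ni 0$ be an open interval, $u_0\in H^1(\mathbb R^3;\mathbb C)$, and let $u\in C(I;H^1(\mathbb R^3;\mathbb C))$ be a solution of $$i\partial_t u+\Delta u-Vu+|u|^2u=0,\qquad u(0)=u_0,$$ that is, for every $\varphi\in C_c^\infty(\mathbb R^3)$ and every $t\in I$, $$\frac{d}{dt}\int\varphi u\,dx=-i\Big(\int\nabla\varphi\cdot\nabla u\,dx+\int\varphi Vu\,dx-\int\varphi|u|^2u\,dx\Big).$$ Let $\chi\in C_c^\infty(\mathbb R^3)$ be real-valued. Then $t\mapsto\int\chi|u(t)|^2dx$ is differentiable on $I$, and for every $t\in I$ $$\partial_t\int_{\mathbb R^3}\chi|u|^2dx=2\operatorname{Im}\int_{\mathbb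 R^3}(\nabla\chi\cdot\nabla u)\bar u\,dx .$$ Assume in addition that the distribution $\nabla\chi\cdot\nabla V$, given by $\varphi\mapsto-\int V\,\nabla\cdot(\varphi\nabla\chi)\,dx$, is a locally integrable function and that $(\nabla\chi\cdot\nabla V)|f|^2$ is integrable for every $f\in H^1(\mathbb R^3;\mathbb C)$ (for instance, that $\nabla\chi\cdot\nabla V\in L^{3/2}$). Then $t\mapsto\int\chi|u(t)|^2dx$ is twice differentiable on $I$, and for every $t\in I$ $$\partial_t^2\int_{\mathbb R^3}\chi|u|^2dx=4\sum_{i,j=1}^3\operatorname{Re}\int_{\mathbb R^3}\partial_{x_ix_j}\chi\,\partial_{x_i}u\,\overline{\partial_{x_j}u}\,dx-\int_{\mathbb R^3}\Delta\chi|u|^4dx-\int_{\mathbb R^3}\Delta^2\chi|u|^2dx-2\int_{\mathbb R^3}(\nabla\chi\cdot\nabla V)|u|^2dx .$$ All the integrals above converge absolutely. -/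

import Mathlib

open MeasureTheory Set
open scoped ENNReal InnerProductSpace ContDiff

namespace NLSVirial

noncomputable section

/-- Three-dimensional Euclidean space. -/
abbrev R3 : Type := EuclideanSpace ℝ (Fin 3)

/-- Classical partial derivative `∂_i φ` of a real function. -/
def pd (i : Fin 3) (φ : R3 → ℝ) (x : R3) : ℝ :=
  fderiv ℝ φ x (EuclideanSpace.single i (1 : ℝ))

/-- Real-valued test functions: the class `C_c^∞(ℝ³)`. Testing against real functions is the same
as testing against complex ones, by linearity. -/
def IsTestFunction (φ : R3 → ℝ) : Prop :=
  ContDiff ℝ ∞ φ ∧ HasCompactSupport φ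

theorem IsTestFunction.continuous_pd {φ : R3 → ℝ} (h : IsTestFunction φ) (i : Fin 3) :
    Continuous (pd i φ) :=
  (h.1.continuous_fderiv (by simp)).clm_apply continuous_const

theorem IsTestFunction.hasCompactSupport_pd {φ : R3 → ℝ} (h : IsTestFunction φ) (i : Fin 3) :
    HasCompactSupport (pd i φ) :=
  h.2.fderiv_apply ℝ _

theorem integrable_smul_of_L2 {φ : R3 → ℝ} (hφ : Continuous φ) (hs : HasCompactSupport φ)
    (f : Lp ℂ 2 (volume : Measure R3)) : Integrable (fun x => φ x • f x) :=
  by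
  have h : MemLp φ 2 (volume : Measure R3) := hφ.memLp_of_hasCompactSupport hs
  exact memLp_one_iff_integrable.1 ((Lp.memLp f).smul h)

/-- The Sobolev space `H¹(ℝ³; ℂ)`, realised as the graph of the weak gradient: the pairs
`(f, (g₀, g₁, g₂))` of square integrable functions with `g_i = ∂_i f` in the weak sense. Its
topology, inherited from `L² × (L²)³`, is that of the usual `H¹` norm. -/
def H1 : Submodule ℂ
    (Lp ℂ 2 (volume : Measure R3) × (Fin 3 → Lp ℂ 2 (volume : Measure R3))) where
  carrier := {p | ∀ φ : R3 → ℝ, IsTestFunction φ → ∀ i : Fin 3,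
    ∫ x, pd i φ x • p.1 x = -∫ x, φ x • p.2 i x}
  zero_mem' := by
    intro φ hφ i
    simp
  add_mem' := by
    intro p q hp hq φ hφ i
    have key : ∀ (ψ : R3 → ℝ), Continuous ψ → HasCompactSupport ψ →
        ∀ f g : Lp ℂ 2 (volume : Measure R3),
        ∫ x, ψ x • (f + g) x = (∫ x, ψ x • f x) + ∫ x, ψ x • g x := by
      intro ψ hc hs f g
      rw [← integral_add (integrable_smul_of_L2 hc hs f) (integrable_smul_of_L2 hc hs g)]
      refine integral_congr_ae ?_
      filter_upwards [Lp.coeFn_add f g] with x hx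
      rw [hx, Pi.add_apply, smul_add]
    have e1 := key (pd i φ) (hφ.continuous_pd i) (hφ.hasCompactSupport_pd i) p.1 q.1
    have e2 := key φ hφ.1.continuous hφ.2 (p.2 i) (q.2 i)
    have e3 := hp φ hφ i
    have e4 := hq φ hφ i
    calc ∫ x, pd i φ x • (p.1 + q.1) x = _ := e1
      _ = -∫ x, φ x • (p.2 i + q.2 i) x := by rw [e2, e3, e4]; ring
  smul_mem' := by
    intro c p hp φ hφ i
    have key : ∀ (ψ : R3 → ℝ) (f : Lp ℂ 2 (volume : Measure R3)),
        ∫ x, ψ x • (c • f) x = c * ∫ x, ψ x • f x := by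
      intro ψ f
      rw [← integral_const_mul]
      refine integral_congr_ae ?_
      filter_upwards [Lp.coeFn_smul c f] with x hx
      simp only [hx, Pi.smul_apply, smul_eq_mul, Complex.real_smul]
      ring
    calc ∫ x, pd i φ x • (c • p.1) x = _ := key _ _
      _ = -∫ x, φ x • (c • p.2 i) x := by rw [key, hp φ hφ i]; ring

/-- The underlying function of an element of `H¹`. -/
def H1.val (f : H1) : R3 → ℂ := fun x => f.1.1 x

/-- The weak partial derivative `∂_i f` of an element `f` of `H¹`. -/
def H1.grad (f : H1) (i : Fin 3) : R3 → ℂ := fun x => f.1.2 i x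

/-- The global Kato norm `sup_x ∫ |V(y)| / |x - y| dy`, as an extended nonnegative number. -/
def katoNorm (V : R3 → ℝ) : ℝ≥0∞ :=
  ⨆ x : R3, ∫⁻ y, ENNReal.ofReal (|V y| / ‖x - y‖)

/-- The class `𝒦₀`: the closure in the Kato norm of the bounded compactly supported functions. -/
def MemK0 (V : R3 → ℝ) : Prop :=
  AEStronglyMeasurable V volume ∧
  ∀ ε : ℝ, 0 < ε → ∃ g : R3 → ℝ, AEStronglyMeasurable g volume ∧ (∃ C : ℝ, ∀ x, |g x| ≤ C) ∧
    HasCompactSupport g ∧ katoNorm (fun x => V x - g x) < ENNReal.ofReal ε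

/-- The standing assumptions on the potential: `V ∈ 𝒦₀ ∩ L^{3/2}`, and the negative part
`V₋ = min(V, 0)` satisfies `‖V₋‖_𝒦 < 4π`. -/
structure IsAdmissiblePotential (V : R3 → ℝ) : Prop where
  memK0 : MemK0 V
  memLp : MemLp V (3 / 2 : ℝ≥0∞) volume
  negPart_lt : katoNorm (fun x => min (V x) 0) < ENNReal.ofReal (4 * Real.pi)

/-- `u` is an `H¹` solution, on the open time interval `I` around `0`, of
`i ∂_t u + Δu - V u + |u|² u = 0`, `u(0) = u₀`: it belongs to `C(I; H¹)` and satisfies the equation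
in the sense of distributions on `ℝ³` at each time, i.e. for every test function `φ` and `t ∈ I`,
`d/dt ∫ φ u = -i (∫ ∇φ·∇u + ∫ φ V u - ∫ φ |u|² u)`. -/
structure IsSolution (V : R3 → ℝ) (I : Set ℝ) (u₀ : H1) (u : ℝ → H1) : Prop where
  isOpen : IsOpen I
  ordConnected : I.OrdConnected
  zero_mem : (0 : ℝ) ∈ I
  initial : u 0 = u₀
  continuousOn : ContinuousOn u I
  equation : ∀ φ : R3 → ℝ, IsTestFunction φ → ∀ t ∈ I,
    HasDerivAt (fun s => ∫ x, φ x • H1.val (u s) x)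
      (-Complex.I * ((∫ x, ∑ i, pd i φ x • H1.grad (u t) i x)
        + (∫ x, (φ x * V x) • H1.val (u t) x)
        - ∫ x, (φ x * ‖H1.val (u t) x‖ ^ 2) • H1.val (u t) x)) t

/-- `W` is the distributional derivative `∇χ · ∇V` of `V` along the vector field `∇χ`: `W` is
locally integrable and `∫ W φ = -∫ V ∇·(φ ∇χ)` for every test function `φ`. -/
def IsWeakGradDot (χ V W : R3 → ℝ) : Prop :=
  LocallyIntegrable W volume ∧
  ∀ φ : R3 → ℝ, IsTestFunction φ →
    ∫ x, W x * φ x = -∫ x, V x * ∑ i, pd i (fun y => φ y * pd i χ y) x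

end

end NLSVirial

open Filter Topology
open scoped BoundedContinuousFunction NNReal

namespace NLSVirial

noncomputable section

/-! Formally both identities come from differentiating the integral of χ|u|² twice, inserting the
equation and integrating by parts. But u(t) is only in H¹ and V only in L^{3/2}: Δu and ∇V are not
functions, ∂ₜu lies only in H⁻¹, and ∇χ·∇u is not an admissible test function. One regularization in
space and one in time make the computation rigorous.

In space, let v ∈ H¹ solve -Δv + Vv = G weakly with G ∈ L². Instead of ∇χ·∇v, the test function is
(v∘Φ_s - v∘Φ_{-s})/s, where Φ is the flow of the vector field ∇χ; it lies in H¹, and it tends to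
2∇χ·∇v in L², which settles the right-hand side. On the left stand bounded symmetric forms B whose
values B(v∘Φ_s, v∘Φ_s) are differentiable in s. Although v∘Φ_s - v is only o(1) in H¹, the quadratic
remainders at s and at -s agree up to o(s), because composition with Φ_{-s} carries one increment to
the other; so the symmetric quotient tends to the derivative of B along the flow
(`IsRealForm.tendsto_symm_slope`). For the Dirichlet form this derivative gives the Hessian of χ and
-Δχ|∇v|²; for the potential it gives -∇·(V∇χ) = -(∇χ·∇V + VΔχ), and no derivative of V has to be a
function except along ∇χ (`virial_dirL`). Testing with Δχ v removes the terms Δχ|∇v|² and VΔχ|v|²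
and produces Δ²χ (`virial_lapl`, `virial_stationary`).

In time, u is replaced by its Steklov averages u_δ. They are C¹ with values in H¹, and since the
linear part of the equation commutes with averaging, v = u_δ(t) solves the stationary problem
exactly with G = i∂ₜu_δ + (|u|²u)_δ (`weak_steklov`). For the functionals of interest, algebra and
one integration by parts express the time derivative along u_δ through u_δ and the averaged
nonlinearity alone (`mass_symm`, `virial_symm`). This expression is continuous on H¹ × L², so the
time-integrated identity survives δ → 0 and differentiates back (`hasDerivAt_of_weak_evolution`).

The functional analysis behind this: smooth compactly supported functions are dense in H¹
(`dense_smoothH1`); H¹ embeds in L⁶, so that u ↦ |u|²u is continuous from H¹ to L² and V defines a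
bounded form; and the bare integrability of (∇χ·∇V)|f|² for all f ∈ H¹ yields a bounded form by the
closed graph theorem (`multiplier`). The cubic term contributes through 4 Re(|v|²v ∇χ·∇v̄) =
∇χ·∇|v|⁴. -/

/-- Square integrable complex functions on `ℝ³`. -/
abbrev L2 : Type := Lp ℂ 2 (volume : Measure R3)

/-- The `i`-th coordinate vector. -/
abbrev basisVec (i : Fin 3) : R3 := EuclideanSpace.single i (1 : ℝ)

/-- Classical partial derivative of a complex function. -/
def pdc (i : Fin 3) (f : R3 → ℂ) (x : R3) : ℂ := fderiv ℝ f x (basisVec i)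

/-- The square integrable function defined by a continuous function of compact support. -/
def toL2 (f : R3 → ℂ) (hf : Continuous f) (hs : HasCompactSupport f) : L2 :=
  (hf.memLp_of_hasCompactSupport hs).toLp f

theorem coeFn_toL2 {f : R3 → ℂ} (hf : Continuous f) (hs : HasCompactSupport f) :
    toL2 f hf hs =ᵐ[volume] f := MemLp.coeFn_toLp _

theorem inner_eq (f g : L2) : ⟪f, g⟫_ℂ = ∫ x, g x * (starRingEnd ℂ) (f x) := by
  simp [L2.inner_def, RCLike.inner_apply]

theorem inner_eq_of_ae {f g : L2} {f' g' : R3 → ℂ} (hf : f =ᵐ[volume] f') (hg : g =ᵐ[volume] g') :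
    ⟪f, g⟫_ℂ = ∫ x, g' x * (starRingEnd ℂ) (f' x) := by
  rw [inner_eq]
  refine integral_congr_ae ?_
  filter_upwards [hf, hg] with x h1 h2
  rw [h1, h2]

theorem integrable_inner_of_ae {f g : L2} {f' g' : R3 → ℂ} (hf : f =ᵐ[volume] f')
    (hg : g =ᵐ[volume] g') : Integrable (fun x => g' x * (starRingEnd ℂ) (f' x)) := by
  refine (L2.integrable_inner (𝕜 := ℂ) f g).congr ?_
  filter_upwards [hf, hg] with x h1 h2
  rw [h1, h2, RCLike.inner_apply]

/-! ### Multiplication by bounded continuous functions on L² -/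

section Mul

/-- The product of a bounded continuous real function and a square integrable function is square
integrable. -/
theorem memLp_smul (a : R3 →ᵇ ℝ) (f : L2) : MemLp (fun x => a x • f x) 2 volume := by
  refine (Lp.memLp f).of_le_mul (c := ‖a‖)
    (a.continuous.aestronglyMeasurable.smul (Lp.aestronglyMeasurable f)) ?_
  filter_upwards with x
  rw [norm_smul]
  gcongr
  exact a.norm_coe_le_norm x

/-- Multiplication by a bounded continuous real function. -/
def mulL (a : R3 →ᵇ ℝ) : L2 →L[ℂ] L2 :=
  LinearMap.mkContinuous
    { toFun := fun f => (memLp_smul a f).toLp _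
      map_add' := fun f g => by
        refine Lp.ext ?_
        filter_upwards [(memLp_smul a (f + g)).coeFn_toLp, (memLp_smul a f).coeFn_toLp,
          (memLp_smul a g).coeFn_toLp, Lp.coeFn_add f g,
          Lp.coeFn_add ((memLp_smul a f).toLp _) ((memLp_smul a g).toLp _)] with x h1 h2 h3 h4 h5
        rw [h1, h5, Pi.add_apply, h2, h3, h4, Pi.add_apply, smul_add]
      map_smul' := fun c f => by
        refine Lp.ext ?_
        filter_upwards [(memLp_smul a (c • f)).coeFn_toLp, (memLp_smul a f).coeFn_toLp,
          Lp.coeFn_smul c f, Lp.coeFn_smul c ((memLp_smul a f).toLp _)] with x h1 h2 h3 h4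
        rw [h1, RingHom.id_apply, h4, Pi.smul_apply, h2, h3, Pi.smul_apply, smul_comm] }
    ‖a‖ (fun f => by
      refine Lp.norm_le_mul_norm_of_ae_le_mul ?_
      filter_upwards [(memLp_smul a f).coeFn_toLp] with x h1
      change ‖(memLp_smul a f).toLp _ x‖ ≤ _
      rw [h1, norm_smul]
      gcongr
      exact a.norm_coe_le_norm x)

theorem coeFn_mulL (a : R3 →ᵇ ℝ) (f : L2) : mulL a f =ᵐ[volume] fun x => a x • f x :=
  (memLp_smul a f).coeFn_toLp

theorem norm_mulL_le (a : R3 →ᵇ ℝ) (f : L2) : ‖mulL a f‖ ≤ ‖a‖ * ‖f‖ :=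
  (LinearMap.mkContinuous_norm_le _ (norm_nonneg a) _ |> fun h =>
    (mulL a).le_of_opNorm_le h f)

theorem mulL_add (a b : R3 →ᵇ ℝ) (f : L2) : mulL (a + b) f = mulL a f + mulL b f := by
  refine Lp.ext ?_
  filter_upwards [coeFn_mulL (a + b) f, coeFn_mulL a f, coeFn_mulL b f,
    Lp.coeFn_add (mulL a f) (mulL b f)] with x h1 h2 h3 h4
  rw [h1, h4, Pi.add_apply, h2, h3, BoundedContinuousFunction.add_apply, add_smul]

theorem mulL_sub (a b : R3 →ᵇ ℝ) (f : L2) : mulL (a - b) f = mulL a f - mulL b f := by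
  have := mulL_add (a - b) b f
  rw [sub_add_cancel] at this
  rw [this, add_sub_cancel_right]

theorem mulL_smul (c : ℝ) (a : R3 →ᵇ ℝ) (f : L2) : mulL (c • a) f = (c : ℂ) • mulL a f := by
  refine Lp.ext ?_
  filter_upwards [coeFn_mulL (c • a) f, coeFn_mulL a f,
    Lp.coeFn_smul (c : ℂ) (mulL a f)] with x h1 h2 h3
  rw [h1, h3, Pi.smul_apply, h2, BoundedContinuousFunction.coe_smul, smul_assoc,
    Complex.coe_smul]

theorem mulL_one (f : L2) : mulL 1 f = f := by
  refine Lp.ext ?_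
  filter_upwards [coeFn_mulL 1 f] with x h1
  simp [h1]

theorem inner_mulL_left (a : R3 →ᵇ ℝ) (f g : L2) : ⟪mulL a f, g⟫_ℂ = ⟪f, mulL a g⟫_ℂ := by
  rw [inner_eq_of_ae (coeFn_mulL a f) (ae_eq_refl g), inner_eq_of_ae (ae_eq_refl f) (coeFn_mulL a g)]
  congr 1 with x
  simp only [Complex.real_smul, map_mul, Complex.conj_ofReal]
  ring

theorem inner_mulL_self (a : R3 →ᵇ ℝ) (f : L2) :
    ⟪f, mulL a f⟫_ℂ = ((∫ x, a x * ‖f x‖ ^ 2 : ℝ) : ℂ) := by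
  rw [inner_eq_of_ae (ae_eq_refl f) (coeFn_mulL a f), ← integral_complex_ofReal]
  congr 1 with x
  rw [Complex.real_smul, mul_assoc, Complex.mul_conj, Complex.normSq_eq_norm_sq]
  push_cast
  ring

/-- A continuous real function with compact support as a bounded continuous function. -/
def bcf (a : R3 → ℝ) (ha : Continuous a) (hs : HasCompactSupport a) : R3 →ᵇ ℝ :=
  BoundedContinuousFunction.ofNormedAddCommGroup a ha
    (Classical.choose (hs.exists_bound_of_continuous ha))
    (Classical.choose_spec (hs.exists_bound_of_continuous ha))

theorem integrable_bcf_mul_sq (a : R3 →ᵇ ℝ) (f : L2) : Integrable (fun x => a x * ‖f x‖ ^ 2) := by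
  have h := (integrable_inner_of_ae (ae_eq_refl f) (coeFn_mulL a f)).re
  refine h.congr (Eventually.of_forall fun x => ?_)
  change ((a x • f x) * (starRingEnd ℂ) (f x)).re = _
  rw [Complex.real_smul, mul_assoc, Complex.mul_conj, Complex.normSq_eq_norm_sq]
  norm_cast

end Mul

/-! ### Test functions, and completeness of H¹ -/

section TestFunctions

theorem IsTestFunction.contDiff_pd {φ : R3 → ℝ} (h : IsTestFunction φ) (i : Fin 3) :
    ContDiff ℝ ∞ (pd i φ) :=
  (h.1.fderiv_right (m := ∞) (by simp)).clm_apply contDiff_const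

theorem IsTestFunction.pd {φ : R3 → ℝ} (h : IsTestFunction φ) (i : Fin 3) :
    IsTestFunction (pd i φ) :=
  ⟨h.contDiff_pd i, h.hasCompactSupport_pd i⟩

theorem IsTestFunction.mul {φ ψ : R3 → ℝ} (h : IsTestFunction φ) (h' : ContDiff ℝ ∞ ψ) :
    IsTestFunction (fun x => φ x * ψ x) :=
  ⟨h.1.mul h', h.2.mul_right⟩

theorem IsTestFunction.add {φ ψ : R3 → ℝ} (h : IsTestFunction φ) (h' : IsTestFunction ψ) :
    IsTestFunction (fun x => φ x + ψ x) :=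
  ⟨h.1.add h'.1, h.2.add h'.2⟩

theorem IsTestFunction.sum {φ : Fin 3 → R3 → ℝ} (h : ∀ i, IsTestFunction (φ i)) :
    IsTestFunction (fun x => ∑ i, φ i x) := by
  simp only [Fin.sum_univ_three]
  exact ((h 0).add (h 1)).add (h 2)

theorem pd_mul {φ ψ : R3 → ℝ} (hφ : Differentiable ℝ φ) (hψ : Differentiable ℝ ψ) (i : Fin 3)
    (x : R3) : pd i (fun y => φ y * ψ y) x = pd i φ x * ψ x + φ x * pd i ψ x := by
  unfold NLSVirial.pd
  rw [fderiv_fun_mul (hφ x) (hψ x)]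
  simp only [add_apply, smul_apply, smul_eq_mul]
  ring

/-- A real test function as a square integrable function. -/
def testL (φ : R3 → ℝ) (hφ : Continuous φ) (hs : HasCompactSupport φ) : L2 :=
  toL2 (fun x => (φ x : ℂ)) (Complex.continuous_ofReal.comp hφ)
    (hs.comp_left (g := ((↑) : ℝ → ℂ)) (by simp))

theorem inner_testL (φ : R3 → ℝ) (hφ : Continuous φ) (hs : HasCompactSupport φ) (f : L2) :
    ⟪testL φ hφ hs, f⟫_ℂ = ∫ x, φ x • f x := by
  rw [testL, inner_eq_of_ae (coeFn_toL2 _ _) (ae_eq_refl f)]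
  congr 1 with x
  rw [Complex.conj_ofReal, Complex.real_smul, mul_comm]

theorem mem_H1_iff {p : L2 × (Fin 3 → L2)} :
    p ∈ H1 ↔ ∀ (φ : R3 → ℝ) (hφ : IsTestFunction φ) (i : Fin 3),
      ⟪testL _ (hφ.continuous_pd i) (hφ.hasCompactSupport_pd i), p.1⟫_ℂ
        + ⟪testL _ hφ.1.continuous hφ.2, p.2 i⟫_ℂ = 0 := by
  simp only [inner_testL, add_eq_zero_iff_eq_neg]
  rfl

/-- An intersection of zero sets of continuous functionals. The resulting completeness is needed for
the closed graph theorem and for time integrals with values in H¹. -/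
theorem isClosed_H1 : IsClosed (H1 : Set (L2 × (Fin 3 → L2))) := by
  have : (H1 : Set (L2 × (Fin 3 → L2))) = ⋂ (φ : R3 → ℝ) (hφ : IsTestFunction φ) (i : Fin 3),
      {p | ⟪testL _ (hφ.continuous_pd i) (hφ.hasCompactSupport_pd i), p.1⟫_ℂ
        + ⟪testL _ hφ.1.continuous hφ.2, p.2 i⟫_ℂ = 0} := by
    ext p
    simp only [SetLike.mem_coe, mem_H1_iff, mem_iInter, mem_ofPred_eq]
  rw [this]
  refine isClosed_iInter fun φ => isClosed_iInter fun hφ => isClosed_iInter fun i => ?_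
  refine isClosed_eq ?_ continuous_const
  fun_prop

instance : CompleteSpace H1 := isClosed_H1.completeSpace_coe

end TestFunctions

/-! ### H¹ seen through its value and gradient maps -/

section Projections

/-- The underlying square integrable function, as a continuous linear map. -/
def valL : H1 →L[ℂ] L2 := (ContinuousLinearMap.fst ℂ L2 (Fin 3 → L2)).comp H1.subtypeL

/-- The weak partial derivative, as a continuous linear map. -/
def gradL (i : Fin 3) : H1 →L[ℂ] L2 :=
  (ContinuousLinearMap.proj i).comp
    ((ContinuousLinearMap.snd ℂ L2 (Fin 3 → L2)).comp H1.subtypeL)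

theorem coe_valL (f : H1) : (valL f : R3 → ℂ) = H1.val f := rfl
theorem coe_gradL (i : Fin 3) (f : H1) : (gradL i f : R3 → ℂ) = H1.grad f i := rfl

theorem norm_valL_le (f : H1) : ‖valL f‖ ≤ ‖f‖ := norm_fst_le f.1
theorem norm_gradL_le (i : Fin 3) (f : H1) : ‖gradL i f‖ ≤ ‖f‖ :=
  (norm_le_pi_norm f.1.2 i).trans (norm_snd_le f.1)

theorem H1.norm_le {f : H1} {C : ℝ} (hv : ‖valL f‖ ≤ C) (hg : ∀ i, ‖gradL i f‖ ≤ C) : ‖f‖ ≤ C :=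
  max_le hv ((pi_norm_le_iff_of_nonneg ((norm_nonneg _).trans hv)).2 hg)

theorem tendsto_H1 {ι : Type*} {l : Filter ι} {F : ι → H1} {f : H1}
    (hv : Tendsto (fun n => valL (F n)) l (𝓝 (valL f)))
    (hg : ∀ i, Tendsto (fun n => gradL i (F n)) l (𝓝 (gradL i f))) : Tendsto F l (𝓝 f) := by
  rw [tendsto_subtype_rng]
  exact hv.prodMk_nhds (tendsto_pi_nhds.2 hg)

theorem H1.ext_val_grad {f g : H1} (hv : valL f = valL g) (hg : ∀ i, gradL i f = gradL i g) :
    f = g := Subtype.ext (Prod.ext hv (funext hg))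

/-- A pair of continuous linear maps into `L²` and `(L²)³` with values in the graph of the weak
gradient is a continuous linear map into `H¹`. -/
def liftH1 {E : Type*} [NormedAddCommGroup E] [NormedSpace ℂ E] (A : E →L[ℂ] L2)
    (B : Fin 3 → E →L[ℂ] L2) (h : ∀ e, ((A e, fun i => B i e) : L2 × (Fin 3 → L2)) ∈ H1) :
    E →L[ℂ] H1 :=
  (A.prod (ContinuousLinearMap.pi B)).codRestrict H1 h

theorem valL_liftH1 {E : Type*} [NormedAddCommGroup E] [NormedSpace ℂ E] (A : E →L[ℂ] L2)
    (B : Fin 3 → E →L[ℂ] L2) (h : ∀ e, ((A e, fun i => B i e) : L2 × (Fin 3 → L2)) ∈ H1) (e : E) :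
    valL (liftH1 A B h e) = A e := rfl

theorem gradL_liftH1 {E : Type*} [NormedAddCommGroup E] [NormedSpace ℂ E] (A : E →L[ℂ] L2)
    (B : Fin 3 → E →L[ℂ] L2) (h : ∀ e, ((A e, fun i => B i e) : L2 × (Fin 3 → L2)) ∈ H1)
    (i : Fin 3) (e : E) : gradL i (liftH1 A B h e) = B i e := rfl

theorem H1.weak (f : H1) {φ : R3 → ℝ} (hφ : IsTestFunction φ) (i : Fin 3) :
    ∫ x, pd i φ x • valL f x = -∫ x, φ x • gradL i f x := f.2 φ hφ i

end Projections

/-! ### Classical functions as elements of H¹ -/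

section Classical

theorem continuous_pdc {f : R3 → ℂ} (hf : ContDiff ℝ 1 f) (i : Fin 3) : Continuous (pdc i f) :=
  (hf.continuous_fderiv (by simp)).clm_apply continuous_const

theorem hasCompactSupport_pdc {f : R3 → ℂ} (hs : HasCompactSupport f) (i : Fin 3) :
    HasCompactSupport (pdc i f) := hs.fderiv_apply ℝ _

/-- Integration by parts against a bump η equal to 1 on the support of f: there η f' = f', while η'
f = 0. -/
theorem integral_fderiv_eq_zero {F : Type*} [NormedAddCommGroup F] [NormedSpace ℝ F] {f : R3 → F}
    (hf : ContDiff ℝ 1 f) (hs : HasCompactSupport f) (v : R3) :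
    ∫ x, fderiv ℝ f x v = 0 := by
  obtain ⟨η, hη1, hη2⟩ : ∃ η : ContDiffBump (0 : R3), tsupport f ⊆ Metric.closedBall 0 η.rIn ∧
      True := by
    obtain ⟨R, hR⟩ := hs.isCompact.isBounded.subset_closedBall (0 : R3)
    exact ⟨⟨max R 1, max R 1 + 1, by positivity, by linarith⟩,
      hR.trans (Metric.closedBall_subset_closedBall (le_max_left _ _)), trivial⟩
  have hc : ContDiff ℝ 1 (η : R3 → ℝ) := η.contDiff
  have key := integral_smul_fderiv_eq_neg_fderiv_smul_of_integrable (μ := volume) (𝕜 := ℝ)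
    (f := (η : R3 → ℝ)) (g := f) (v := v) ?_ ?_ ?_ ?_ ?_
  · have h1 : ∀ x, η x • fderiv ℝ f x v = fderiv ℝ f x v := by
      intro x
      by_cases hx : x ∈ tsupport f
      · rw [η.one_of_mem_closedBall (hη1 hx), one_smul]
      · have : fderiv ℝ f x = 0 := by
          by_contra h
          exact hx (support_fderiv_subset ℝ h)
        simp [this]
    have h2 : ∀ x, (fderiv ℝ η x v) • f x = 0 := by
      intro x
      by_cases hx : f x = 0
      · rw [hx, smul_zero]
      · have : η =ᶠ[𝓝 x] fun _ => (1 : ℝ) := by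
          have hx' : {y | f y ≠ 0} ∈ 𝓝 x := hf.continuous.continuousAt.eventually_ne hx
          filter_upwards [hx'] with y hy
          exact η.one_of_mem_closedBall (hη1 (subset_tsupport f hy))
        rw [this.fderiv_eq]
        simp
    simpa [h1, h2] using key
  · exact (((hc.continuous_fderiv (by simp)).clm_apply (continuous_const (y := v))).smul
      hf.continuous).integrable_of_hasCompactSupport hs.smul_left
  · exact (hc.continuous.smul ((hf.continuous_fderiv (by simp)).clm_apply
      continuous_const)).integrable_of_hasCompactSupport (η.hasCompactSupport.smul_right)
  · exact (hc.continuous.smul hf.continuous).integrable_of_hasCompactSupport hs.smul_left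
  · exact fun x _ => (hc.differentiable (by simp) x)
  · exact fun x _ => (hf.differentiable (by simp) x)

theorem pdc_smul {φ : R3 → ℝ} {f : R3 → ℂ} (hφ : Differentiable ℝ φ) (hf : Differentiable ℝ f)
    (i : Fin 3) (x : R3) : pdc i (fun y => φ y • f y) x = pd i φ x • f x + φ x • pdc i f x := by
  unfold pdc pd
  rw [fderiv_fun_smul (hφ x) (hf x)]
  simp [add_comm]

theorem integral_pd_smul_eq_neg {f : R3 → ℂ} (hf : ContDiff ℝ 1 f) {φ : R3 → ℝ}
    (hφ : IsTestFunction φ) (i : Fin 3) :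
    ∫ x, pd i φ x • f x = -∫ x, φ x • pdc i f x := by
  have h3 := integral_fderiv_eq_zero (f := fun x => φ x • f x)
    ((hφ.1.of_le (by exact_mod_cast le_top)).smul hf) hφ.2.smul_right (basisVec i)
  change ∫ x, pdc i (fun y => φ y • f y) x = 0 at h3
  simp only [pdc_smul (hφ.1.differentiable (by simp)) (hf.differentiable (by simp))] at h3
  rw [integral_add] at h3
  · exact add_eq_zero_iff_eq_neg.1 h3
  · exact ((hφ.continuous_pd i).smul hf.continuous).integrable_of_hasCompactSupport
      (hφ.hasCompactSupport_pd i).smul_right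
  · exact (hφ.1.continuous.smul (continuous_pdc hf i)).integrable_of_hasCompactSupport
      hφ.2.smul_right

/-- An element of `H¹` from a function and its weak partial derivatives. -/
theorem mem_H1_of_weak {p : L2 × (Fin 3 → L2)} {f : R3 → ℂ} {g : Fin 3 → R3 → ℂ}
    (hf : p.1 =ᵐ[volume] f) (hg : ∀ i, p.2 i =ᵐ[volume] g i)
    (h : ∀ φ : R3 → ℝ, IsTestFunction φ → ∀ i, ∫ x, pd i φ x • f x = -∫ x, φ x • g i x) :
    p ∈ H1 := by
  intro φ hφ i
  have h1 : ∫ x, pd i φ x • p.1 x = ∫ x, pd i φ x • f x :=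
    integral_congr_ae (hf.mono fun x hx => by simp only [hx])
  have h2 : ∫ x, φ x • p.2 i x = ∫ x, φ x • g i x :=
    integral_congr_ae ((hg i).mono fun x hx => by simp only [hx])
  rw [h1, h2, h φ hφ i]

/-- A continuously differentiable function with compact support, as an element of `H¹`. -/
def ofC1 (f : R3 → ℂ) (hf : ContDiff ℝ 1 f) (hs : HasCompactSupport f) : H1 :=
  ⟨(toL2 f hf.continuous hs,
    fun i => toL2 (pdc i f) (continuous_pdc hf i) (hasCompactSupport_pdc hs i)),
    mem_H1_of_weak (coeFn_toL2 hf.continuous hs)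
      (fun i => coeFn_toL2 (continuous_pdc hf i) (hasCompactSupport_pdc hs i))
      fun _ hφ i => integral_pd_smul_eq_neg hf hφ i⟩

theorem coeFn_valL_ofC1 {f : R3 → ℂ} (hf : ContDiff ℝ 1 f) (hs : HasCompactSupport f) :
    valL (ofC1 f hf hs) =ᵐ[volume] f := coeFn_toL2 hf.continuous hs

theorem coeFn_gradL_ofC1 {f : R3 → ℂ} (hf : ContDiff ℝ 1 f) (hs : HasCompactSupport f) (i : Fin 3) :
    gradL i (ofC1 f hf hs) =ᵐ[volume] pdc i f :=
  coeFn_toL2 (continuous_pdc hf i) (hasCompactSupport_pdc hs i)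

/-- The elements of `H¹` given by smooth functions with compact support. -/
def smoothH1 : Set H1 :=
  {g | ∃ (f : R3 → ℂ) (hf : ContDiff ℝ ∞ f) (hs : HasCompactSupport f),
    g = ofC1 f (hf.of_le (by exact_mod_cast le_top)) hs}

end Classical

attribute [irreducible] valL gradL mulL liftH1 toL2 ofC1 testL

/-! ### Multipliers on H¹ -/

section Multipliers

/-- A test function as a bounded continuous function. -/
def IsTestFunction.bcf {ψ : R3 → ℝ} (hψ : IsTestFunction ψ) : R3 →ᵇ ℝ :=
  NLSVirial.bcf ψ hψ.1.continuous hψ.2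

@[simp] theorem IsTestFunction.bcf_apply {ψ : R3 → ℝ} (hψ : IsTestFunction ψ) (x : R3) :
    hψ.bcf x = ψ x := rfl

theorem integrable_continuous_smul {ψ : R3 → ℝ} (hψ : Continuous ψ) (hs : HasCompactSupport ψ)
    (f : L2) : Integrable (fun x => ψ x • f x) := integrable_smul_of_L2 hψ hs f

/-- Leibniz' rule, with φψ as the test function in the weak derivative identity of f. -/
theorem weak_smul {ψ : R3 → ℝ} (hψ : IsTestFunction ψ) (f : H1) {φ : R3 → ℝ}
    (hφ : IsTestFunction φ) (i : Fin 3) :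
    ∫ x, pd i φ x • ψ x • valL f x
      = -∫ x, φ x • (ψ x • gradL i f x + pd i ψ x • valL f x) := by
  have hφψ := hφ.mul hψ.1
  have h := H1.weak f hφψ i
  have i1 := integrable_continuous_smul (hφψ.continuous_pd i) (hφψ.hasCompactSupport_pd i)
    (valL f)
  have i2 := integrable_continuous_smul (hφ.mul (hψ.pd i).1).1.continuous
    (hφ.mul (hψ.pd i).1).2 (valL f)
  have i3 := integrable_continuous_smul hφψ.1.continuous hφψ.2 (gradL i f)
  generalize (valL f : R3 → ℂ) = a at *
  generalize (gradL i f : R3 → ℂ) = b at *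
  have e : ∀ x, pd i φ x • ψ x • a x
      = pd i (fun y => φ y * ψ y) x • a x - (φ x * pd i ψ x) • a x := by
    intro x
    simp only [pd_mul (hφ.1.differentiable (by simp)) (hψ.1.differentiable (by simp)),
      Complex.real_smul]
    push_cast
    ring
  have e' : ∀ x, φ x • (ψ x • b x + pd i ψ x • a x)
      = (φ x * ψ x) • b x + (φ x * pd i ψ x) • a x := by
    intro x
    simp only [Complex.real_smul]
    push_cast
    ring
  simp only [e, e']
  rw [integral_sub i1 i2, integral_add i3 i2, h]
  ring

theorem smul_mem_H1 {ψ : R3 → ℝ} (hψ : IsTestFunction ψ) (f : H1) :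
    ((mulL hψ.bcf (valL f), fun i => mulL hψ.bcf (gradL i f) + mulL (hψ.pd i).bcf (valL f)) :
      L2 × (Fin 3 → L2)) ∈ H1 := by
  refine mem_H1_of_weak (f := fun x => ψ x • valL f x)
    (g := fun i x => ψ x • gradL i f x + pd i ψ x • valL f x) (coeFn_mulL _ _) (fun i => ?_)
    (fun φ hφ i => weak_smul hψ f hφ i)
  filter_upwards [coeFn_mulL hψ.bcf (gradL i f), coeFn_mulL (hψ.pd i).bcf (valL f),
    Lp.coeFn_add (mulL hψ.bcf (gradL i f)) (mulL (hψ.pd i).bcf (valL f))] with x h1 h2 h3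
  exact h3.trans (congrArg₂ (· + ·) h1 h2)

/-- Multiplication by a test function on `H¹`. -/
def mulH1 {ψ : R3 → ℝ} (hψ : IsTestFunction ψ) : H1 →L[ℂ] H1 :=
  liftH1 ((mulL hψ.bcf).comp valL)
    (fun i => (mulL hψ.bcf).comp (gradL i) + (mulL (hψ.pd i).bcf).comp valL)
    (fun f => smul_mem_H1 hψ f)

theorem valL_mulH1 {ψ : R3 → ℝ} (hψ : IsTestFunction ψ) (f : H1) :
    valL (mulH1 hψ f) = mulL hψ.bcf (valL f) := by
  exact valL_liftH1 _ _ _ f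

theorem gradL_mulH1 {ψ : R3 → ℝ} (hψ : IsTestFunction ψ) (i : Fin 3) (f : H1) :
    gradL i (mulH1 hψ f) = mulL hψ.bcf (gradL i f) + mulL (hψ.pd i).bcf (valL f) := by
  exact gradL_liftH1 _ _ _ i f

/-- A function which multiplies `H¹` into `L²` does so continuously. -/
def multiplier (m : R3 → ℝ) (h : ∀ f : H1, MemLp (fun x => m x • valL f x) 2 volume) :
    H1 →L[ℂ] L2 :=
  let T : H1 →ₗ[ℂ] L2 :=
    { toFun := fun f => (h f).toLp _
      map_add' := fun f g => by
        refine Lp.ext ?_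
        filter_upwards [(h (f + g)).coeFn_toLp, (h f).coeFn_toLp, (h g).coeFn_toLp,
          Lp.coeFn_add (valL f) (valL g),
          Lp.coeFn_add ((h f).toLp _) ((h g).toLp _)] with x h1 h2 h3 h4 h5
        have e : valL (f + g) = valL f + valL g := map_add valL f g
        refine h1.trans ?_
        simp only [h5, h2, h3, e, h4, Pi.add_apply, smul_add]
      map_smul' := fun c f => by
        refine Lp.ext ?_
        filter_upwards [(h (c • f)).coeFn_toLp, (h f).coeFn_toLp,
          Lp.coeFn_smul c (valL f), Lp.coeFn_smul c ((h f).toLp _)] with x h1 h2 h3 h4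
        have e : valL (c • f) = c • valL f := map_smul valL c f
        refine h1.trans ?_
        simp only [RingHom.id_apply, h4, Pi.smul_apply, h2, e, h3]
        exact smul_comm _ _ _ }
  ⟨T, by
    -- Closed graph theorem: if u_n → f in H¹ and m u_n → y in L², then along a common subsequence
    -- both limits hold almost everywhere, which forces y = m f.
    refine LinearMap.continuous_of_seq_closed_graph T fun u f y hu hy => ?_
    have hv : Tendsto (fun n => valL (u n)) atTop (𝓝 (valL f)) :=
      (valL.continuous.tendsto f).comp hu
    obtain ⟨ns, hns, h1⟩ := (tendstoInMeasure_of_tendsto_Lp hv).exists_seq_tendsto_ae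
    obtain ⟨ms, hms, h2⟩ := (tendstoInMeasure_of_tendsto_Lp
      (hy.comp hns.tendsto_atTop)).exists_seq_tendsto_ae
    refine Lp.ext ?_
    have h3 : ∀ᵐ x, ∀ n, T (u n) x = m x • valL (u n) x :=
      ae_all_iff.2 fun n => (h (u n)).coeFn_toLp
    filter_upwards [h1, h2, h3, (h f).coeFn_toLp] with x h1 h2 h3 h4
    have h5 : Tendsto (fun n => m x • valL (u (ns (ms n))) x) atTop (𝓝 (m x • valL f x)) :=
      ((h1.comp hms.tendsto_atTop).const_smul (m x))
    have h6 : Tendsto (fun n => m x • valL (u (ns (ms n))) x) atTop (𝓝 (y x)) := by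
      refine h2.congr fun n => ?_
      exact h3 _
    change y x = (h f).toLp _ x
    rw [h4, tendsto_nhds_unique h6 h5]⟩

theorem coeFn_multiplier (m : R3 → ℝ) (h : ∀ f : H1, MemLp (fun x => m x • valL f x) 2 volume)
    (f : H1) : multiplier m h f =ᵐ[volume] fun x => m x • valL f x := (h f).coeFn_toLp

end Multipliers

/-! ### Quadratic forms ∫ w f̄ g on H¹ -/

section Forms

/-- A weight `w` such that `w |f|²` is integrable for every `f` in `H¹`. -/
def FormBounded (w : R3 → ℝ) : Prop :=
  AEStronglyMeasurable w volume ∧ ∀ f : H1, Integrable (fun x => w x * ‖valL f x‖ ^ 2)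

namespace FormBounded

variable {w : R3 → ℝ}

/-- The square of √|w| |f| is |w||f|². Splitting w into √|w| and w/√|w| turns the form into an L²
inner product of two multipliers, whose boundedness is automatic. -/
theorem memLp_sqrt (hw : FormBounded w) (f : H1) : MemLp (fun x => √|w x| • valL f x) 2 volume := by
  rw [memLp_two_iff_integrable_sq_norm]
  · refine (hw.2 f).norm.congr (Eventually.of_forall fun x => ?_)
    simp only [norm_mul, norm_smul, Real.norm_eq_abs, norm_pow, mul_pow, sq_abs, abs_norm]
    rw [Real.sq_sqrt (abs_nonneg _)]
  · exact (Real.continuous_sqrt.comp continuous_abs).comp_aestronglyMeasurable hw.1 |>.smul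
      (Lp.aestronglyMeasurable _)

/-- The factor w/√|w| is √|w| times the sign of w; where w = 0 the convention 0/0 = 0 gives the
right value. -/
theorem memLp_div_sqrt (hw : FormBounded w) (f : H1) : MemLp (fun x => (w x / √|w x|) • valL f x) 2 volume := by
  refine (hw.memLp_sqrt f).mono ?_ (Eventually.of_forall fun x => ?_)
  · exact ((hw.1.aemeasurable.div ((Real.continuous_sqrt.comp
      continuous_abs).measurable.comp_aemeasurable hw.1.aemeasurable)).aestronglyMeasurable).smul
      (Lp.aestronglyMeasurable _)
  · rw [norm_smul, norm_smul]
    gcongr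
    rw [Real.norm_eq_abs, Real.norm_eq_abs, abs_div, abs_of_nonneg (Real.sqrt_nonneg _),
      Real.div_sqrt]

end FormBounded

/-- The form `(f, g) ↦ ∫ w f̄ g` on `H¹`, as an inner product of two continuous linear maps. -/
def form {w : R3 → ℝ} (hw : FormBounded w) (f g : H1) : ℂ :=
  ⟪multiplier _ hw.memLp_sqrt f, multiplier _ hw.memLp_div_sqrt g⟫_ℂ

variable {w : R3 → ℝ} (hw : FormBounded w)

theorem form_integrand (f g : H1) (x : R3) :
    ((w x / √|w x|) • valL g x) * (starRingEnd ℂ) (√|w x| • valL f x)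
      = (w x : ℂ) * valL g x * (starRingEnd ℂ) (valL f x) := by
  have h : w x / √|w x| * √|w x| = w x := by
    by_cases h0 : w x = 0
    · simp [h0]
    · exact div_mul_cancel₀ _ (by positivity)
  have h' : (w x : ℂ) = ((w x / √|w x| : ℝ) : ℂ) * ((√|w x| : ℝ) : ℂ) := by
    rw [← Complex.ofReal_mul, h]
  simp only [h', Complex.real_smul, map_mul, Complex.conj_ofReal]
  ring

theorem form_eq (f g : H1) :
    form hw f g = ∫ x, (w x : ℂ) * valL g x * (starRingEnd ℂ) (valL f x) := by
  rw [form, inner_eq_of_ae (coeFn_multiplier _ _ f) (coeFn_multiplier _ _ g)]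
  simp only [form_integrand]

theorem form_integrable (hw : FormBounded w) (f g : H1) :
    Integrable (fun x => (w x : ℂ) * valL g x * (starRingEnd ℂ) (valL f x)) := by
  have := integrable_inner_of_ae (coeFn_multiplier _ hw.memLp_sqrt f)
    (coeFn_multiplier _ hw.memLp_div_sqrt g)
  simpa only [form_integrand] using this

theorem form_self (f : H1) : form hw f f = ((∫ x, w x * ‖valL f x‖ ^ 2 : ℝ) : ℂ) := by
  rw [form_eq, ← integral_complex_ofReal]
  congr 1 with x
  rw [mul_assoc, Complex.mul_conj, Complex.normSq_eq_norm_sq]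
  push_cast
  ring

theorem form_conj_symm (f g : H1) : (starRingEnd ℂ) (form hw f g) = form hw g f := by
  rw [form_eq, form_eq, ← integral_conj]
  congr 1 with x
  simp only [map_mul, Complex.conj_conj, Complex.conj_ofReal]
  ring

theorem form_add_left (f g h : H1) : form hw (f + g) h = form hw f h + form hw g h := by
  simp only [form, map_add, inner_add_left]

theorem continuous_form : Continuous fun p : H1 × H1 => form hw p.1 p.2 := by
  unfold form
  fun_prop

theorem exists_form_bound : ∃ C, 0 ≤ C ∧ ∀ f g, ‖form hw f g‖ ≤ C * ‖f‖ * ‖g‖ := by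
  refine ⟨‖multiplier _ hw.memLp_sqrt‖ * ‖multiplier _ hw.memLp_div_sqrt‖, by positivity,
    fun f g => ?_⟩
  calc ‖form hw f g‖ ≤ ‖multiplier _ hw.memLp_sqrt f‖ * ‖multiplier _ hw.memLp_div_sqrt g‖ :=
        norm_inner_le_norm _ _
    _ ≤ (‖multiplier _ hw.memLp_sqrt‖ * ‖f‖) * (‖multiplier _ hw.memLp_div_sqrt‖ * ‖g‖) := by
        gcongr <;> exact ContinuousLinearMap.le_opNorm _ _
    _ = _ := by ring

theorem formBounded_mul {a : R3 → ℝ} (ha : Continuous a) (hs : HasCompactSupport a)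
    (hw : FormBounded w) : FormBounded (fun x => w x * a x) := by
  obtain ⟨C, hC⟩ := hs.exists_bound_of_continuous ha
  refine ⟨hw.1.mul ha.aestronglyMeasurable, fun f => ?_⟩
  refine ((hw.2 f).bdd_mul (c := C) ha.aestronglyMeasurable (Eventually.of_forall hC)).congr
    (Eventually.of_forall fun x => ?_)
  simp only
  ring

theorem FormBounded.add {w' : R3 → ℝ} (hw : FormBounded w) (hw' : FormBounded w') :
    FormBounded (fun x => w x + w' x) :=
  ⟨hw.1.add hw'.1, fun f => ((hw.2 f).add (hw'.2 f)).congr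
    (Eventually.of_forall fun x => by simp only [Pi.add_apply]; ring)⟩

end Forms

attribute [irreducible] mulH1 multiplier

/-! ### Density arguments and cutoff at infinity -/

section Dense

/-- Strong convergence of uniformly Lipschitz maps follows from convergence on a dense set. -/
theorem tendsto_of_dense {ι E F : Type*} [NormedAddCommGroup E] [NormedAddCommGroup F]
    {l : Filter ι} {T : ι → E → F} {S : E → F} {C : ℝ} {D : Set E} (hD : Dense D)
    (hT : ∀ᶠ n in l, ∀ f g, ‖T n f - T n g‖ ≤ C * ‖f - g‖) (hS : ∀ f g, ‖S f - S g‖ ≤ C * ‖f - g‖)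
    (h : ∀ g ∈ D, Tendsto (fun n => T n g) l (𝓝 (S g))) (f : E) :
    Tendsto (fun n => T n f) l (𝓝 (S f)) := by
  rw [Metric.tendsto_nhds]
  intro ε hε
  have hC : 0 < |C| + 1 := by positivity
  obtain ⟨g, hg, hgD⟩ := Metric.dense_iff.1 hD f (ε / (3 * (|C| + 1))) (by positivity)
  have hfg : ‖f - g‖ < ε / (3 * (|C| + 1)) := by
    rwa [Metric.mem_ball, dist_comm, dist_eq_norm] at hg
  have hb : C * ‖f - g‖ < ε / 3 := by
    calc C * ‖f - g‖ ≤ (|C| + 1) * ‖f - g‖ := by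
          gcongr
          linarith [le_abs_self C]
      _ < (|C| + 1) * (ε / (3 * (|C| + 1))) := by gcongr
      _ = ε / 3 := by field_simp
  filter_upwards [hT, Metric.tendsto_nhds.1 (h g hgD) (ε / 3) (by positivity)] with n h1 h2
  rw [dist_eq_norm] at h2 ⊢
  have e : T n f - S f = (T n f - T n g) + (T n g - S g) + (S g - S f) := by abel
  rw [e]
  have h3 := h1 f g
  have h4 := hS f g
  rw [norm_sub_rev] at h4
  calc _ ≤ ‖T n f - T n g‖ + ‖T n g - S g‖ + ‖S g - S f‖ := norm_add₃_le
    _ < ε := by linarith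

/-- The square integrable functions given by smooth functions with compact support. -/
def smoothL2 : Set L2 :=
  {g | ∃ (f : R3 → ℂ) (hf : ContDiff ℝ ∞ f) (hs : HasCompactSupport f),
    g = toL2 f hf.continuous hs}

theorem dense_smoothL2 : Dense smoothL2 := by
  refine (Lp.dense_hasCompactSupport_contDiff (F := ℂ) (μ := (volume : Measure R3))
    (p := 2) (by simp)).mono ?_
  rintro f ⟨g, hg, hs, hc⟩
  exact ⟨g, hc, hs, Lp.ext (hg.trans (coeFn_toL2 hc.continuous hs).symm)⟩

theorem exists_bump_eq_one {s : Set R3} (hs : Bornology.IsBounded s) :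
    ∃ R : ℝ, 0 < R ∧ ∀ x ∈ s, ‖x‖ ≤ R := by
  obtain ⟨R, hR⟩ := hs.subset_closedBall (0 : R3)
  exact ⟨max R 1, by positivity, fun x hx => by simpa using Or.inl (hR hx)⟩

/-- A standard cutoff function at scale `n + 1`. -/
def cutoff (n : ℕ) (x : R3) : ℝ :=
  (⟨1, 2, by norm_num, by norm_num⟩ : ContDiffBump (0 : R3)) (((n : ℝ) + 1)⁻¹ • x)

theorem isTestFunction_cutoff (n : ℕ) : IsTestFunction (cutoff n) := by
  refine ⟨(ContDiffBump.contDiff _).comp (contDiff_const_smul _), ?_⟩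
  exact (ContDiffBump.hasCompactSupport _).comp_homeomorph
    (Homeomorph.smulOfNeZero (((n : ℝ) + 1)⁻¹) (by positivity))

theorem cutoff_nonneg (n : ℕ) (x : R3) : 0 ≤ cutoff n x := ContDiffBump.nonneg _
theorem cutoff_le_one (n : ℕ) (x : R3) : cutoff n x ≤ 1 := ContDiffBump.le_one _

theorem cutoff_eq_one {n : ℕ} {x : R3} (hx : ‖x‖ ≤ n) : cutoff n x = 1 := by
  refine ContDiffBump.one_of_mem_closedBall _ ?_
  rw [mem_closedBall_zero_iff, norm_smul, norm_inv, Real.norm_of_nonneg (by positivity),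
    inv_mul_le_iff₀ (by positivity)]
  linarith

/-- The chain rule for the dilation by (n+1)⁻¹. This decay kills the commutator of the cutoff with
the gradient. -/
theorem exists_norm_pd_cutoff_le : ∃ C, 0 ≤ C ∧ ∀ n i x, |pd i (cutoff n) x| ≤ C / ((n : ℝ) + 1) := by
  set b : ContDiffBump (0 : R3) := ⟨1, 2, by norm_num, by norm_num⟩ with hb
  have hbt : IsTestFunction b := ⟨b.contDiff, b.hasCompactSupport⟩
  obtain ⟨C, hC⟩ := (hbt.2.fderiv ℝ).exists_bound_of_continuous
    (hbt.1.continuous_fderiv (by simp))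
  refine ⟨C, (norm_nonneg _).trans (hC 0), fun n i x => ?_⟩
  have h : HasFDerivAt (cutoff n) ((fderiv ℝ b (((n : ℝ) + 1)⁻¹ • x)).comp
      (((n : ℝ) + 1)⁻¹ • ContinuousLinearMap.id ℝ R3)) x := by
    have h1 := (hbt.1.differentiable (by simp) (((n : ℝ) + 1)⁻¹ • x)).hasFDerivAt
    have h2 : HasFDerivAt (fun y : R3 => ((n : ℝ) + 1)⁻¹ • y)
        (((n : ℝ) + 1)⁻¹ • ContinuousLinearMap.id ℝ R3) x :=
      (hasFDerivAt_id x).const_smul (((n : ℝ) + 1)⁻¹)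
    exact h1.comp x h2
  rw [pd, h.fderiv]
  simp only [ContinuousLinearMap.comp_apply, smul_apply, ContinuousLinearMap.id_apply, map_smul,
    smul_eq_mul, abs_mul, abs_inv]
  rw [abs_of_nonneg (by positivity : (0 : ℝ) ≤ (n : ℝ) + 1), div_eq_inv_mul]
  gcongr
  have h1 := (fderiv ℝ b (((n : ℝ) + 1)⁻¹ • x)).le_opNorm (basisVec i)
  have h2 : ‖basisVec i‖ = 1 := by simp [basisVec]
  rw [h2, mul_one, Real.norm_eq_abs] at h1
  exact h1.trans (hC _)

/-- The cutoffs are contractions of L², and on a function with compact support the sequence is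
eventually constant. -/
theorem tendsto_mulL_cutoff (f : L2) :
    Tendsto (fun n => mulL (isTestFunction_cutoff n).bcf f) atTop (𝓝 f) := by
  refine tendsto_of_dense (C := 1) (S := id)
    (T := fun n f => mulL (isTestFunction_cutoff n).bcf f) dense_smoothL2
    (Eventually.of_forall fun n f g => ?_) (fun f g => by simp) ?_ f
  · rw [← map_sub]
    refine (norm_mulL_le _ _).trans ?_
    gcongr
    refine (BoundedContinuousFunction.norm_le zero_le_one).2 fun x => ?_
    rw [IsTestFunction.bcf_apply, Real.norm_of_nonneg (cutoff_nonneg n x)]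
    exact cutoff_le_one n x
  · rintro g ⟨f, hf, hs, rfl⟩
    obtain ⟨R, -, hR⟩ := exists_bump_eq_one hs.isCompact.isBounded
    obtain ⟨N, hN⟩ := exists_nat_ge R
    refine tendsto_const_nhds.congr' ?_
    filter_upwards [eventually_ge_atTop N] with n hn
    refine Lp.ext ?_
    filter_upwards [coeFn_toL2 hf.continuous hs,
      coeFn_mulL (isTestFunction_cutoff n).bcf (toL2 f hf.continuous hs)] with x h1 h2
    refine Eq.trans ?_ h2.symm
    rw [IsTestFunction.bcf_apply, id, h1]
    by_cases hx : x ∈ tsupport f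
    · have : (N : ℝ) ≤ n := by exact_mod_cast hn
      rw [cutoff_eq_one ((hR x hx).trans (hN.trans this)), one_smul]
    · rw [image_eq_zero_of_notMem_tsupport hx, smul_zero]

theorem tendsto_mulH1_cutoff (f : H1) :
    Tendsto (fun n => mulH1 (isTestFunction_cutoff n) f) atTop (𝓝 f) := by
  refine tendsto_H1 ?_ fun i => ?_
  · simp only [valL_mulH1]
    exact tendsto_mulL_cutoff _
  · simp only [gradL_mulH1]
    rw [← add_zero (gradL i f)]
    refine (by simpa using tendsto_mulL_cutoff (gradL i f) : Tendsto _ _ _).add ?_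
    obtain ⟨C, hC0, hC⟩ := exists_norm_pd_cutoff_le
    refine squeeze_zero_norm (a := fun n : ℕ => C / ((n : ℝ) + 1) * ‖valL f‖) (fun n => ?_) ?_
    · refine (norm_mulL_le _ _).trans ?_
      gcongr
      exact (BoundedContinuousFunction.norm_le (by positivity)).2 fun x => hC n i x
    · have := (tendsto_const_div_atTop_nhds_zero_nat C).comp (tendsto_add_atTop_nat 1)
      simpa [Function.comp_def] using this.mul_const ‖valL f‖

end Dense

/-! ### Mollification and density of smooth functions in H¹ -/

section Mollify

open scoped Convolution Pointwise
open ContinuousLinearMap (lsmul)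

variable {F : Type*} [NormedAddCommGroup F] [NormedSpace ℝ F]

/-- Convolution with a normalized bump function. -/
def mollify (φ : ContDiffBump (0 : R3)) (f : R3 → F) : R3 → F :=
  φ.normed volume ⋆[lsmul ℝ ℝ, volume] f

theorem mollify_apply (φ : ContDiffBump (0 : R3)) (f : R3 → F) (x : R3) :
    mollify φ f x = ∫ t, φ.normed volume t • f (x - t) := rfl

theorem mollify_apply' (φ : ContDiffBump (0 : R3)) (f : R3 → F) (x : R3) :
    mollify φ f x = ∫ t, φ.normed volume (x - t) • f t := by
  rw [mollify, MeasureTheory.convolution_eq_swap]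
  rfl

theorem continuous_normed (φ : ContDiffBump (0 : R3)) : Continuous (φ.normed volume) :=
  (φ.contDiff_normed (n := 0)).continuous

theorem lintegral_normed (φ : ContDiffBump (0 : R3)) :
    ∫⁻ t, ‖φ.normed volume t‖ₑ = 1 := by
  rw [← ofReal_integral_norm_eq_lintegral_enorm φ.integrable_normed]
  simp_rw [Real.norm_of_nonneg (φ.nonneg_normed _)]
  rw [φ.integral_normed, ENNReal.ofReal_one]

theorem mollify_sub (φ : ContDiffBump (0 : R3)) {f g : R3 → F} (hf : LocallyIntegrable f volume)
    (hg : LocallyIntegrable g volume) : mollify φ (f - g) = mollify φ f - mollify φ g := by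
  ext x
  simp only [mollify_apply', Pi.sub_apply, smul_sub]
  have hc : Continuous fun t => φ.normed volume (x - t) :=
    (continuous_normed φ).comp (continuous_const.sub continuous_id)
  have hs : HasCompactSupport fun t => φ.normed volume (x - t) :=
    φ.hasCompactSupport_normed.comp_homeomorph (Homeomorph.subLeft x)
  exact integral_sub (hf.integrable_smul_left_of_hasCompactSupport hc hs)
    (hg.integrable_smul_left_of_hasCompactSupport hc hs)

theorem continuous_mollify [CompleteSpace F] (φ : ContDiffBump (0 : R3)) {f : R3 → F}
    (hf : LocallyIntegrable f volume) : Continuous (mollify φ f) :=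
  φ.hasCompactSupport_normed.continuous_convolution_left _ (continuous_normed φ) hf

theorem contDiff_mollify [CompleteSpace F] (φ : ContDiffBump (0 : R3)) {f : R3 → F}
    (hf : LocallyIntegrable f volume) : ContDiff ℝ ∞ (mollify φ f) :=
  φ.hasCompactSupport_normed.contDiff_convolution_left (n := ⊤) _ φ.contDiff_normed hf

theorem hasCompactSupport_mollify (φ : ContDiffBump (0 : R3)) {f : R3 → F}
    (hs : HasCompactSupport f) : HasCompactSupport (mollify φ f) :=
  φ.hasCompactSupport_normed.convolution _ hs

/-- Jensen's inequality for the probability density k, obtained from Cauchy–Schwarz with k g =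
k^{1/2} · (k^{1/2} g). -/
theorem lintegral_sq_le {α : Type*} [MeasurableSpace α] {μ : Measure α} {k g : α → ℝ≥0∞}
    (hk : AEMeasurable k μ) (hg : AEMeasurable g μ) (h1 : ∫⁻ t, k t ∂μ = 1) :
    (∫⁻ t, k t * g t ∂μ) ^ 2 ≤ ∫⁻ t, k t * g t ^ 2 ∂μ := by
  have h := ENNReal.lintegral_mul_le_Lp_mul_Lq μ (Real.HolderConjugate.two_two)
    (f := fun t => k t ^ (2⁻¹ : ℝ)) (g := fun t => k t ^ (2⁻¹ : ℝ) * g t)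
    (hk.pow_const _) ((hk.pow_const _).mul hg)
  have e1 : ∀ t, ((fun t => k t ^ (2⁻¹ : ℝ)) * fun t => k t ^ (2⁻¹ : ℝ) * g t) t = k t * g t := by
    intro t
    simp only [Pi.mul_apply]
    rw [← mul_assoc, ← ENNReal.rpow_add_of_nonneg _ _ (by norm_num) (by norm_num)]
    norm_num
  have e2 : ∀ t, (k t ^ (2⁻¹ : ℝ)) ^ (2 : ℝ) = k t := by
    intro t
    rw [← ENNReal.rpow_mul]
    norm_num
  have e3 : ∀ t, (k t ^ (2⁻¹ : ℝ) * g t) ^ (2 : ℝ) = k t * g t ^ 2 := by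
    intro t
    rw [ENNReal.mul_rpow_of_nonneg _ _ (by norm_num), e2, ENNReal.rpow_two]
  simp only [e1, e2, e3, h1, ENNReal.one_rpow, one_mul] at h
  calc (∫⁻ t, k t * g t ∂μ) ^ 2 ≤ ((∫⁻ t, k t * g t ^ 2 ∂μ) ^ (1 / 2 : ℝ)) ^ 2 := by gcongr
    _ = _ := by
      rw [← ENNReal.rpow_two, ← ENNReal.rpow_mul]
      norm_num

/-- Jensen at each point x, then Tonelli and translation invariance of the inner integral. -/
theorem lintegral_mollify_sq_le (φ : ContDiffBump (0 : R3)) {f : R3 → F}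
    (hf : AEStronglyMeasurable f volume) :
    ∫⁻ x, ‖mollify φ f x‖ₑ ^ 2 ≤ ∫⁻ x, ‖f x‖ₑ ^ 2 := by
  have hk : AEMeasurable (fun t => ‖φ.normed volume t‖ₑ) (volume : Measure R3) :=
    (continuous_normed φ).aestronglyMeasurable.enorm
  have hm : AEMeasurable (fun p : R3 × R3 => ‖φ.normed volume p.2‖ₑ * ‖f (p.1 - p.2)‖ₑ ^ 2)
      (volume.prod volume) := by
    have h1 : AEStronglyMeasurable (fun p : R3 × R3 => f (p.1 - p.2)) (volume.prod volume) :=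
      hf.comp_quasiMeasurePreserving (quasiMeasurePreserving_sub _ _)
    exact (((continuous_normed φ).comp continuous_snd).enorm.measurable.aemeasurable).mul
      (h1.enorm.pow_const _)
  calc ∫⁻ x, ‖mollify φ f x‖ₑ ^ 2
      ≤ ∫⁻ x, (∫⁻ t, ‖φ.normed volume t‖ₑ * ‖f (x - t)‖ₑ) ^ 2 := by
        refine lintegral_mono fun x => ?_
        dsimp only
        gcongr
        rw [mollify_apply]
        refine (enorm_integral_le_lintegral_enorm _).trans (le_of_eq ?_)
        simp_rw [enorm_smul]
    _ ≤ ∫⁻ x, ∫⁻ t, ‖φ.normed volume t‖ₑ * ‖f (x - t)‖ₑ ^ 2 := by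
        refine lintegral_mono fun x => lintegral_sq_le hk ?_ (lintegral_normed φ)
        exact (hf.comp_quasiMeasurePreserving
          (quasiMeasurePreserving_sub_left (volume : Measure R3) x)).enorm
    _ = ∫⁻ t, ∫⁻ x, ‖φ.normed volume t‖ₑ * ‖f (x - t)‖ₑ ^ 2 := lintegral_lintegral_swap hm
    _ = ∫⁻ t, ‖φ.normed volume t‖ₑ * ∫⁻ x, ‖f x‖ₑ ^ 2 := by
        refine lintegral_congr fun t => ?_
        rw [lintegral_const_mul' _ _ enorm_ne_top,
          lintegral_sub_right_eq_self (fun x => ‖f x‖ₑ ^ 2) t]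
    _ = ∫⁻ x, ‖f x‖ₑ ^ 2 := by
        rw [lintegral_mul_const'' _ hk, lintegral_normed, one_mul]

theorem eLpNorm_mollify_le (φ : ContDiffBump (0 : R3)) {f : R3 → F}
    (hf : AEStronglyMeasurable f volume) :
    eLpNorm (mollify φ f) 2 volume ≤ eLpNorm f 2 volume := by
  have e : ∀ g : R3 → F, eLpNorm g 2 volume = (∫⁻ x, ‖g x‖ₑ ^ 2) ^ (1 / 2 : ℝ) := by
    intro g
    rw [eLpNorm_eq_lintegral_rpow_enorm_toReal (by simp) (by simp)]
    simp
  rw [e, e]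
  exact ENNReal.rpow_le_rpow (lintegral_mollify_sq_le φ hf) (by norm_num)

theorem locallyIntegrable_L2 (f : L2) : LocallyIntegrable f volume :=
  (Lp.memLp f).locallyIntegrable (by norm_num)

theorem memLp_mollify (φ : ContDiffBump (0 : R3)) (f : L2) : MemLp (mollify φ f) 2 volume :=
  ⟨(continuous_mollify φ (locallyIntegrable_L2 f)).aestronglyMeasurable,
    (eLpNorm_mollify_le φ (Lp.aestronglyMeasurable f)).trans_lt (Lp.memLp f).2⟩

/-- Mollification as a map of `L²`. -/
def mollL (φ : ContDiffBump (0 : R3)) (f : L2) : L2 := (memLp_mollify φ f).toLp _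

theorem mollify_congr_ae (φ : ContDiffBump (0 : R3)) {f g : R3 → F} (h : f =ᵐ[volume] g) :
    mollify φ f = mollify φ g := by
  ext x
  rw [mollify_apply', mollify_apply']
  refine integral_congr_ae ?_
  filter_upwards [h] with t ht
  rw [ht]

theorem norm_mollL_sub_le (φ : ContDiffBump (0 : R3)) (f g : L2) :
    ‖mollL φ f - mollL φ g‖ ≤ ‖f - g‖ := by
  rw [mollL, mollL, ← MemLp.toLp_sub, Lp.norm_toLp, Lp.norm_def]
  refine ENNReal.toReal_mono (Lp.eLpNorm_ne_top _) ?_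
  rw [← mollify_sub φ (locallyIntegrable_L2 f) (locallyIntegrable_L2 g),
    mollify_congr_ae φ (Lp.coeFn_sub f g).symm]
  exact eLpNorm_mollify_le φ (Lp.aestronglyMeasurable _)

/-- A standard bump function at scale `1 / (n + 1)`. -/
def bump (n : ℕ) : ContDiffBump (0 : R3) :=
  ⟨1 / (2 * ((n : ℝ) + 1)), 1 / ((n : ℝ) + 1), by positivity, by
    rw [one_div_lt_one_div (by positivity) (by positivity)]
    have : (0 : ℝ) < (n : ℝ) + 1 := by positivity
    linarith⟩

theorem tendsto_rOut_bump : Tendsto (fun n => (bump n).rOut) atTop (𝓝 0) :=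
  tendsto_one_div_add_atTop_nhds_zero_nat

theorem tendstoUniformly_mollify_bump [CompleteSpace F] {f : R3 → F} (hf : Continuous f)
    (hs : HasCompactSupport f) {ε : ℝ} (hε : 0 < ε) :
    ∀ᶠ n in atTop, ∀ x, dist (mollify (bump n) f x) (f x) ≤ ε := by
  obtain ⟨δ, hδ, h⟩ := Metric.uniformContinuous_iff.1 (hs.uniformContinuous_of_continuous hf) ε hε
  filter_upwards [tendsto_rOut_bump.eventually (gt_mem_nhds hδ)] with n hn x
  refine (bump n).dist_normed_convolution_le hf.aestronglyMeasurable fun y hy => ?_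
  exact (h ((Metric.mem_ball.1 hy).trans hn)).le

/-- All mollifications of `f` at scale at most `1` vanish outside a fixed compact set. -/
theorem exists_compact_mollify {f : R3 → F} (hs : HasCompactSupport f) :
    ∃ K : Set R3, IsCompact K ∧ Function.support f ⊆ K ∧
      ∀ n, Function.support (mollify (bump n) f) ⊆ K := by
  refine ⟨Metric.closedBall 0 1 + tsupport f,
    (isCompact_closedBall _ _).add hs.isCompact, ?_, fun n => ?_⟩
  · intro x hx
    exact ⟨0, by simp, x, subset_tsupport f hx, by simp⟩
  · refine (support_convolution_subset _).trans ?_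
    rw [(bump n).support_normed_eq]
    refine Set.add_subset_add ?_ (subset_tsupport f)
    refine Metric.ball_subset_closedBall.trans (Metric.closedBall_subset_closedBall ?_)
    change 1 / ((n : ℝ) + 1) ≤ 1
    rw [div_le_one (by positivity)]
    linarith [(Nat.cast_nonneg n : (0 : ℝ) ≤ n)]

/-- Mollifications are contractions of L², so smooth compactly supported functions suffice; for
these the convergence is uniform and all supports lie in one compact set. -/
theorem tendsto_mollL (f : L2) : Tendsto (fun n => mollL (bump n) f) atTop (𝓝 f) := by
  refine tendsto_of_dense (C := 1) (S := id) (T := fun n f => mollL (bump n) f) dense_smoothL2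
    (Eventually.of_forall fun n f g => ?_) (fun f g => by simp) ?_ f
  · rw [one_mul]
    exact norm_mollL_sub_le _ f g
  · rintro _ ⟨g, hg, hs, rfl⟩
    obtain ⟨K, hK, h1, h2⟩ := exists_compact_mollify hs
    have hKf : volume K < ⊤ := hK.measure_lt_top
    rw [Metric.tendsto_nhds]
    intro ε hε
    -- The factor |K|^{1/2} converts a uniform bound on K into an L² bound; adding 1 to it avoids a
    -- division by zero.
    set c : ℝ := (volume K ^ (1 / 2 : ℝ)).toReal with hc
    have hc0 : 0 ≤ c := ENNReal.toReal_nonneg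
    have hcK : volume K ^ (1 / 2 : ℝ) ≠ ⊤ := by
      exact ENNReal.rpow_ne_top_of_nonneg (by norm_num) hKf.ne
    filter_upwards [tendstoUniformly_mollify_bump hg.continuous hs
      (show 0 < ε / (2 * (c + 1)) by positivity)] with n hn
    have e1 : mollL (bump n) (toL2 g hg.continuous hs) =ᵐ[volume] mollify (bump n) g := by
      rw [← mollify_congr_ae (bump n) (coeFn_toL2 hg.continuous hs)]
      exact MemLp.coeFn_toLp _
    rw [id, dist_eq_norm, Lp.norm_def]
    have e2 : eLpNorm (mollL (bump n) (toL2 g hg.continuous hs) - toL2 g hg.continuous hs : L2) 2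
        volume = eLpNorm (mollify (bump n) g - g) 2 volume := by
      refine eLpNorm_congr_ae ?_
      filter_upwards [Lp.coeFn_sub (mollL (bump n) (toL2 g hg.continuous hs))
        (toL2 g hg.continuous hs), e1, coeFn_toL2 hg.continuous hs] with x hx h3 h4
      simp only [hx, Pi.sub_apply, h3, h4]
    rw [e2]
    have e3 := eLpNorm_sub_le_of_dist_bdd volume (p := 2) (by simp) hK.measurableSet
      (show 0 ≤ ε / (2 * (c + 1)) by positivity) hn (h2 n) h1
    have e4 : ENNReal.ofReal (ε / (2 * (c + 1))) * volume K ^ (1 / (2 : ℝ≥0∞).toReal) =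
        ENNReal.ofReal (ε / (2 * (c + 1)) * c) := by
      rw [ENNReal.ofReal_mul (by positivity), hc, ENNReal.ofReal_toReal hcK]
      simp
    rw [e4] at e3
    refine (ENNReal.toReal_mono ENNReal.ofReal_ne_top e3).trans_lt ?_
    rw [ENNReal.toReal_ofReal (by positivity)]
    calc ε / (2 * (c + 1)) * c ≤ ε / (2 * (c + 1)) * (c + 1) := by gcongr; linarith
      _ = ε / 2 := by field_simp
      _ < ε := by linarith

theorem pd_normed_sub (φ : ContDiffBump (0 : R3)) (i : Fin 3) (x y : R3) :
    pd i (fun y => φ.normed volume (x - y)) y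
      = -fderiv ℝ (φ.normed volume) (x - y) (basisVec i) := by
  have h : HasFDerivAt (fun y => φ.normed volume (x - y))
      ((fderiv ℝ (φ.normed volume) (x - y)).comp (-ContinuousLinearMap.id ℝ R3)) y := by
    have h1 := ((φ.contDiff_normed (n := 1) (μ := (volume : Measure R3))).differentiable
      (by simp) (x - y)).hasFDerivAt
    exact h1.comp y ((hasFDerivAt_id y).const_sub x)
  rw [pd, h.fderiv]
  simp

/-- The derivative falls on the kernel, where it becomes a derivative of a test function; this is
what lets the weak derivative of f enter afterwards. -/
theorem fderiv_mollify_apply (φ : ContDiffBump (0 : R3)) {f : R3 → ℂ}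
    (hf : LocallyIntegrable f volume) (x v : R3) :
    fderiv ℝ (mollify φ f) x v = ∫ t, fderiv ℝ (φ.normed volume) (x - t) v • f t := by
  have h := φ.hasCompactSupport_normed.hasFDerivAt_convolution_left (lsmul ℝ ℝ)
    (φ.contDiff_normed (n := 1) (μ := (volume : Measure R3))) hf x
  rw [mollify, h.fderiv, MeasureTheory.convolution_eq_swap]
  rw [ContinuousLinearMap.integral_apply]
  · rfl
  · exact ((φ.hasCompactSupport_normed.fderiv ℝ).convolutionExists_left _
      ((φ.contDiff_normed (n := 1)).continuous_fderiv (by simp)) hf x).integrable_swap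

/-- Mollification commutes with weak derivatives. -/
theorem pdc_mollify (φ : ContDiffBump (0 : R3)) (f : H1) (i : Fin 3) :
    pdc i (mollify φ (valL f)) = mollify φ (gradL i f) := by
  ext x
  rw [pdc, fderiv_mollify_apply φ (locallyIntegrable_L2 _), mollify_apply']
  have ht : IsTestFunction fun y => φ.normed volume (x - y) :=
    ⟨φ.contDiff_normed.comp (contDiff_const.sub contDiff_id),
      φ.hasCompactSupport_normed.comp_homeomorph (Homeomorph.subLeft x)⟩
  have h := H1.weak f ht i
  simp only [pd_normed_sub, neg_smul, integral_neg, neg_inj] at h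
  exact h

/-- Cut off at infinity, then mollify. Since mollification commutes with weak derivatives, its L²
convergence applies to the gradient as well as to the function. -/
theorem dense_smoothH1 : Dense smoothH1 := by
  intro f
  have key : ∀ n, mulH1 (isTestFunction_cutoff n) f ∈ closure smoothH1 := by
    intro n
    set g := mulH1 (isTestFunction_cutoff n) f with hg
    have hae : valL g =ᵐ[volume] fun x => cutoff n x • valL f x := by
      rw [hg, valL_mulH1]
      exact coeFn_mulL _ _
    have hs : ∀ m, HasCompactSupport (mollify (bump m) (valL g)) := by
      intro m
      rw [mollify_congr_ae _ hae]
      exact hasCompactSupport_mollify _ (isTestFunction_cutoff n).2.smul_right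
    have hd : ∀ m, ContDiff ℝ ∞ (mollify (bump m) (valL g)) := fun m =>
      contDiff_mollify _ (locallyIntegrable_L2 _)
    refine mem_closure_of_tendsto (f := fun m => ofC1 (mollify (bump m) (valL g))
      ((hd m).of_le (by exact_mod_cast le_top)) (hs m)) (b := atTop) ?_
      (Eventually.of_forall fun m => ⟨_, hd m, hs m, rfl⟩)
    refine tendsto_H1 ?_ fun i => ?_
    · refine (tendsto_mollL (valL g)).congr fun m => Lp.ext ?_
      exact (MemLp.coeFn_toLp _).trans (coeFn_valL_ofC1 _ _).symm
    · refine (tendsto_mollL (gradL i g)).congr fun m => Lp.ext ?_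
      refine (MemLp.coeFn_toLp _).trans ?_
      rw [← pdc_mollify]
      exact (coeFn_gradL_ofC1 _ _ i).symm
  have := mem_closure_of_tendsto (tendsto_mulH1_cutoff f) (Eventually.of_forall key)
  rwa [closure_closure] at this

end Mollify

/-! ### The Sobolev embedding H¹ ⊆ L⁶ and the cubic nonlinearity -/

section Sobolev

instance : Fact ((1 : ℝ≥0∞) ≤ 6) := ⟨by norm_num⟩
instance : Fact ((1 : ℝ≥0∞) ≤ 3) := ⟨by norm_num⟩

theorem norm_fderiv_le (f : R3 → ℂ) (x : R3) : ‖fderiv ℝ f x‖ ≤ ∑ i, ‖pdc i f x‖ := by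
  refine ContinuousLinearMap.opNorm_le_bound _ (by positivity) fun v => ?_
  have hv : v = ∑ i, v i • basisVec i := by
    ext j
    fin_cases j <;> simp [Fin.sum_univ_three, basisVec]
  conv_lhs => rw [hv]
  rw [map_sum, Finset.sum_mul]
  refine (norm_sum_le _ _).trans (Finset.sum_le_sum fun i _ => ?_)
  rw [map_smul, norm_smul, mul_comm]
  exact mul_le_mul_of_nonneg_left (PiLp.norm_apply_le v i) (norm_nonneg _)

theorem eLpNorm_fderiv_le {f : R3 → ℂ} (hf : ContDiff ℝ 1 f) (hs : HasCompactSupport f) :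
    eLpNorm (fderiv ℝ f) 2 volume ≤ ENNReal.ofReal (3 * ‖ofC1 f hf hs‖) := by
  have h1 : eLpNorm (fderiv ℝ f) 2 volume
      ≤ eLpNorm (∑ i, fun x => ‖pdc i f x‖) 2 volume := by
    refine eLpNorm_mono_real fun x => ?_
    simpa using norm_fderiv_le f x
  refine h1.trans ((eLpNorm_sum_le (fun i _ =>
    (continuous_pdc hf i).norm.aestronglyMeasurable) (by norm_num)).trans ?_)
  have h2 : ∀ i, eLpNorm (fun x => ‖pdc i f x‖) 2 volume ≤ ENNReal.ofReal ‖ofC1 f hf hs‖ := by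
    intro i
    rw [eLpNorm_norm, ← eLpNorm_congr_ae (coeFn_gradL_ofC1 hf hs i), ← Lp.enorm_def,
      ← ofReal_norm]
    exact ENNReal.ofReal_le_ofReal (norm_gradL_le i _)
  refine (Finset.sum_le_sum fun i _ => h2 i).trans (le_of_eq ?_)
  rw [Finset.sum_const, Finset.card_univ, Fintype.card_fin, nsmul_eq_mul,
    ENNReal.ofReal_mul (by norm_num)]
  norm_num

/-- Gagliardo–Nirenberg–Sobolev in dimension 3, with 1/6 = 1/2 - 1/3. -/
theorem exists_gns_const : ∃ C : ℝ≥0, ∀ f : R3 → ℂ, ContDiff ℝ 1 f → HasCompactSupport f →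
    eLpNorm f 6 volume ≤ C * eLpNorm (fderiv ℝ f) 2 volume :=
  ⟨_, fun _ hf hs => eLpNorm_le_eLpNorm_fderiv_of_eq (volume : Measure R3) hf hs (p := 2) (p' := 6)
    (by norm_num) (by simp) (by simp; norm_num)⟩

theorem eLpNorm_ofC1_le {C : ℝ≥0} (hC : ∀ f : R3 → ℂ, ContDiff ℝ 1 f → HasCompactSupport f →
    eLpNorm f 6 volume ≤ C * eLpNorm (fderiv ℝ f) 2 volume) {f : R3 → ℂ} (hf : ContDiff ℝ 1 f)
    (hs : HasCompactSupport f) :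
    eLpNorm (valL (ofC1 f hf hs)) 6 volume ≤ ENNReal.ofReal (C * 3 * ‖ofC1 f hf hs‖) := by
  rw [eLpNorm_congr_ae (coeFn_valL_ofC1 hf hs)]
  refine ((hC f hf hs).trans (mul_le_mul_right (eLpNorm_fderiv_le hf hs) _)).trans (le_of_eq ?_)
  rw [mul_assoc, ENNReal.ofReal_mul (p := (C : ℝ)) (by positivity), ENNReal.ofReal_coe_nnreal]

/-- Fatou's lemma along an almost everywhere convergent subsequence of smooth approximations. -/
theorem exists_sobolev_const : ∃ C : ℝ, 0 ≤ C ∧ ∀ f : H1,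
    eLpNorm (valL f) 6 volume ≤ ENNReal.ofReal (C * ‖f‖) := by
  obtain ⟨C, hC⟩ := exists_gns_const
  have hsm : ∀ g ∈ smoothH1, eLpNorm (valL g) 6 volume ≤ ENNReal.ofReal (C * 3 * ‖g‖) := by
    rintro _ ⟨f, hf, hs, rfl⟩
    exact eLpNorm_ofC1_le hC _ hs
  refine ⟨C * 3, by positivity, fun f => ?_⟩
  obtain ⟨g, hg, hgf⟩ := mem_closure_iff_seq_limit.1 (dense_smoothH1 f)
  obtain ⟨ns, hns, h1⟩ := (tendstoInMeasure_of_tendsto_Lp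
    ((valL.continuous.tendsto f).comp hgf)).exists_seq_tendsto_ae
  refine (Lp.eLpNorm_lim_le_liminf_eLpNorm
    (fun n => Lp.aestronglyMeasurable (valL (g (ns n)))) _ h1).trans ?_
  have h2 : Tendsto (fun n => ENNReal.ofReal (C * 3 * ‖g (ns n)‖)) atTop
      (𝓝 (ENNReal.ofReal (C * 3 * ‖f‖))) :=
    (ENNReal.continuous_ofReal.tendsto _).comp
      ((hgf.norm.comp hns.tendsto_atTop).const_mul _)
  rw [← h2.liminf_eq]
  exact liminf_le_liminf (Eventually.of_forall fun n => hsm _ (hg _))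

theorem memLp_six (f : H1) : MemLp (valL f) 6 volume := by
  obtain ⟨C, -, hC⟩ := exists_sobolev_const
  exact ⟨Lp.aestronglyMeasurable _, (hC f).trans_lt ENNReal.ofReal_lt_top⟩

instance : ENNReal.HolderTriple 6 6 3 := ⟨by
  have : (6 : ℝ≥0∞) = 2 * 3 := by norm_num
  rw [this, ENNReal.mul_inv (by simp) (by simp), ← add_mul, ENNReal.inv_two_add_inv_two, one_mul]⟩

instance : ENNReal.HolderTriple 3 6 2 := ⟨by
  rw [← ENNReal.toReal_eq_toReal_iff' (by simp) (by simp), ENNReal.toReal_add (by simp) (by simp)]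
  simp
  norm_num⟩

theorem toLp_six_add (f g : H1) : (memLp_six (f + g)).toLp _
    = (memLp_six f).toLp _ + (memLp_six g).toLp _ := by
  refine Lp.ext ?_
  filter_upwards [(memLp_six (f + g)).coeFn_toLp, (memLp_six f).coeFn_toLp,
    (memLp_six g).coeFn_toLp, Lp.coeFn_add (valL f) (valL g),
    Lp.coeFn_add ((memLp_six f).toLp _) ((memLp_six g).toLp _)] with x h1 h2 h3 h4 h5
  have e : valL (f + g) = valL f + valL g := map_add valL f g
  refine h1.trans ?_
  simp only [h5, h2, h3, e, h4, Pi.add_apply]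

theorem toLp_six_smul (c : ℂ) (f : H1) : (memLp_six (c • f)).toLp _
    = c • (memLp_six f).toLp _ := by
  refine Lp.ext ?_
  filter_upwards [(memLp_six (c • f)).coeFn_toLp, (memLp_six f).coeFn_toLp,
    Lp.coeFn_smul c (valL f), Lp.coeFn_smul c ((memLp_six f).toLp _)] with x h1 h2 h3 h4
  have e : valL (c • f) = c • valL f := map_smul valL c f
  refine h1.trans ?_
  simp only [h4, Pi.smul_apply, h2, e, h3]

/-- The Sobolev embedding `H¹ ⊆ L⁶`. -/
def sixL : H1 →L[ℂ] Lp ℂ 6 (volume : Measure R3) :=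
  LinearMap.mkContinuousOfExistsBound
    { toFun := fun f => (memLp_six f).toLp _
      map_add' := toLp_six_add
      map_smul' := toLp_six_smul }
    (by
      obtain ⟨C, hC0, hC⟩ := exists_sobolev_const
      refine ⟨C, fun f => ?_⟩
      change ‖(memLp_six f).toLp _‖ ≤ _
      rw [Lp.norm_toLp]
      exact ENNReal.toReal_le_of_le_ofReal (by positivity) (hC f))

theorem coeFn_sixL (f : H1) : sixL f =ᵐ[volume] valL f := (memLp_six f).coeFn_toLp

theorem coeFn_holder_mul {p q r : ℝ≥0∞} [p.HolderTriple q r] [Fact (1 ≤ p)] [Fact (1 ≤ q)]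
    [Fact (1 ≤ r)] (f : Lp ℂ p (volume : Measure R3)) (g : Lp ℂ q (volume : Measure R3)) :
    (ContinuousLinearMap.mul ℂ ℂ).holderL volume p q r f g =ᵐ[volume] fun x => f x * g x :=
  (ContinuousLinearMap.mul ℂ ℂ).coeFn_holder (r := r) f g

/-- The map `f ↦ |f|²` from `L⁶` to `L³`. -/
def sqMod (f : Lp ℂ 6 (volume : Measure R3)) : Lp ℂ 3 (volume : Measure R3) :=
  (ContinuousLinearMap.mul ℂ ℂ).holderL volume 6 6 3 f
    ((Complex.conjCLE : ℂ →L[ℝ] ℂ).compLpL 6 volume f)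

theorem continuous_sqMod : Continuous sqMod :=
  ((ContinuousLinearMap.holderL volume 6 6 3 (ContinuousLinearMap.mul ℂ ℂ)).continuous).clm_apply
    (((Complex.conjCLE : ℂ →L[ℝ] ℂ).compLpL 6 (volume : Measure R3)).continuous)

theorem coeFn_sqMod (f : Lp ℂ 6 (volume : Measure R3)) :
    sqMod f =ᵐ[volume] fun x => ((‖f x‖ ^ 2 : ℝ) : ℂ) := by
  filter_upwards [coeFn_holder_mul (r := 3) f ((Complex.conjCLE : ℂ →L[ℝ] ℂ).compLpL 6 volume f),
    (Complex.conjCLE : ℂ →L[ℝ] ℂ).coeFn_compLpL f] with x h1 h2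
  refine h1.trans ?_
  rw [h2, ← Complex.normSq_eq_norm_sq, ← Complex.mul_conj]
  rfl

/-- The nonlinearity `|u|² u`, as a map `H¹ → L²`. -/
def cubic (u : H1) : L2 :=
  (ContinuousLinearMap.mul ℂ ℂ).holderL volume 3 6 2 (sqMod (sixL u)) (sixL u)

/-- The nonlinearity is a composition of continuous bilinear Hölder products L⁶ × L⁶ → L³ and L³ ×
L⁶ → L² with the embedding, so its continuity needs no difference estimate. -/
theorem continuous_cubic : Continuous cubic :=
  ((ContinuousLinearMap.holderL volume 3 6 2 (ContinuousLinearMap.mul ℂ ℂ)).continuous.comp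
    (continuous_sqMod.comp sixL.continuous)).clm_apply sixL.continuous

theorem coeFn_cubic (u : H1) :
    cubic u =ᵐ[volume] fun x => ((‖valL u x‖ ^ 2 : ℝ) : ℂ) * valL u x := by
  filter_upwards [coeFn_holder_mul (r := 2) (sqMod (sixL u)) (sixL u), coeFn_sqMod (sixL u),
    coeFn_sixL u] with x h1 h2 h3
  rw [← h3]
  exact h1.trans (congrArg (· * sixL u x) h2)

/-- Hölder: |f|² ∈ L³ by the Sobolev embedding, and 2/3 + 1/3 = 1. -/
theorem formBounded_of_memLp {V : R3 → ℝ} (hV : MemLp V (3 / 2 : ℝ≥0∞) volume) :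
    FormBounded V := by
  refine ⟨hV.1, fun f => ?_⟩
  have h6 := (memLp_six f).norm
  have h3 : MemLp (fun x => ‖valL f x‖ * ‖valL f x‖) 3 volume := h6.mul' h6
  have : ENNReal.HolderTriple (3 / 2 : ℝ≥0∞) 3 1 := ⟨by
    rw [← ENNReal.toReal_eq_toReal_iff' (by simp) (by simp),
      ENNReal.toReal_add (by simp) (by simp)]
    simp
    norm_num⟩
  have := h3.mul' (r := 1) hV
  simpa only [pow_two] using memLp_one_iff_integrable.1 this

end Sobolev

attribute [irreducible] sixL sqMod cubic

/-! ### Flows of bounded Lipschitz vector fields -/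

section Flow

/-- `Φ` is the flow of the autonomous vector field `X`. -/
structure IsFlow {E : Type*} [NormedAddCommGroup E] [NormedSpace ℝ E] (X : E → E)
    (Φ : ℝ → E → E) : Prop where
  zero : ∀ x, Φ 0 x = x
  hasDerivAt : ∀ x t, HasDerivAt (fun s => Φ s x) (X (Φ t x)) t

/-- Grönwall's inequality in both time directions. -/
theorem norm_le_of_norm_deriv_le {F : Type*} [NormedAddCommGroup F] [NormedSpace ℝ F]
    {f f' : ℝ → F} {δ K ε s : ℝ} (hK : 1 ≤ K) (hδ : 0 ≤ δ) (hε : 0 ≤ ε) (hs : |s| ≤ 1)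
    (hf : ∀ t, |t| ≤ |s| → HasDerivAt f (f' t) t) (h0 : ‖f 0‖ ≤ δ)
    (hb : ∀ t, |t| ≤ |s| → ‖f' t‖ ≤ K * ‖f t‖ + ε) : ‖f s‖ ≤ (δ + ε) * Real.exp K := by
  -- Forward time only; for s ≤ 0 it is applied to t ↦ f(-t). The assumption 1 ≤ K serves to bound
  -- ε/K by ε.
  have key : ∀ (g g' : ℝ → F), (∀ t, |t| ≤ |s| → HasDerivAt g (g' t) t) → ‖g 0‖ ≤ δ →
      (∀ t, |t| ≤ |s| → ‖g' t‖ ≤ K * ‖g t‖ + ε) → ‖g |s|‖ ≤ (δ + ε) * Real.exp K := by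
    intro g g' hg hg0 hgb
    have hi : ∀ t ∈ Icc (0 : ℝ) |s|, |t| ≤ |s| := fun t ht => by
      rw [abs_of_nonneg ht.1]
      exact ht.2
    have h := norm_le_gronwallBound_of_norm_deriv_right_le (f := g) (f' := g') (a := 0) (b := |s|)
      (fun t ht => (hg t (hi t ht)).continuousAt.continuousWithinAt)
      (fun t ht => (hg t (hi t (Ico_subset_Icc_self ht))).hasDerivWithinAt) hg0
      (fun t ht => hgb t (hi t (Ico_subset_Icc_self ht))) |s| ⟨abs_nonneg s, le_rfl⟩
    refine h.trans ?_
    rw [gronwallBound_of_K_ne_0 (by positivity), sub_zero]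
    have h1 : Real.exp (K * |s|) ≤ Real.exp K :=
      Real.exp_le_exp.2 (by nlinarith [abs_nonneg s])
    have h2 : ε / K ≤ ε := div_le_self hε hK
    have h3 : 0 ≤ Real.exp (K * |s|) - 1 := by
      have := Real.one_le_exp (show 0 ≤ K * |s| by positivity)
      linarith
    calc δ * Real.exp (K * |s|) + ε / K * (Real.exp (K * |s|) - 1)
        ≤ δ * Real.exp K + ε * Real.exp K := by
          gcongr
          linarith
      _ = _ := by ring
  rcases le_total 0 s with h | h
  · have := key f f' hf h0 hb
    rwa [abs_of_nonneg h] at this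
  · have := key (fun t => f (-t)) (fun t => -f' (-t)) (fun t ht => ?_) (by simpa using h0)
      (fun t ht => ?_)
    · simpa [abs_of_nonpos h] using this
    · have h1 := hf (-t) (by rwa [abs_neg])
      have h2 := HasDerivAt.scomp t h1 (hasDerivAt_neg t)
      simpa [Function.comp_def] using h2
    · rw [norm_neg]
      exact hb (-t) (by rwa [abs_neg])

variable {E : Type*} [NormedAddCommGroup E] [NormedSpace ℝ E] {X : E → E} {Φ : ℝ → E → E}
  {K M : ℝ≥0}

/-- A field bounded by M cannot leave the ball of radius M a in time a, so Picard–Lindelöf works on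
[-a, a] for every a; uniqueness glues the solutions together. -/
theorem exists_isFlow [CompleteSpace E] (hX : LipschitzWith K X) (hM : ∀ x, ‖X x‖ ≤ M) :
    ∃ Φ : ℝ → E → E, IsFlow X Φ := by
  have loc : ∀ (x : E) (a : ℝ), ∃ α : ℝ → E, 0 < a → α 0 = x ∧
      ∀ t ∈ Ioo (-a) a, HasDerivAt α (X (α t)) t := by
    intro x a
    by_cases ha : 0 < a
    · have h0 : (0 : ℝ) ∈ Icc (-a) a := ⟨by linarith, ha.le⟩
      have hp : IsPicardLindelof (fun _ => X) (⟨0, h0⟩ : Icc (-a) a) x (M * a.toNNReal) 0 M K :=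
        { lipschitzOnWith := fun t _ => hX.lipschitzOnWith
          continuousOn := fun y _ => continuousOn_const
          norm_le := fun t _ y _ => hM y
          mul_max_le := by
            simp [ha.le] }
      obtain ⟨α, h1, h2⟩ := hp.exists_eq_forall_mem_Icc_hasDerivWithinAt₀
      exact ⟨α, fun _ => ⟨h1, fun t ht =>
        (h2 t (Ioo_subset_Icc_self ht)).hasDerivAt (Icc_mem_nhds ht.1 ht.2)⟩⟩
    · exact ⟨fun _ => x, fun h => absurd h ha⟩
  choose α hα using loc
  have huniq : ∀ x a b, 0 < a → a ≤ b → EqOn (α x a) (α x b) (Ioo (-a) a) := by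
    intro x a b ha hab
    refine ODE_solution_unique_of_mem_Ioo (v := fun _ => X) (s := fun _ => univ) (K := K) (t₀ := 0)
      (fun t _ => hX.lipschitzOnWith) ⟨by linarith, ha⟩
      (fun t ht => ⟨(hα x a ha).2 t ht, trivial⟩)
      (fun t ht => ⟨(hα x b (ha.trans_le hab)).2 t ⟨by linarith [ht.1], by linarith [ht.2]⟩,
        trivial⟩) ?_
    rw [(hα x a ha).1, (hα x b (ha.trans_le hab)).1]
  -- The value at s is read off the solution on the interval of half-length |s| + 1, which contains
  -- s in its interior. For s near t these values agree with the single solution of half-length |t|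
  -- + 2, so differentiability is inherited from it.
  refine ⟨fun s x => α x (|s| + 1) s, fun x => ?_, fun x t => ?_⟩
  · exact (hα x (|(0 : ℝ)| + 1) (by positivity)).1
  · have hpos : 0 < |t| + 2 := by positivity
    have ht : t ∈ Ioo (-(|t| + 2)) (|t| + 2) :=
      ⟨by linarith [neg_abs_le t], by linarith [le_abs_self t]⟩
    have h1 := (hα x (|t| + 2) hpos).2 t ht
    have hm : ∀ s, |s| < |t| + 1 → α x (|s| + 1) s = α x (|t| + 2) s := by
      intro s hs
      exact huniq x (|s| + 1) (|t| + 2) (by positivity) (by linarith)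
        ⟨by linarith [neg_abs_le s], by linarith [le_abs_self s]⟩
    have he : (fun s => α x (|s| + 1) s) =ᶠ[𝓝 t] α x (|t| + 2) := by
      have : {s : ℝ | |s| < |t| + 1} ∈ 𝓝 t :=
        (isOpen_lt continuous_abs continuous_const).mem_nhds (by simp)
      filter_upwards [this] with s hs using hm s hs
    rw [hm t (by linarith)]
    exact h1.congr_of_eventuallyEq he

namespace IsFlow

theorem add (h : IsFlow X Φ) (hX : LipschitzWith K X) (s t : ℝ) (x : E) :
    Φ (s + t) x = Φ s (Φ t x) := by
  have h1 : (fun r => Φ (r + t) x) = fun r => Φ r (Φ t x) := by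
    refine ODE_solution_unique_univ (v := fun _ => X) (s := fun _ => univ) (K := K) (t₀ := 0)
      (fun r => hX.lipschitzOnWith) (fun r => ⟨?_, trivial⟩)
      (fun r => ⟨h.hasDerivAt _ r, trivial⟩) (by simp [h.zero])
    exact (h.hasDerivAt x (r + t)).comp_add_const r t
  exact congrFun h1 s

theorem neg_apply (h : IsFlow X Φ) (hX : LipschitzWith K X) (s : ℝ) (x : E) :
    Φ (-s) (Φ s x) = x := by
  rw [← h.add hX, neg_add_cancel, h.zero]

theorem eq_self (h : IsFlow X Φ) (hX : LipschitzWith K X) {x : E} (hx : X x = 0) (s : ℝ) :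
    Φ s x = x := by
  have h1 : (fun r => Φ r x) = fun _ => x := by
    refine ODE_solution_unique_univ (v := fun _ => X) (s := fun _ => univ) (K := K) (t₀ := 0)
      (fun r => hX.lipschitzOnWith) (fun r => ⟨h.hasDerivAt _ r, trivial⟩)
      (fun r => ⟨?_, trivial⟩) (h.zero x)
    rw [hx]
    exact hasDerivAt_const r x
  exact congrFun h1 s

theorem norm_sub_self_le (h : IsFlow X Φ) (hM : ∀ x, ‖X x‖ ≤ M) (s : ℝ) (x : E) :
    ‖Φ s x - x‖ ≤ M * |s| := by
  have := convex_univ.norm_image_sub_le_of_norm_hasDerivWithin_le (f := fun r => Φ r x)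
    (f' := fun r => X (Φ r x)) (C := M) (x := 0) (y := s)
    (fun r _ => (h.hasDerivAt x r).hasDerivWithinAt) (fun r _ => hM _) trivial trivial
  simpa [h.zero] using this

theorem norm_sub_le (h : IsFlow X Φ) (hX : LipschitzWith K X) (hK : 1 ≤ K) {s : ℝ} (hs : |s| ≤ 1)
    (x y : E) : ‖Φ s x - Φ s y‖ ≤ Real.exp K * ‖x - y‖ := by
  have := norm_le_of_norm_deriv_le (f := fun r => Φ r x - Φ r y)
    (f' := fun r => X (Φ r x) - X (Φ r y)) (δ := ‖x - y‖) (K := K) (ε := 0) (s := s)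
    (by exact_mod_cast hK) (norm_nonneg _) le_rfl hs
    (fun t _ => (h.hasDerivAt x t).sub (h.hasDerivAt y t)) (by simp [h.zero])
    (fun t _ => by simpa using hX.norm_sub_le (Φ t x) (Φ t y))
  simpa [mul_comm] using this

theorem lipschitzWith (h : IsFlow X Φ) (hX : LipschitzWith K X) (hK : 1 ≤ K) {s : ℝ}
    (hs : |s| ≤ 1) : LipschitzWith (Real.exp K).toNNReal (Φ s) := by
  refine LipschitzWith.of_dist_le_mul fun x y => ?_
  rw [dist_eq_norm, dist_eq_norm, Real.coe_toNNReal _ (Real.exp_pos _).le]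
  exact h.norm_sub_le hX hK hs x y

end IsFlow

/-- Solutions of the linearized equation along a curve. -/
theorem exists_linearized [CompleteSpace E] {B : ℝ → E →L[ℝ] E} (hB : Continuous B) (hK : ∀ t, ‖B t‖ ≤ K) :
    ∃ A : ℝ → E →L[ℝ] E, A 0 = 1 ∧
      ∀ t, |t| < 1 / (2 * (K : ℝ) + 1) → HasDerivAt A ((B t).comp (A t)) t := by
  -- In the unit ball around the identity the operators have norm at most 2, so the linear field has
  -- size at most 2K there; 2Kτ ≤ 1 keeps the solution in that ball.
  set τ : ℝ := 1 / (2 * (K : ℝ) + 1) with hτ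
  have hτ0 : 0 < τ := by positivity
  have h0 : (0 : ℝ) ∈ Icc (-τ) τ := ⟨by linarith, hτ0.le⟩
  have hp : IsPicardLindelof (fun t (A : E →L[ℝ] E) => (B t).comp A) (⟨0, h0⟩ : Icc (-τ) τ) 1
      1 0 (2 * K) K :=
    { lipschitzOnWith := fun t _ => by
        refine (LipschitzWith.of_dist_le_mul fun A A' => ?_).lipschitzOnWith
        rw [dist_eq_norm, dist_eq_norm, ← ContinuousLinearMap.comp_sub]
        refine (ContinuousLinearMap.opNorm_comp_le _ _).trans ?_
        gcongr
        exact hK t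
      continuousOn := fun A _ => (hB.clm_comp continuous_const).continuousOn
      norm_le := fun t _ A hA => by
        have hA' : ‖A‖ ≤ 2 := by
          have h1 : ‖A - 1‖ ≤ 1 := by simpa [dist_eq_norm] using hA
          have h2 : ‖(1 : E →L[ℝ] E)‖ ≤ 1 := ContinuousLinearMap.norm_id_le
          calc ‖A‖ = ‖(A - 1) + 1‖ := by rw [sub_add_cancel]
            _ ≤ ‖A - 1‖ + ‖(1 : E →L[ℝ] E)‖ := norm_add_le _ _
            _ ≤ 2 := by linarith
        refine (ContinuousLinearMap.opNorm_comp_le _ _).trans ?_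
        calc ‖B t‖ * ‖A‖ ≤ K * 2 := by
              gcongr
              exact hK t
          _ = _ := by
              push_cast
              ring
      mul_max_le := by
        simp only [sub_zero, zero_sub, neg_neg, max_self, NNReal.coe_mul, NNReal.coe_ofNat,
          NNReal.coe_one, NNReal.coe_zero]
        rw [hτ, mul_one_div, div_le_one (by positivity)]
        linarith }
  obtain ⟨A, h1, h2⟩ := hp.exists_eq_forall_mem_Icc_hasDerivWithinAt₀
  refine ⟨A, h1, fun t ht => ?_⟩
  have ht' := abs_lt.1 ht
  exact (h2 t ⟨ht'.1.le, ht'.2.le⟩).hasDerivAt (Icc_mem_nhds ht'.1 ht'.2)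

end Flow

/-! ### Differentiability of the flow in the initial point -/

section FlowDeriv

variable {E : Type*} [NormedAddCommGroup E] [NormedSpace ℝ E] {X : E → E} {Φ : ℝ → E → E}
  {K L M : ℝ≥0}

/-- The mean value inequality on the segment from a to b, where the derivative deviates from its
value at a by at most L‖b - a‖. -/
theorem norm_sub_sub_fderiv_le (hd : Differentiable ℝ X) (hL : LipschitzWith L (fderiv ℝ X))
    (a b : E) : ‖X b - X a - fderiv ℝ X a (b - a)‖ ≤ L * ‖b - a‖ ^ 2 := by
  have h := (convex_segment a b).norm_image_sub_le_of_norm_hasFDerivWithin_le'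
    (f := X) (f' := fderiv ℝ X) (φ := fderiv ℝ X a) (C := L * ‖b - a‖)
    (fun x _ => (hd x).hasFDerivAt.hasFDerivWithinAt) (fun x hx => by
      refine (hL.norm_sub_le x a).trans ?_
      gcongr
      have := norm_sub_le_of_mem_segment hx
      exact this) (left_mem_segment ℝ a b) (right_mem_segment ℝ a b)
  calc _ ≤ _ := h
    _ = _ := by ring

variable [CompleteSpace E]

/-- The spatial derivative of a flow at small times solves the linearized equation; in particular
the flow is `C¹` and its derivative is `1 + s DX + O(s²)`. -/
theorem IsFlow.exists_hasFDerivAt (h : IsFlow X Φ) (hd : ContDiff ℝ 1 X) (hX : LipschitzWith K X)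
    (hK : 1 ≤ K) (hL : LipschitzWith L (fderiv ℝ X)) (hM : ∀ x, ‖X x‖ ≤ M) :
    ∃ A : ℝ → E → E →L[ℝ] E, ∃ C : ℝ, 0 ≤ C ∧ ∀ s, |s| < 1 / (2 * (K : ℝ) + 1) →
      (∀ x, HasFDerivAt (Φ s) (A s x) x) ∧ Continuous (A s) ∧ (∀ x, ‖A s x‖ ≤ C) ∧
      ∀ x, ‖A s x - 1 - s • fderiv ℝ X x‖ ≤ C * s ^ 2 := by
  have hK1 : (1 : ℝ) ≤ K := by exact_mod_cast hK
  have hDX : ∀ x, ‖fderiv ℝ X x‖ ≤ K := fun x => norm_fderiv_le_of_lipschitz ℝ hX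
  have hdX : Differentiable ℝ X := hd.differentiable (by simp)
  have hcont : ∀ x, Continuous fun t => Φ t x := fun x =>
    continuous_iff_continuousAt.2 fun t => (h.hasDerivAt x t).continuousAt
  have hlin : ∀ x, ∃ A : ℝ → E →L[ℝ] E, A 0 = 1 ∧ ∀ t, |t| < 1 / (2 * (K : ℝ) + 1) →
      HasDerivAt A ((fderiv ℝ X (Φ t x)).comp (A t)) t := fun x =>
    exists_linearized (B := fun t => fderiv ℝ X (Φ t x)) (hL.continuous.comp (hcont x))
      fun t => hDX _
  choose A hA0 hA using hlin
  have h1 : ‖(1 : E →L[ℝ] E)‖ ≤ 1 := ContinuousLinearMap.norm_id_le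
  have hone : ∀ s : ℝ, |s| < 1 / (2 * (K : ℝ) + 1) → |s| ≤ 1 := fun s hs =>
    hs.le.trans (by rw [div_le_one (by positivity)]; linarith)
  have hAb : ∀ x s, |s| < 1 / (2 * (K : ℝ) + 1) → ‖A x s‖ ≤ Real.exp K := by
    intro x s hs
    have := norm_le_of_norm_deriv_le (f := A x) (δ := 1) (ε := 0) (K := K) (s := s) hK1
      zero_le_one le_rfl (hone s hs) (fun t ht => hA x t (ht.trans_lt hs)) (by rw [hA0]; exact h1)
      (fun t ht => by
        rw [add_zero]
        exact (ContinuousLinearMap.opNorm_comp_le _ _).trans (by gcongr; exact hDX _))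
    simpa using this
  have hA1 : ∀ x s, |s| < 1 / (2 * (K : ℝ) + 1) → ‖A x s - 1‖ ≤ K * Real.exp K * |s| := by
    intro x s hs
    have := (convex_Icc (-|s|) |s|).norm_image_sub_le_of_norm_hasDerivWithin_le (f := A x)
      (f' := fun t => (fderiv ℝ X (Φ t x)).comp (A x t)) (C := K * Real.exp K) (x := 0) (y := s)
      (fun t ht => (hA x t ((abs_le.2 ht).trans_lt hs)).hasDerivWithinAt)
      (fun t ht => (ContinuousLinearMap.opNorm_comp_le _ _).trans (by
        gcongr
        · exact hDX _
        · exact hAb x t ((abs_le.2 ht).trans_lt hs)))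
      ⟨by linarith [abs_nonneg s], abs_nonneg s⟩ ⟨neg_abs_le s, le_abs_self s⟩
    simpa [hA0] using this
  -- Grönwall for the difference of the linearized solutions along two orbits. The resulting
  -- Lipschitz dependence on the initial point gives continuity of the spatial derivative.
  have hlip : ∀ x y s, |s| < 1 / (2 * (K : ℝ) + 1) →
      ‖A y s - A x s‖ ≤ L * Real.exp K * Real.exp K * ‖y - x‖ * Real.exp K := by
    intro x y s hs
    have := norm_le_of_norm_deriv_le (f := fun t => A y t - A x t) (δ := 0)
      (ε := L * Real.exp K * Real.exp K * ‖y - x‖) (K := K) (s := s) hK1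
      le_rfl (by positivity) (hone s hs)
      (fun t ht => (hA y t (ht.trans_lt hs)).sub (hA x t (ht.trans_lt hs)))
      (by simp [hA0])
      (fun t ht => by
        have e : (fderiv ℝ X (Φ t y)).comp (A y t) - (fderiv ℝ X (Φ t x)).comp (A x t) =
            (fderiv ℝ X (Φ t x)).comp (A y t - A x t) +
              (fderiv ℝ X (Φ t y) - fderiv ℝ X (Φ t x)).comp (A y t) := by
          ext z
          simp
        rw [e]
        refine (norm_add_le _ _).trans (add_le_add
          ((ContinuousLinearMap.opNorm_comp_le _ _).trans (by gcongr; exact hDX _))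
          ((ContinuousLinearMap.opNorm_comp_le _ _).trans ?_))
        calc _ ≤ L * (Real.exp K * ‖y - x‖) * Real.exp K := by
              gcongr
              · exact (hL.norm_sub_le _ _).trans (by
                  gcongr; exact h.norm_sub_le hX hK (ht.trans (hone s hs)) y x)
              · exact hAb y t (ht.trans_lt hs)
          _ = _ := by ring)
    simpa using this
  -- The error of the linear approximation solves the linearized equation with a forcing quadratic
  -- in the distance of the two orbits; Grönwall keeps it of order ‖y - x‖², so A is the spatial
  -- derivative.
  have herr : ∀ x y s, |s| < 1 / (2 * (K : ℝ) + 1) →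
      ‖Φ s y - Φ s x - A x s (y - x)‖ ≤
        L * (Real.exp K * ‖y - x‖) ^ 2 * Real.exp K := by
    intro x y s hs
    have := norm_le_of_norm_deriv_le (f := fun t => Φ t y - Φ t x - A x t (y - x)) (δ := 0)
      (ε := L * (Real.exp K * ‖y - x‖) ^ 2) (K := K) (s := s) hK1
      le_rfl (by positivity) (hone s hs)
      (fun t ht => ((h.hasDerivAt y t).sub (h.hasDerivAt x t)).sub
        ((hA x t (ht.trans_lt hs)).clm_apply (hasDerivAt_const t (y - x))))
      (by simp [hA0, h.zero])
      (fun t ht => by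
        have e : X (Φ t y) - X (Φ t x) - (((fderiv ℝ X (Φ t x)).comp (A x t)) (y - x) + A x t 0)
            = fderiv ℝ X (Φ t x) (Φ t y - Φ t x - A x t (y - x)) +
              (X (Φ t y) - X (Φ t x) - fderiv ℝ X (Φ t x) (Φ t y - Φ t x)) := by
          simp
        rw [e]
        refine (norm_add_le _ _).trans (add_le_add
          ((ContinuousLinearMap.le_opNorm _ _).trans (by gcongr; exact hDX _))
          ((norm_sub_sub_fderiv_le hdX hL _ _).trans ?_))
        gcongr
        exact h.norm_sub_le hX hK (ht.trans (hone s hs)) y x)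
    simpa using this
  refine ⟨fun s x => A x s, Real.exp K + (K * (K * Real.exp K) + L * M), by positivity,
    fun s hs => ⟨fun x => ?_, ?_, fun x => (hAb x s hs).trans ?_, fun x => ?_⟩⟩
  · refine .of_isLittleO ?_
    refine (Asymptotics.IsBigO.of_bound (L * Real.exp K ^ 2 * Real.exp K)
      (g := fun y => ‖y - x‖ ^ 2) (.of_forall fun y => ?_)).trans_isLittleO ?_
    · refine (herr x y s hs).trans (le_of_eq ?_)
      rw [Real.norm_of_nonneg (by positivity)]
      ring
    · refine Asymptotics.isLittleO_pow_sub_sub x (by norm_num)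
  · refine (LipschitzWith.of_dist_le_mul (K := L * (Real.exp K).toNNReal ^ 3) fun y x => ?_).continuous
    rw [dist_eq_norm, dist_eq_norm]
    refine (hlip x y s hs).trans (le_of_eq ?_)
    push_cast
    rw [Real.coe_toNNReal _ (Real.exp_pos _).le]
    ring
  · have : 0 ≤ (K * (K * Real.exp K) + L * M : ℝ) := by positivity
    linarith
  -- The time derivative of A_t - t DX(x) is DX(Φ_t x)(A_t - 1) + (DX(Φ_t x) - DX(x)), both terms
  -- being O(|t|); integration gives O(s²).
  · have := (convex_Icc (-|s|) |s|).norm_image_sub_le_of_norm_hasDerivWithin_le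
      (f := fun t => A x t - t • fderiv ℝ X x)
      (f' := fun t => (fderiv ℝ X (Φ t x)).comp (A x t) - (1 : ℝ) • fderiv ℝ X x)
      (C := (K * (K * Real.exp K) + L * M) * |s|) (x := 0) (y := s)
      (fun t ht => ((hA x t ((abs_le.2 ht).trans_lt hs)).sub
        ((hasDerivAt_id t).smul_const (fderiv ℝ X x))).hasDerivWithinAt)
      (fun t ht => by
        have ht' := abs_le.2 ht
        have e : (fderiv ℝ X (Φ t x)).comp (A x t) - (1 : ℝ) • fderiv ℝ X x =
            (fderiv ℝ X (Φ t x)).comp (A x t - 1) + (fderiv ℝ X (Φ t x) - fderiv ℝ X x) := by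
          ext z
          simp
        rw [e, add_mul]
        refine (norm_add_le _ _).trans (add_le_add
          ((ContinuousLinearMap.opNorm_comp_le _ _).trans ?_) ((hL.norm_sub_le _ _).trans ?_))
        · rw [mul_assoc (K : ℝ)]
          gcongr
          · exact hDX _
          · exact (hA1 x t (ht'.trans_lt hs)).trans (by gcongr)
        · rw [mul_assoc (L : ℝ)]
          gcongr
          exact (h.norm_sub_self_le hM t x).trans (by gcongr))
      ⟨by linarith [abs_nonneg s], abs_nonneg s⟩ ⟨neg_abs_le s, le_abs_self s⟩
    have e : A x s - 1 - s • fderiv ℝ X x =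
        (A x s - s • fderiv ℝ X x) - (A x 0 - (0 : ℝ) • fderiv ℝ X x) := by
      rw [hA0, zero_smul]
      abel
    show ‖A x s - 1 - s • fderiv ℝ X x‖ ≤ _
    rw [e]
    refine this.trans ?_
    rw [sub_zero, Real.norm_eq_abs, mul_assoc, ← sq, sq_abs]
    exact mul_le_mul_of_nonneg_right (by linarith [Real.exp_pos K]) (sq_nonneg s)

end FlowDeriv

/-! ### The flow of ∇χ, and how it distorts Lebesgue measure -/

/-- The gradient vector field of `χ`. -/
def gradField (χ : R3 → ℝ) (x : R3) : R3 := WithLp.toLp 2 fun i => pd i χ x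

theorem gradField_apply (χ : R3 → ℝ) (x : R3) (i : Fin 3) : gradField χ x i = pd i χ x := rfl

theorem IsTestFunction.contDiff_gradField {χ : R3 → ℝ} (hχ : IsTestFunction χ) :
    ContDiff ℝ ∞ (gradField χ) :=
  contDiff_euclidean.2 fun i => hχ.contDiff_pd i

theorem gradField_eq_zero {χ : R3 → ℝ} {x : R3} (hx : x ∉ tsupport χ) : gradField χ x = 0 := by
  ext i
  have : fderiv ℝ χ x = 0 := by
    by_contra h
    exact hx (support_fderiv_subset ℝ h)
  simp [gradField_apply, pd, this]

theorem IsTestFunction.hasCompactSupport_gradField {χ : R3 → ℝ} (hχ : IsTestFunction χ) :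
    HasCompactSupport (gradField χ) :=
  HasCompactSupport.intro hχ.2 fun _ hx => gradField_eq_zero hx

theorem fderiv_gradField {χ : R3 → ℝ} (hχ : IsTestFunction χ) (x : R3) (i j : Fin 3) :
    fderiv ℝ (gradField χ) x (basisVec j) i = pd j (pd i χ) x := by
  have h : HasFDerivAt (gradField χ) (fderiv ℝ (gradField χ) x) x :=
    (hχ.contDiff_gradField.differentiable (by simp) x).hasFDerivAt
  have h1 := ((EuclideanSpace.proj i : R3 →L[ℝ] ℝ).hasFDerivAt (x := gradField χ x)).comp x h
  have h2 : fderiv ℝ (pd i χ) x = _ := h1.fderiv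
  rw [pd, h2]
  rfl

/-- `Φ` is the flow of `∇χ`, with uniform bounds at times `|s| < τ`. -/
structure IsLocalFlow (χ : R3 → ℝ) (Φ : ℝ → R3 → R3) (τ C : ℝ) (c : ℝ≥0∞) : Prop where
  isFlow : IsFlow (gradField χ) Φ
  pos : 0 < τ
  nonneg : 0 ≤ C
  ne_top : c ≠ ⊤
  add : ∀ s t x, Φ (s + t) x = Φ s (Φ t x)
  eq_self : ∀ s x, x ∉ tsupport χ → Φ s x = x
  move : ∀ s x, ‖Φ s x - x‖ ≤ C * |s|
  contDiff : ∀ s, |s| < τ → ContDiff ℝ 1 (Φ s)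
  bound : ∀ s, |s| < τ → ∀ x, ‖fderiv ℝ (Φ s) x‖ ≤ C
  expansion : ∀ s, |s| < τ → ∀ x,
    ‖fderiv ℝ (Φ s) x - 1 - s • fderiv ℝ (gradField χ) x‖ ≤ C * s ^ 2
  map_le : ∀ s, |s| < τ → Measure.map (Φ s) volume ≤ c • (volume : Measure R3)

/-- The preimage of a set under f lies in its image under g, and a k-Lipschitz map increases
3-dimensional Hausdorff measure, a multiple of Lebesgue measure, by at most k³. No Jacobian
determinant is needed. -/
theorem map_le_of_lipschitz_inverse {f g : R3 → R3} {k : ℝ≥0} (hf : Continuous f)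
    (hg : LipschitzWith k g) (h : ∀ x, g (f x) = x) :
    Measure.map f volume ≤ ((k : ℝ≥0∞) ^ (3 : ℝ)) • (volume : Measure R3) := by
  have hfin : (Module.finrank ℝ R3 : ℝ) = 3 := by simp
  obtain ⟨c, hc⟩ : ∃ c : ℝ≥0, (volume : Measure R3) = c • μH[3] := by
    have : (μH[3] : Measure R3).IsAddHaarMeasure := by
      rw [← hfin]
      exact isAddHaarMeasure_hausdorffMeasure
    exact ⟨_, Measure.isAddLeftInvariant_eq_smul _ _⟩
  refine Measure.le_iff.2 fun s hs => ?_
  rw [Measure.map_apply hf.measurable hs]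
  have hsub : f ⁻¹' s ⊆ g '' s := fun x hx => ⟨f x, hx, h x⟩
  have h1 := hg.hausdorffMeasure_image_le (d := 3) (by norm_num) s
  calc volume (f ⁻¹' s) ≤ volume (g '' s) := measure_mono hsub
    _ = c * μH[3] (g '' s) := by rw [hc]; rfl
    _ ≤ c * ((k : ℝ≥0∞) ^ (3 : ℝ) * μH[3] s) := by gcongr
    _ = ((k : ℝ≥0∞) ^ (3 : ℝ)) * (c * μH[3] s) := by ring
    _ = _ := by
      rw [Measure.smul_apply, hc]
      rfl

/-- The field ∇χ is smooth with compact support, so it and its derivative are bounded and Lipschitz.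
The inverse of Φ_s is Φ_{-s}, with Lipschitz constant e^K, which gives the distortion factor e^{3K}.
-/
theorem exists_isLocalFlow {χ : R3 → ℝ} (hχ : IsTestFunction χ) :
    ∃ Φ τ C c, IsLocalFlow χ Φ τ C c := by
  have hX := hχ.contDiff_gradField
  have hs := hχ.hasCompactSupport_gradField
  obtain ⟨K₀, hK₀⟩ := ContDiff.lipschitzWith_of_hasCompactSupport hs hX (by simp)
  obtain ⟨L, hL⟩ := ContDiff.lipschitzWith_of_hasCompactSupport (hs.fderiv ℝ)
    (hX.fderiv_right (m := ∞) (by simp)) (by simp)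
  obtain ⟨M₀, hM₀⟩ := hX.continuous.bounded_above_of_compact_support hs
  have hM : ∀ x, ‖gradField χ x‖ ≤ M₀.toNNReal := fun x => (hM₀ x).trans (Real.le_coe_toNNReal _)
  -- The Grönwall bounds are stated for Lipschitz constants at least 1.
  set K := max K₀ 1
  have hK : LipschitzWith K (gradField χ) := hK₀.weaken (le_max_left _ _)
  have h1 : 1 ≤ K := le_max_right _ _
  obtain ⟨Φ, h⟩ := exists_isFlow hK hM
  obtain ⟨A, C, hC, hA⟩ := h.exists_hasFDerivAt (hX.of_le (by simp)) hK h1 hL hM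
  have hfd : ∀ s, |s| < 1 / (2 * (K : ℝ) + 1) → fderiv ℝ (Φ s) = A s := fun s hs =>
    funext fun x => ((hA s hs).1 x).fderiv
  have hone : ∀ s : ℝ, |s| < 1 / (2 * (K : ℝ) + 1) → |s| ≤ 1 := fun s hs =>
    hs.le.trans (by
      have : (0 : ℝ) ≤ K := K.2
      rw [div_le_one (by positivity)]; linarith)
  refine ⟨Φ, 1 / (2 * (K : ℝ) + 1), C + M₀.toNNReal, ((Real.exp K).toNNReal : ℝ≥0∞) ^ (3 : ℝ),
    h, by positivity, by positivity, by simp, h.add hK,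
    fun s x hx => h.eq_self hK (gradField_eq_zero hx) s, fun s x => ?_, fun s hs => ?_,
    fun s hs x => ?_, fun s hs x => ?_, fun s hs => ?_⟩
  · refine (h.norm_sub_self_le hM s x).trans ?_
    gcongr
    linarith
  · refine contDiff_one_iff_fderiv.2 ⟨fun x => ((hA s hs).1 x).differentiableAt, ?_⟩
    rw [hfd s hs]
    exact (hA s hs).2.1
  · rw [hfd s hs]
    exact ((hA s hs).2.2.1 x).trans (by simp)
  · rw [hfd s hs]
    refine ((hA s hs).2.2.2 x).trans ?_
    gcongr
    simp
  · exact map_le_of_lipschitz_inverse (h.lipschitzWith hK h1 (hone s hs)).continuous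
      (h.lipschitzWith hK h1 (by rw [abs_neg]; exact hone s hs)) (h.neg_apply hK s)

/-! ### Composition operators on L² -/

/-- `ψ` distorts Lebesgue measure by at most the factor `c`. -/
structure Transport (ψ : R3 → R3) (c : ℝ≥0∞) : Prop where
  measurable : Measurable ψ
  ne_top : c ≠ ⊤
  map_le : Measure.map ψ volume ≤ c • (volume : Measure R3)

namespace Transport

variable {ψ : R3 → R3} {c : ℝ≥0∞}

theorem quasi (h : Transport ψ c) : Measure.QuasiMeasurePreserving ψ volume volume :=
  ⟨h.measurable, Measure.absolutelyContinuous_of_le_smul h.map_le⟩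

theorem memLp (h : Transport ψ c) (f : L2) : MemLp (fun x => f (ψ x)) 2 volume :=
  MemLp.comp_of_map ((Lp.memLp f).of_measure_le_smul h.ne_top h.map_le) h.measurable.aemeasurable

theorem eLpNorm_le (h : Transport ψ c) (f : L2) :
    eLpNorm (fun x => f (ψ x)) 2 volume ≤ c ^ (1 / 2 : ℝ) * eLpNorm f 2 volume := by
  have h1 := eLpNorm_map_measure (p := 2) (((Lp.memLp f).1).mono_ac
    (Measure.absolutelyContinuous_of_le_smul h.map_le)) h.measurable.aemeasurable
  refine (h1.symm.le).trans ((eLpNorm_le_of_measure_le_smul h.map_le).trans ?_)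
  simp

/-- Composition with `ψ`. -/
def comp (h : Transport ψ c) : L2 →L[ℂ] L2 :=
  LinearMap.mkContinuous
    { toFun := fun f => (h.memLp f).toLp _
      map_add' := fun f g => by
        refine Lp.ext ?_
        filter_upwards [(h.memLp (f + g)).coeFn_toLp, (h.memLp f).coeFn_toLp,
          (h.memLp g).coeFn_toLp, Lp.coeFn_add ((h.memLp f).toLp _) ((h.memLp g).toLp _),
          h.quasi.ae_eq_comp (Lp.coeFn_add f g)] with x h1 h2 h3 h4 h5
        rw [h1, h4, Pi.add_apply, h2, h3]
        exact h5
      map_smul' := fun a f => by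
        refine Lp.ext ?_
        filter_upwards [(h.memLp (a • f)).coeFn_toLp, (h.memLp f).coeFn_toLp,
          Lp.coeFn_smul a ((h.memLp f).toLp _),
          h.quasi.ae_eq_comp (Lp.coeFn_smul a f)] with x h1 h2 h4 h5
        rw [h1, RingHom.id_apply, h4, Pi.smul_apply, h2]
        exact h5 }
    (c ^ (1 / 2 : ℝ)).toReal (fun f => by
      have hc : c ^ (1 / 2 : ℝ) ≠ ⊤ := ENNReal.rpow_ne_top_of_nonneg (by norm_num) h.ne_top
      rw [Lp.norm_def, Lp.norm_def, ← ENNReal.toReal_mul]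
      refine ENNReal.toReal_mono (ENNReal.mul_ne_top hc (Lp.eLpNorm_ne_top f)) ?_
      exact (eLpNorm_congr_ae (h.memLp f).coeFn_toLp).le.trans (h.eLpNorm_le f))

theorem coeFn_comp (h : Transport ψ c) (f : L2) : h.comp f =ᵐ[volume] fun x => f (ψ x) :=
  (h.memLp f).coeFn_toLp

theorem coeFn_comp_of_ae (h : Transport ψ c) {f : L2} {f' : R3 → ℂ} (hf : f =ᵐ[volume] f') :
    h.comp f =ᵐ[volume] fun x => f' (ψ x) :=
  (h.coeFn_comp f).trans (h.quasi.ae_eq_comp hf)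

theorem norm_comp_le (h : Transport ψ c) (f : L2) :
    ‖h.comp f‖ ≤ (c ^ (1 / 2 : ℝ)).toReal * ‖f‖ :=
  ContinuousLinearMap.le_of_opNorm_le _
    (LinearMap.mkContinuous_norm_le _ ENNReal.toReal_nonneg _) f

end Transport

attribute [irreducible] Transport.comp

theorem sum_smul_basisVec (v : R3) : ∑ i, v i • basisVec i = v := by
  ext j
  simp [basisVec, Finset.sum_apply, Pi.single_apply]

theorem norm_basisVec (i : Fin 3) : ‖basisVec i‖ = 1 := by simp [basisVec]

theorem abs_apply_le_norm (v : R3) (i : Fin 3) : |v i| ≤ ‖v‖ := EuclideanSpace.norm_eq v ▸ by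
  rw [← Real.sqrt_sq_eq_abs]
  refine Real.sqrt_le_sqrt ?_
  have := Finset.single_le_sum (f := fun i => ‖v i‖ ^ 2) (fun i _ => by positivity)
    (Finset.mem_univ i)
  simpa using this

theorem norm_le_of_ae_bound {F : L2} {F' : R3 → ℂ} (h : F =ᵐ[volume] F') {K : Set R3}
    (hK : IsCompact K) {ε : ℝ} (hb : ∀ x, ‖F' x‖ ≤ ε) (h0 : ∀ x ∉ K, F' x = 0) :
    ‖F‖ ≤ (volume K ^ (1 / 2 : ℝ)).toReal * ε := by
  have hε : 0 ≤ ε := (norm_nonneg _).trans (hb 0)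
  have hfin : volume K ^ (1 / 2 : ℝ) ≠ ⊤ :=
    ENNReal.rpow_ne_top_of_nonneg (by norm_num) hK.measure_lt_top.ne
  rw [Lp.norm_def, eLpNorm_congr_ae h, ← eLpNorm_restrict_eq_of_support_subset (s := K)
    (fun x hx => by
      by_contra hxK
      exact hx (h0 x hxK))]
  refine (ENNReal.toReal_mono ?_ (eLpNorm_le_of_ae_bound (C := ε) (.of_forall hb))).trans ?_
  · refine ENNReal.mul_ne_top ?_ ENNReal.ofReal_ne_top
    simpa using hfin
  · rw [ENNReal.toReal_mul, ENNReal.toReal_ofReal hε]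
    simp

/-! ### Composition with the flow on L² and H¹ -/

section GradientFlow

variable {χ : R3 → ℝ} {Φ : ℝ → R3 → R3} {τ C s : ℝ} {c : ℝ≥0∞}

/-- The derivative `∇χ·∇v` along the gradient field of `χ`. -/
def dirL (hχ : IsTestFunction χ) : H1 →L[ℂ] L2 := ∑ i, (mulL (hχ.pd i).bcf).comp (gradL i)

theorem dirL_apply (hχ : IsTestFunction χ) (f : H1) :
    dirL hχ f = ∑ i, mulL (hχ.pd i).bcf (gradL i f) := by
  simp [dirL]

theorem coeFn_sum (F : Fin 3 → L2) :
    ((∑ i, F i : L2) : R3 → ℂ) =ᵐ[volume] fun x => ∑ i, F i x := by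
  rw [Fin.sum_univ_three]
  filter_upwards [Lp.coeFn_add (F 0 + F 1) (F 2), Lp.coeFn_add (F 0) (F 1)] with x h1 h2
  rw [h1, Pi.add_apply, h2, Pi.add_apply, Fin.sum_univ_three]

theorem coeFn_dirL (hχ : IsTestFunction χ) (f : H1) :
    dirL hχ f =ᵐ[volume] fun x => ∑ i, pd i χ x • gradL i f x := by
  rw [dirL_apply]
  refine (coeFn_sum _).trans ?_
  have := ae_all_iff.2 fun i => coeFn_mulL (hχ.pd i).bcf (gradL i f)
  filter_upwards [this] with x hx
  exact Finset.sum_congr rfl fun i _ => hx i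

theorem fderiv_gradField_dir (f : R3 → ℂ) (x v : R3) :
    fderiv ℝ f x v = ∑ i, v i • pdc i f x := by
  conv_lhs => rw [← sum_smul_basisVec v, map_sum]
  simp [pdc]

theorem coeFn_dirL_ofC1 (hχ : IsTestFunction χ) {f : R3 → ℂ} (hf : ContDiff ℝ 1 f)
    (hs : HasCompactSupport f) :
    dirL hχ (ofC1 f hf hs) =ᵐ[volume] fun x => fderiv ℝ f x (gradField χ x) := by
  refine (coeFn_dirL hχ _).trans ?_
  have := ae_all_iff.2 fun i => coeFn_gradL_ofC1 hf hs i
  filter_upwards [this] with x hx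
  rw [fderiv_gradField_dir]
  exact Finset.sum_congr rfl fun i _ => by rw [hx i]; rfl

namespace IsLocalFlow

theorem continuous (h : IsLocalFlow χ Φ τ C c) (hs : |s| < τ) : Continuous (Φ s) :=
  (h.contDiff s hs).continuous

theorem transport (h : IsLocalFlow χ Φ τ C c) (hs : |s| < τ) : Transport (Φ s) c :=
  ⟨(h.continuous hs).measurable, h.ne_top, h.map_le s hs⟩

theorem zero_lt (h : IsLocalFlow χ Φ τ C c) : |(0 : ℝ)| < τ := by simpa using h.pos

theorem eventually_lt (h : IsLocalFlow χ Φ τ C c) : ∀ᶠ s in 𝓝 (0 : ℝ), |s| < τ :=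
  (isOpen_lt continuous_abs continuous_const).mem_nhds h.zero_lt

theorem contDiff_comp {F : Type*} [NormedAddCommGroup F] [NormedSpace ℝ F]
    (h : IsLocalFlow χ Φ τ C c) (hs : |s| < τ) {f : R3 → F}
    (hf : ContDiff ℝ 1 f) : ContDiff ℝ 1 (fun x => f (Φ s x)) :=
  hf.comp (h.contDiff s hs)

theorem hasCompactSupport_comp {F : Type*} [NormedAddCommGroup F]
    (h : IsLocalFlow χ Φ τ C c) (hχ : HasCompactSupport χ) (s : ℝ) {f : R3 → F}
    (hf : HasCompactSupport f) : HasCompactSupport (fun x => f (Φ s x)) := by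
  refine HasCompactSupport.intro (IsCompact.union hχ hf) fun x hx => ?_
  rw [h.eq_self s x fun h' => hx (Or.inl h')]
  exact image_eq_zero_of_notMem_tsupport fun h' => hx (Or.inr h')

/-- The entry `∂_j Φ_s^i` of the Jacobian matrix. -/
def jac (h : IsLocalFlow χ Φ τ C c) (hs : |s| < τ) (j i : Fin 3) : R3 →ᵇ ℝ :=
  BoundedContinuousFunction.ofNormedAddCommGroup (fun x => fderiv ℝ (Φ s) x (basisVec j) i)
    (by
      have h1 : Continuous fun x => fderiv ℝ (Φ s) x (basisVec j) :=
        ((h.contDiff s hs).continuous_fderiv (by simp)).clm_apply continuous_const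
      exact (EuclideanSpace.proj i : R3 →L[ℝ] ℝ).continuous.comp h1) C
    (fun x => (abs_apply_le_norm _ i).trans <| (ContinuousLinearMap.le_opNorm _ _).trans <| by
      rw [norm_basisVec, mul_one]
      exact h.bound s hs x)

theorem jac_apply (h : IsLocalFlow χ Φ τ C c) (hs : |s| < τ) (j i : Fin 3) (x : R3) :
    h.jac hs j i x = fderiv ℝ (Φ s) x (basisVec j) i := rfl

theorem norm_jac_le (h : IsLocalFlow χ Φ τ C c) (hs : |s| < τ) (j i : Fin 3) :
    ‖h.jac hs j i‖ ≤ C :=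
  BoundedContinuousFunction.norm_ofNormedAddCommGroup_le _ h.nonneg _

theorem norm_jac_sub_le (hχ : IsTestFunction χ) (h : IsLocalFlow χ Φ τ C c) (hs : |s| < τ)
    (j i : Fin 3) :
    ‖h.jac hs j i - (if j = i then 1 else 0) - s • ((hχ.pd i).pd j).bcf‖ ≤ C * s ^ 2 := by
  refine (BoundedContinuousFunction.norm_le (mul_nonneg h.nonneg (sq_nonneg s))).2 fun x => ?_
  have h1 := h.expansion s hs x
  have h2 := (ContinuousLinearMap.le_opNorm
    (fderiv ℝ (Φ s) x - 1 - s • fderiv ℝ (gradField χ) x) (basisVec j))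
  rw [norm_basisVec, mul_one] at h2
  have h3 := (abs_apply_le_norm _ i).trans (h2.trans h1)
  have e : ((fderiv ℝ (Φ s) x - 1 - s • fderiv ℝ (gradField χ) x) (basisVec j)) i =
      (h.jac hs j i - (if j = i then 1 else 0) - s • ((hχ.pd i).pd j).bcf : R3 →ᵇ ℝ) x := by
    have e1 : (if j = i then (1 : R3 →ᵇ ℝ) else 0) x = (basisVec j) i := by
      by_cases hji : j = i
      · simp [hji, basisVec]
      · simp [hji, basisVec, Ne.symm hji]
    simp only [sub_apply, smul_apply, one_apply_eq_self, PiLp.sub_apply, PiLp.smul_apply,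
      BoundedContinuousFunction.sub_apply, BoundedContinuousFunction.smul_apply,
      fderiv_gradField hχ, e1, jac_apply]
    rfl
  rw [← e]
  exact h3

theorem pdc_comp (h : IsLocalFlow χ Φ τ C c) (hs : |s| < τ) {f : R3 → ℂ} (hf : ContDiff ℝ 1 f)
    (j : Fin 3) (x : R3) :
    pdc j (fun y => f (Φ s y)) x = ∑ i, h.jac hs j i x • pdc i f (Φ s x) := by
  have h1 : fderiv ℝ (fun y => f (Φ s y)) x = (fderiv ℝ f (Φ s x)).comp (fderiv ℝ (Φ s) x) :=
    fderiv_comp x (hf.differentiable (by simp) _) ((h.contDiff s hs).differentiable (by simp) x)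
  simp only [jac_apply]
  rw [← fderiv_gradField_dir, pdc, h1]
  rfl

/-- Composition with the flow on `L²`. -/
def flowL (h : IsLocalFlow χ Φ τ C c) (s : ℝ) : L2 →L[ℂ] L2 :=
  if hs : |s| < τ then (h.transport hs).comp else 0

theorem coeFn_flowL_of_ae (h : IsLocalFlow χ Φ τ C c) (hs : |s| < τ) {f : L2} {f' : R3 → ℂ}
    (hf : f =ᵐ[volume] f') : h.flowL s f =ᵐ[volume] fun x => f' (Φ s x) := by
  rw [flowL, dif_pos hs]
  exact (h.transport hs).coeFn_comp_of_ae hf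

theorem norm_flowL_le (h : IsLocalFlow χ Φ τ C c) (s : ℝ) (f : L2) :
    ‖h.flowL s f‖ ≤ (c ^ (1 / 2 : ℝ)).toReal * ‖f‖ := by
  by_cases hs : |s| < τ
  · rw [flowL, dif_pos hs]
    exact (h.transport hs).norm_comp_le f
  · rw [flowL, dif_neg hs]
    simpa using mul_nonneg ENNReal.toReal_nonneg (norm_nonneg f)

theorem flowL_add (h : IsLocalFlow χ Φ τ C c) {t : ℝ} (hs : |s| < τ) (ht : |t| < τ)
    (hst : |s + t| < τ) (f : L2) : h.flowL (s + t) f = h.flowL s (h.flowL t f) := by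
  refine Lp.ext ?_
  have h1 := h.coeFn_flowL_of_ae ht (ae_eq_refl f)
  refine (h.coeFn_flowL_of_ae hst (ae_eq_refl f)).trans ((h.coeFn_flowL_of_ae hs h1).trans ?_).symm
  refine .of_forall fun x => ?_
  show f (Φ t (Φ s x)) = f (Φ (s + t) x)
  rw [add_comm s t, h.add]

theorem flowL_zero (h : IsLocalFlow χ Φ τ C c) (f : L2) : h.flowL 0 f = f := by
  refine Lp.ext ((h.coeFn_flowL_of_ae h.zero_lt (ae_eq_refl f)).trans (.of_forall fun x => ?_))
  show f (Φ 0 x) = f x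
  rw [h.isFlow.zero]

attribute [irreducible] flowL jac

/-- The chain rule for smooth f. Both components are continuous in f and the graph of the weak
gradient is closed, so the statement passes to all of H¹ by density. -/
theorem comp_mem_H1 (h : IsLocalFlow χ Φ τ C c) (hs : |s| < τ) (f : H1) :
    ((h.flowL s (valL f), fun j => ∑ i, mulL (h.jac hs j i) (h.flowL s (gradL i f))) :
      L2 × (Fin 3 → L2)) ∈ H1 := by
  refine (dense_smoothH1.induction (P := fun f : H1 => ((h.flowL s (valL f),
    fun j => ∑ i, mulL (h.jac hs j i) (h.flowL s (gradL i f))) : L2 × (Fin 3 → L2)) ∈ H1)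
    ?_ ?_) f
  · rintro _ ⟨f, hf, hsf, rfl⟩
    have hf1 : ContDiff ℝ 1 f := hf.of_le (by simp)
    refine mem_H1_of_weak (f := fun x => f (Φ s x)) (g := fun j => pdc j fun x => f (Φ s x))
      (h.coeFn_flowL_of_ae hs (coeFn_valL_ofC1 _ _)) (fun j => ?_)
      fun φ hφ i => integral_pd_smul_eq_neg (h.contDiff_comp hs hf1) hφ i
    refine (coeFn_sum _).trans ?_
    have h1 := ae_all_iff.2 fun i => coeFn_mulL (h.jac hs j i)
      (h.flowL s (gradL i (ofC1 f hf1 hsf)))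
    have h2 := ae_all_iff.2 fun i => h.coeFn_flowL_of_ae hs (coeFn_gradL_ofC1 hf1 hsf i)
    filter_upwards [h1, h2] with x h1 h2
    rw [h.pdc_comp hs hf1]
    exact Finset.sum_congr rfl fun i _ => by rw [h1, h2]
  · refine isClosed_H1.preimage (f := fun f : H1 => ((h.flowL s (valL f),
      fun j => ∑ i, mulL (h.jac hs j i) (h.flowL s (gradL i f))) : L2 × (Fin 3 → L2))) ?_
    fun_prop

end IsLocalFlow

end GradientFlow

theorem coeFn_sub_sub_smul {f g k : L2} {f' g' k' : R3 → ℂ} (a : ℂ) (hf : f =ᵐ[volume] f')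
    (hg : g =ᵐ[volume] g') (hk : k =ᵐ[volume] k') :
    ((f - g - a • k : L2) : R3 → ℂ) =ᵐ[volume] fun x => f' x - g' x - a • k' x := by
  refine (Lp.coeFn_sub _ _).trans ?_
  filter_upwards [Lp.coeFn_sub f g, Lp.coeFn_smul a k, hf, hg, hk] with x h4 h5 h1 h2 h3
  rw [Pi.sub_apply, h4, Pi.sub_apply, h1, h2, h5, Pi.smul_apply, h3]

namespace IsLocalFlow

variable {χ : R3 → ℝ} {Φ : ℝ → R3 → R3} {τ C s : ℝ} {c : ℝ≥0∞}

/-- Composition with the flow on `H¹`, at small times. -/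
def flowH1OfLt (h : IsLocalFlow χ Φ τ C c) (hs : |s| < τ) : H1 →L[ℂ] H1 :=
  liftH1 ((h.flowL s).comp valL)
    (fun j => ∑ i, (mulL (h.jac hs j i)).comp ((h.flowL s).comp (gradL i)))
    (fun f => by
      have := h.comp_mem_H1 hs f
      simpa using this)

theorem valL_flowH1OfLt (h : IsLocalFlow χ Φ τ C c) (hs : |s| < τ) (f : H1) :
    valL (h.flowH1OfLt hs f) = h.flowL s (valL f) :=
  valL_liftH1 _ _ _ f

theorem gradL_flowH1OfLt (h : IsLocalFlow χ Φ τ C c) (hs : |s| < τ) (j : Fin 3) (f : H1) :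
    gradL j (h.flowH1OfLt hs f) = ∑ i, mulL (h.jac hs j i) (h.flowL s (gradL i f)) :=
  (gradL_liftH1 _ _ _ j f).trans (by
    simp only [sum_apply, ContinuousLinearMap.comp_apply])

attribute [irreducible] flowH1OfLt

/-- Composition with the flow on `H¹`. -/
def flowH1 (h : IsLocalFlow χ Φ τ C c) (s : ℝ) : H1 →L[ℂ] H1 :=
  if hs : |s| < τ then h.flowH1OfLt hs else 0

theorem flowH1_of_lt (h : IsLocalFlow χ Φ τ C c) (hs : |s| < τ) :
    h.flowH1 s = h.flowH1OfLt hs := dif_pos hs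

theorem flowH1_of_not_lt (h : IsLocalFlow χ Φ τ C c) (hs : ¬ |s| < τ) :
    h.flowH1 s = 0 := dif_neg hs

attribute [irreducible] flowH1

theorem valL_flowH1 (h : IsLocalFlow χ Φ τ C c) (hs : |s| < τ) (f : H1) :
    valL (h.flowH1 s f) = h.flowL s (valL f) :=
  (congrArg valL (DFunLike.congr_fun (h.flowH1_of_lt hs) f)).trans (h.valL_flowH1OfLt hs f)

theorem gradL_flowH1 (h : IsLocalFlow χ Φ τ C c) (hs : |s| < τ) (j : Fin 3) (f : H1) :
    gradL j (h.flowH1 s f) = ∑ i, mulL (h.jac hs j i) (h.flowL s (gradL i f)) :=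
  (congrArg (gradL j) (DFunLike.congr_fun (h.flowH1_of_lt hs) f)).trans
    (h.gradL_flowH1OfLt hs j f)

theorem exists_norm_flowH1_le (h : IsLocalFlow χ Φ τ C c) :
    ∃ D, 0 ≤ D ∧ ∀ s f, ‖h.flowH1 s f‖ ≤ D * ‖f‖ := by
  set k := (c ^ (1 / 2 : ℝ)).toReal
  have hk : 0 ≤ k := ENNReal.toReal_nonneg
  have hC := h.nonneg
  refine ⟨k + 3 * (C * k), by positivity, fun s f => ?_⟩
  by_cases hs : |s| < τ
  · refine H1.norm_le ?_ fun j => ?_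
    · rw [h.valL_flowH1 hs]
      calc _ ≤ k * ‖valL f‖ := h.norm_flowL_le s _
        _ ≤ k * ‖f‖ := by gcongr; exact norm_valL_le f
        _ ≤ _ := by gcongr; simp; positivity
    · rw [h.gradL_flowH1 hs]
      calc _ ≤ ∑ i : Fin 3, C * (k * ‖f‖) := norm_sum_le_of_le _ fun i _ =>
            (norm_mulL_le _ _).trans (by
              gcongr
              · exact h.norm_jac_le hs j i
              · exact (h.norm_flowL_le s _).trans (by gcongr; exact norm_gradL_le i f))
        _ = 3 * (C * k) * ‖f‖ := by simp; ring
        _ ≤ _ := by gcongr; simpa using hk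
  · have e : h.flowH1 s f = 0 := DFunLike.congr_fun (h.flowH1_of_not_lt hs) f
    exact ((congrArg norm e).trans norm_zero).le.trans (by positivity)

/-- Orbits of smooth functions stay among the C¹ functions of compact support, where the group law
can be checked pointwise. -/
theorem flowH1_ofC1 (h : IsLocalFlow χ Φ τ C c) (hχ : HasCompactSupport χ) (hs : |s| < τ)
    {f : R3 → ℂ} (hf : ContDiff ℝ 1 f) (hsf : HasCompactSupport f) :
    h.flowH1 s (ofC1 f hf hsf) = ofC1 (fun x => f (Φ s x)) (h.contDiff_comp hs hf)
      (h.hasCompactSupport_comp hχ s hsf) := by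
  refine H1.ext_val_grad (Lp.ext ?_) fun j => Lp.ext ?_
  · rw [h.valL_flowH1 hs]
    exact (h.coeFn_flowL_of_ae hs (coeFn_valL_ofC1 _ _)).trans (coeFn_valL_ofC1 _ _).symm
  · rw [h.gradL_flowH1 hs]
    refine ((coeFn_sum _).trans ?_).trans (coeFn_gradL_ofC1 _ _ j).symm
    have h1 := ae_all_iff.2 fun i => coeFn_mulL (h.jac hs j i)
      (h.flowL s (gradL i (ofC1 f hf hsf)))
    have h2 := ae_all_iff.2 fun i => h.coeFn_flowL_of_ae hs (coeFn_gradL_ofC1 hf hsf i)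
    filter_upwards [h1, h2] with x h1 h2
    rw [h.pdc_comp hs hf]
    exact Finset.sum_congr rfl fun i _ => by rw [h1, h2]

theorem flowL_neg (h : IsLocalFlow χ Φ τ C c) (hs : |s| < τ) (f : L2) :
    h.flowL (-s) (h.flowL s f) = f := by
  rw [← h.flowL_add (by rwa [abs_neg]) hs (by rw [neg_add_cancel]; exact h.zero_lt),
    neg_add_cancel, h.flowL_zero]

theorem flowH1_neg (h : IsLocalFlow χ Φ τ C c) (hχ : HasCompactSupport χ) (hs : |s| < τ) (f : H1) :
    h.flowH1 (-s) (h.flowH1 s f) = f := by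
  refine (dense_smoothH1.induction (P := fun f : H1 => h.flowH1 (-s) (h.flowH1 s f) = f)
    ?_ (isClosed_eq (by fun_prop) (by fun_prop))) f
  rintro _ ⟨f, hf, hsf, rfl⟩
  have hns : |-s| < τ := by rwa [abs_neg]
  rw [h.flowH1_ofC1 hχ hs, h.flowH1_ofC1 hχ hns]
  refine H1.ext_val_grad (Lp.ext ?_) fun j => Lp.ext ?_
  · refine (coeFn_valL_ofC1 _ _).trans (.trans (.of_forall fun x => ?_) (coeFn_valL_ofC1 _ _).symm)
    show f (Φ s (Φ (-s) x)) = f x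
    rw [← h.add, add_neg_cancel, h.isFlow.zero]
  · refine (coeFn_gradL_ofC1 _ _ _).trans (.trans (.of_forall fun x => ?_)
      (coeFn_gradL_ofC1 _ _ _).symm)
    have : (fun x => f (Φ s (Φ (-s) x))) = f := by
      funext x
      rw [← h.add, add_neg_cancel, h.isFlow.zero]
    rw [this]

/-- The chain rule along the flow. -/
theorem hasDerivAt_comp {F : Type*} [NormedAddCommGroup F] [NormedSpace ℝ F]
    (h : IsLocalFlow χ Φ τ C c) {f : R3 → F} (hf : ContDiff ℝ 1 f)
    (x : R3) (r : ℝ) : HasDerivAt (fun r => f (Φ r x)) (fderiv ℝ f (Φ r x) (gradField χ (Φ r x))) r :=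
  (hf.differentiable (by simp) _).hasFDerivAt.comp_hasDerivAt r (h.isFlow.hasDerivAt x r)

/-- Second order Taylor expansion of a smooth function along the flow. -/
theorem exists_norm_comp_sub_le (h : IsLocalFlow χ Φ τ C c) (hχ : IsTestFunction χ)
    {f : R3 → ℂ} (hf : ContDiff ℝ ∞ f) (hf1 : ContDiff ℝ 1 f) :
    ∃ D, 0 ≤ D ∧ ∀ s x,
      ‖f (Φ s x) - f x - (s : ℂ) • fderiv ℝ f x (gradField χ x)‖ ≤ D * s ^ 2 := by
  obtain ⟨g, hg⟩ : ∃ g : R3 → ℂ, g = fun x => fderiv ℝ f x (gradField χ x) := ⟨_, rfl⟩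
  have hg' : ∀ x, fderiv ℝ f x (gradField χ x) = g x := fun x => (congrFun hg x).symm
  have hgc : ContDiff ℝ ∞ g := by
    rw [hg]
    exact (hf.fderiv_right (m := ∞) (by simp)).clm_apply hχ.contDiff_gradField
  have hgs : HasCompactSupport g := by
    refine HasCompactSupport.intro hχ.2 fun x hx => ?_
    simp only [hg, gradField_eq_zero hx, map_zero]
  obtain ⟨L, hL⟩ := ContDiff.lipschitzWith_of_hasCompactSupport hgs hgc (by simp)
  have hC := h.nonneg
  refine ⟨L * C, by positivity, fun s x => ?_⟩
  -- The derivative of r ↦ f(Φ_r x) - r g(x) is g(Φ_r x) - g(x), bounded by the Lipschitz constant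
  -- of g times the displacement C|r|.
  have := (convex_Icc (-|s|) |s|).norm_image_sub_le_of_norm_hasDerivWithin_le
    (f := fun r => f (Φ r x) - r • g x)
    (f' := fun r => g (Φ r x) - (1 : ℝ) • g x)
    (C := L * C * |s|) (x := 0) (y := s)
    (fun r hr => (((h.hasDerivAt_comp hf1 x r).congr_deriv (hg' _)).sub
      ((hasDerivAt_id r).smul_const (g x))).hasDerivWithinAt)
    (fun r hr => by
      rw [one_smul]
      refine (hL.norm_sub_le _ _).trans ?_
      rw [mul_assoc]
      gcongr
      exact (h.move r x).trans (mul_le_mul_of_nonneg_left (abs_le.2 hr) hC))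
    ⟨by linarith [abs_nonneg s], abs_nonneg s⟩ ⟨neg_abs_le s, le_abs_self s⟩
  have e : f (Φ s x) - f x - (s : ℂ) • g x
      = (f (Φ s x) - s • g x) - (f (Φ 0 x) - (0 : ℝ) • g x) := by
    rw [h.isFlow.zero, zero_smul, Complex.coe_smul]
    abel
  rw [hg', e]
  refine this.trans (le_of_eq ?_)
  rw [sub_zero, Real.norm_eq_abs, mul_assoc (_ * _), ← sq, sq_abs]

/-- The flow fixes every point outside the support of χ, so the pointwise Taylor error lives on that
compact set and its uniform bound is an L² bound. -/
theorem exists_norm_flowL_sub_le (h : IsLocalFlow χ Φ τ C c) (hχ : IsTestFunction χ)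
    {F : H1} (hF : F ∈ smoothH1) :
    ∃ D, 0 ≤ D ∧ ∀ s, |s| < τ →
      ‖h.flowL s (valL F) - valL F - (s : ℂ) • dirL hχ F‖ ≤ D * s ^ 2 := by
  obtain ⟨f, hf, hsf, rfl⟩ := hF
  have hf1 : ContDiff ℝ 1 f := hf.of_le (by simp)
  obtain ⟨D, hD, hb⟩ := h.exists_norm_comp_sub_le hχ hf hf1
  refine ⟨(volume (tsupport χ) ^ (1 / 2 : ℝ)).toReal * D,
    mul_nonneg ENNReal.toReal_nonneg hD, fun s hs => ?_⟩
  have h1 := coeFn_valL_ofC1 hf1 hsf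
  refine (norm_le_of_ae_bound (coeFn_sub_sub_smul (s : ℂ) (h.coeFn_flowL_of_ae hs h1) h1
    (coeFn_dirL_ofC1 hχ hf1 hsf)) hχ.2 (hb s) fun x hx => ?_).trans_eq (mul_assoc _ _ _).symm
  rw [h.eq_self s x hx]
  simp [gradField_eq_zero hx]

end IsLocalFlow

/-! ### Difference quotients of local groups of operators -/

section LocalGroup

variable {E G : Type*} [NormedAddCommGroup E] [NormedSpace ℂ E] [NormedAddCommGroup G]
  [NormedSpace ℂ G] {T : ℝ → G →L[ℂ] G} {k τ D s : ℝ}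
  {val dir : E →L[ℂ] G} {S : Set E}

/-- The group law carries the expansion at time 0 to time s: the error there is T_s applied to T_r v
- v - r g. -/
theorem hasDerivAt_localGroup (hk : 0 ≤ k) (hkb : ∀ s f, ‖T s f‖ ≤ k * ‖f‖)
    (hadd : ∀ {s t : ℝ}, |s| < τ → |t| < τ → |s + t| < τ → ∀ f, T (s + t) f = T s (T t f))
    (hτ : 0 < τ) {v g : G}
    (hb : ∀ s, |s| < τ → ‖T s v - v - (s : ℂ) • g‖ ≤ D * s ^ 2) (hs : |s| < τ) :
    HasDerivAt (fun s => T s v) (T s g) s := by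
  rw [hasDerivAt_iff_isLittleO_nhds_zero]
  refine (Asymptotics.IsBigO.of_bound (k * D) (g := fun r : ℝ => r ^ 2) ?_).trans_isLittleO
    (by simpa using Asymptotics.isLittleO_pow_id (𝕜 := ℝ) one_lt_two)
  have h1 : ∀ᶠ r in 𝓝 (0 : ℝ), |s + r| < τ := by
    have : Continuous fun r : ℝ => |s + r| := by fun_prop
    exact (isOpen_lt this continuous_const).mem_nhds (by simpa using hs)
  have h2 : ∀ᶠ r in 𝓝 (0 : ℝ), |r| < τ :=
    (isOpen_lt continuous_abs continuous_const).mem_nhds (by simpa using hτ)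
  filter_upwards [h1, h2] with r h1 h2
  have e : T (s + r) v - T s v - r • T s g = T s (T r v - v - (r : ℂ) • g) := by
    rw [hadd hs h2 h1, map_sub, map_sub, map_smul, Complex.coe_smul]
  rw [e, Real.norm_of_nonneg (sq_nonneg r), mul_assoc]
  exact (hkb _ _).trans (by gcongr; exact hb r h2)

/-- On the dense set this is the mean value inequality with derivative T_r(dir F); the bound
involves only the norm of F in E, so it extends by continuity. -/
theorem norm_localGroup_sub_le (hk : 0 ≤ k) (hkb : ∀ s f, ‖T s f‖ ≤ k * ‖f‖)
    (h0 : ∀ f, T 0 f = f) (hS : Dense S)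
    (hder : ∀ F ∈ S, ∀ s, |s| < τ → HasDerivAt (fun s => T s (val F)) (T s (dir F)) s)
    (hs : |s| < τ) (F : E) : ‖T s (val F) - val F‖ ≤ k * ‖dir‖ * |s| * ‖F‖ := by
  refine (hS.induction
    (P := fun F : E => ‖T s (val F) - val F‖ ≤ k * ‖dir‖ * |s| * ‖F‖)
    (fun F hF => ?_) (isClosed_le (by fun_prop) (by fun_prop))) F
  have := (convex_Icc (-|s|) |s|).norm_image_sub_le_of_norm_hasDerivWithin_le
    (f := fun r => T r (val F)) (f' := fun r => T r (dir F))
    (C := k * (‖dir‖ * ‖F‖)) (x := 0) (y := s)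
    (fun r hr => (hder F hF r ((abs_le.2 hr).trans_lt hs)).hasDerivWithinAt)
    (fun r hr => (hkb r _).trans (by gcongr; exact ContinuousLinearMap.le_opNorm _ _))
    ⟨by linarith [abs_nonneg s], abs_nonneg s⟩ ⟨neg_abs_le s, le_abs_self s⟩
  rw [h0, sub_zero, Real.norm_eq_abs] at this
  exact this.trans_eq (by ring)

theorem exists_norm_localGroup_sub_le (hk : 0 ≤ k) (hkb : ∀ s f, ‖T s f‖ ≤ k * ‖f‖)
    (h0 : ∀ f, T 0 f = f) (hS : Dense S)
    (hder : ∀ F ∈ S, ∀ s, |s| < τ → HasDerivAt (fun s => T s (val F)) (T s (dir F)) s) :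
    ∃ D, 0 ≤ D ∧ ∀ s, |s| < τ → ∀ F, ‖T s (val F) - val F‖ ≤ D * |s| * ‖F‖ :=
  ⟨k * ‖dir‖, by positivity, fun _ hs F => norm_localGroup_sub_le hk hkb h0 hS hder hs F⟩

/-- By the previous bound the difference quotients are uniformly bounded from E to G, so convergence
on the dense set suffices. -/
theorem tendsto_slope_localGroup (hk : 0 ≤ k) (hkb : ∀ s f, ‖T s f‖ ≤ k * ‖f‖)
    (h0 : ∀ f, T 0 f = f) (hτ : 0 < τ) (hS : Dense S)
    (hder : ∀ F ∈ S, ∀ s, |s| < τ → HasDerivAt (fun s => T s (val F)) (T s (dir F)) s) (F : E) :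
    Tendsto (fun s : ℝ => ((s⁻¹ : ℝ) : ℂ) • (T s (val F) - val F)) (𝓝[≠] 0) (𝓝 (dir F)) := by
  obtain ⟨D, hD, hb⟩ := exists_norm_localGroup_sub_le hk hkb h0 hS hder
  refine tendsto_of_dense (C := max D ‖dir‖) hS
    (T := fun (s : ℝ) F => ((s⁻¹ : ℝ) : ℂ) • (T s (val F) - val F)) (S := fun F => dir F)
    ?_ (fun f g => ?_) (fun F hF => ?_) F
  · have h2 : ∀ᶠ r in 𝓝 (0 : ℝ), |r| < τ :=
      (isOpen_lt continuous_abs continuous_const).mem_nhds (by simpa using hτ)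
    filter_upwards [h2.filter_mono nhdsWithin_le_nhds] with s hs f g
    have e : ((s⁻¹ : ℝ) : ℂ) • (T s (val f) - val f) - ((s⁻¹ : ℝ) : ℂ) • (T s (val g) - val g)
        = ((s⁻¹ : ℝ) : ℂ) • (T s (val (f - g)) - val (f - g)) := by
      rw [map_sub, map_sub, ← smul_sub]
      congr 1
      abel
    rw [e, norm_smul, Complex.norm_real, norm_inv, Real.norm_eq_abs]
    calc |s|⁻¹ * ‖T s (val (f - g)) - val (f - g)‖
        ≤ |s|⁻¹ * (D * |s| * ‖f - g‖) := by gcongr; exact hb s hs _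
      _ = (|s|⁻¹ * |s|) * (D * ‖f - g‖) := by ring
      _ ≤ 1 * (D * ‖f - g‖) := by gcongr; exact inv_mul_le_one
      _ ≤ _ := by rw [one_mul]; gcongr; exact le_max_left _ _
  · rw [← map_sub]
    exact (ContinuousLinearMap.le_opNorm _ _).trans (by gcongr; exact le_max_right _ _)
  · have := hasDerivAt_iff_tendsto_slope_zero.1 (hder F hF 0 (by simpa using hτ))
    simpa only [zero_add, h0, Complex.coe_smul] using this

end LocalGroup

/-! ### First order behaviour of the flow operators at time zero -/

namespace IsLocalFlow

variable {χ : R3 → ℝ} {Φ : ℝ → R3 → R3} {τ C s : ℝ} {c : ℝ≥0∞}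

theorem hasDerivAt_flowL (h : IsLocalFlow χ Φ τ C c) (hχ : IsTestFunction χ) (hs : |s| < τ)
    {F : H1} (hF : F ∈ smoothH1) :
    HasDerivAt (fun s => h.flowL s (valL F)) (h.flowL s (dirL hχ F)) s := by
  obtain ⟨D, -, hb⟩ := h.exists_norm_flowL_sub_le hχ hF
  exact hasDerivAt_localGroup ENNReal.toReal_nonneg h.norm_flowL_le h.flowL_add h.pos hb hs

theorem tendsto_flowL_slope (h : IsLocalFlow χ Φ τ C c) (hχ : IsTestFunction χ) (F : H1) :
    Tendsto (fun s : ℝ => ((s⁻¹ : ℝ) : ℂ) • (h.flowL s (valL F) - valL F)) (𝓝[≠] 0) (𝓝 (dirL hχ F)) :=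
  tendsto_slope_localGroup ENNReal.toReal_nonneg h.norm_flowL_le h.flowL_zero h.pos dense_smoothH1
    (fun _ hF _ hs => h.hasDerivAt_flowL hχ hs hF) F

theorem tendsto_flowL (h : IsLocalFlow χ Φ τ C c) (hχ : IsTestFunction χ) (f : L2) :
    Tendsto (fun s => h.flowL s f) (𝓝 0) (𝓝 f) := by
  obtain ⟨k, hk, hkb⟩ : ∃ k, 0 ≤ k ∧ ∀ s f, ‖h.flowL s f‖ ≤ k * ‖f‖ :=
    ⟨_, ENNReal.toReal_nonneg, h.norm_flowL_le⟩
  refine tendsto_of_dense (C := max k 1) dense_smoothL2 (T := fun s f => h.flowL s f)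
    (S := fun f => f) (.of_forall fun s f g => ?_) (fun f g => ?_) ?_ f
  · rw [← map_sub]
    exact (hkb s _).trans (by gcongr; exact le_max_left _ _)
  · exact le_mul_of_one_le_left (norm_nonneg _) (le_max_right _ _)
  · rintro _ ⟨f, hf, hsf, rfl⟩
    have hf1 : ContDiff ℝ 1 f := hf.of_le (by simp)
    have e : toL2 f hf.continuous hsf = valL (ofC1 f hf1 hsf) :=
      Lp.ext ((coeFn_toL2 _ _).trans (coeFn_valL_ofC1 hf1 hsf).symm)
    have := (h.hasDerivAt_flowL hχ h.zero_lt (F := ofC1 f hf1 hsf)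
      ⟨f, hf, hsf, rfl⟩).continuousAt.tendsto
    rw [h.flowL_zero] at this
    simp only [e]
    exact this

/-- The Jacobian matrix differs from the identity by O(|s|) in the supremum norm. -/
theorem tendsto_jac (h : IsLocalFlow χ Φ τ C c) (hχ : IsTestFunction χ) (j i : Fin 3) {f : L2}
    {F : ℝ → L2} {l : Filter ℝ} (hl : l ≤ 𝓝 0) (hF : Tendsto F l (𝓝 f)) :
    Tendsto (fun s => if hs : |s| < τ then mulL (h.jac hs j i) (F s) else 0) l
      (𝓝 (if j = i then f else 0)) := by
  obtain ⟨M, hM⟩ : ∃ M, M = ‖((hχ.pd i).pd j).bcf‖ := ⟨_, rfl⟩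
  have h0 : Tendsto (fun s => if j = i then F s else 0) l (𝓝 (if j = i then f else 0)) := by
    split_ifs
    · exact hF
    · exact tendsto_const_nhds
  refine (tendsto_iff_of_dist (f₁ := fun s => if j = i then F s else 0) ?_).1 h0
  have hid : Tendsto (fun s : ℝ => s) l (𝓝 0) := hl
  have hz : Tendsto (fun s : ℝ => (C * s ^ 2 + |s| * M) * ‖F s‖) l (𝓝 ((C * 0 ^ 2 + |0| * M) * ‖f‖)) :=
    (((hid.pow 2).const_mul C).add (hid.abs.mul_const M)).mul hF.norm
  simp only [ne_eq, OfNat.ofNat_ne_zero, not_false_eq_true, zero_pow, mul_zero, abs_zero, zero_mul,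
    add_zero] at hz
  refine squeeze_zero' (.of_forall fun s => dist_nonneg) ?_ hz
  filter_upwards [hl h.eventually_lt] with s hs
  rw [dif_pos hs, dist_comm, dist_eq_norm]
  have e : mulL (h.jac hs j i) (F s) - (if j = i then F s else 0)
      = mulL (h.jac hs j i - (if j = i then 1 else 0)) (F s) := by
    rw [mulL_sub]
    split_ifs
    · rw [mulL_one]
    · have := mulL_sub 0 0 (F s)
      rw [sub_zero, sub_self] at this
      rw [this]
  rw [e]
  refine (norm_mulL_le _ _).trans ?_
  gcongr
  have h1 := h.norm_jac_sub_le hχ hs j i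
  have h2 : ‖s • ((hχ.pd i).pd j).bcf‖ = |s| * M := by rw [norm_smul, hM, Real.norm_eq_abs]
  calc ‖h.jac hs j i - (if j = i then 1 else 0)‖ ≤ _ := norm_le_norm_sub_add _ (s • ((hχ.pd i).pd j).bcf)
    _ ≤ _ := by rw [h2]; gcongr

theorem tendsto_flowH1 (h : IsLocalFlow χ Φ τ C c) (hχ : IsTestFunction χ) (f : H1) :
    Tendsto (fun s => h.flowH1 s f) (𝓝 0) (𝓝 f) := by
  refine tendsto_H1 ?_ fun j => ?_
  · refine (h.tendsto_flowL hχ (valL f)).congr' ?_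
    filter_upwards [h.eventually_lt] with s hs
    exact (h.valL_flowH1 hs f).symm
  · have h1 := tendsto_finsetSum Finset.univ fun i _ =>
      h.tendsto_jac hχ j i le_rfl (h.tendsto_flowL hχ (gradL i f))
    have e : ∑ i, (if j = i then gradL i f else 0) = gradL j f := by simp
    rw [e] at h1
    refine h1.congr' ?_
    filter_upwards [h.eventually_lt] with s hs
    refine Eq.trans (Finset.sum_congr rfl fun i _ => ?_) (h.gradL_flowH1 hs j f).symm
    rw [dif_pos hs]

/-- The difference quotient of the Jacobian matrix at time zero. -/
theorem tendsto_jac_slope (h : IsLocalFlow χ Φ τ C c) (hχ : IsTestFunction χ) (j i : Fin 3)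
    (f : L2) :
    Tendsto (fun s : ℝ => if hs : |s| < τ then
      ((s⁻¹ : ℝ) : ℂ) • mulL (h.jac hs j i - if j = i then 1 else 0) (h.flowL s f) else 0) (𝓝[≠] 0)
      (𝓝 (mulL ((hχ.pd i).pd j).bcf f)) := by
  have hid : Tendsto (fun s : ℝ => s) (𝓝[≠] 0) (𝓝 0) := nhdsWithin_le_nhds
  have hT : Tendsto (fun s => h.flowL s f) (𝓝[≠] 0) (𝓝 f) := (h.tendsto_flowL hχ f).mono_left hid
  have h0 : Tendsto (fun s => mulL ((hχ.pd i).pd j).bcf (h.flowL s f)) (𝓝[≠] 0)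
      (𝓝 (mulL ((hχ.pd i).pd j).bcf f)) := ((mulL _).continuous.tendsto f).comp hT
  refine (tendsto_iff_of_dist ?_).1 h0
  have hz : Tendsto (fun s : ℝ => C * |s| * ‖h.flowL s f‖) (𝓝[≠] 0) (𝓝 (C * |0| * ‖f‖)) :=
    (hid.abs.const_mul C).mul hT.norm
  simp only [mul_zero, abs_zero, zero_mul] at hz
  refine squeeze_zero' (.of_forall fun s => dist_nonneg) ?_ hz
  filter_upwards [nhdsWithin_le_nhds h.eventually_lt, self_mem_nhdsWithin] with s hs hs0
  have hs0 : s ≠ 0 := hs0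
  rw [dif_pos hs, dist_comm, dist_eq_norm]
  have e : ((s⁻¹ : ℝ) : ℂ) • mulL (h.jac hs j i - if j = i then 1 else 0) (h.flowL s f)
      - mulL ((hχ.pd i).pd j).bcf (h.flowL s f)
      = ((s⁻¹ : ℝ) : ℂ) • mulL (h.jac hs j i - (if j = i then 1 else 0) - s • ((hχ.pd i).pd j).bcf)
        (h.flowL s f) := by
    rw [mulL_sub _ (s • _), mulL_smul, smul_sub, smul_smul, ← Complex.ofReal_mul,
      inv_mul_cancel₀ hs0, Complex.ofReal_one, one_smul]
  rw [e, norm_smul, Complex.norm_real, norm_inv, Real.norm_eq_abs]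
  calc _ ≤ |s|⁻¹ * (C * s ^ 2 * ‖h.flowL s f‖) := by
        gcongr
        refine (norm_mulL_le _ _).trans ?_
        gcongr
        exact h.norm_jac_sub_le hχ hs j i
    _ = _ := by
        rw [← sq_abs]
        field_simp

end IsLocalFlow

/-! ### Quadratic forms along a local group, and symmetric difference quotients -/

section RealForm

variable {E : Type*} [NormedAddCommGroup E]

/-- A bounded symmetric real bilinear form. -/
structure IsRealForm (B : E → E → ℝ) (K : ℝ) : Prop where
  nonneg : 0 ≤ K
  add_left : ∀ f g h, B (f + g) h = B f h + B g h
  symm : ∀ f g, B f g = B g f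
  bound : ∀ f g, |B f g| ≤ K * ‖f‖ * ‖g‖

namespace IsRealForm

variable {B B' : E → E → ℝ} {K K' : ℝ}

theorem sub_left (hB : IsRealForm B K) (f g h : E) : B (f - g) h = B f h - B g h := by
  rw [eq_sub_iff_add_eq, ← hB.add_left, sub_add_cancel]

theorem sub_right (hB : IsRealForm B K) (f g h : E) : B f (g - h) = B f g - B f h := by
  rw [hB.symm, hB.sub_left, hB.symm g, hB.symm h]

theorem abs_self_sub_self_le (hB : IsRealForm B K) (f g : E) :
    |B f f - B g g| ≤ K * (‖f‖ + ‖g‖) * ‖f - g‖ := by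
  have e : B f f - B g g = B (f - g) f + B (f - g) g := by
    rw [hB.sub_left, hB.sub_left, hB.symm f g]
    ring
  rw [e]
  refine (abs_add_le _ _).trans ((add_le_add (hB.bound _ _) (hB.bound _ _)).trans_eq ?_)
  ring

theorem continuous_self (hB : IsRealForm B K) : Continuous fun f => B f f := by
  refine continuous_iff_continuousAt.2 fun f => ?_
  refine tendsto_iff_dist_tendsto_zero.2 ?_
  have h1 : Tendsto (fun g => K * (‖g‖ + ‖f‖) * ‖g - f‖) (𝓝 f) (𝓝 (K * (‖f‖ + ‖f‖) * ‖f - f‖)) := by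
    have : Continuous fun g => K * (‖g‖ + ‖f‖) * ‖g - f‖ := by fun_prop
    exact this.tendsto f
  rw [sub_self, norm_zero, mul_zero] at h1
  exact squeeze_zero (fun _ => dist_nonneg) (fun g => hB.abs_self_sub_self_le g f) h1

variable [NormedSpace ℂ E] {T : ℝ → E →L[ℂ] E} {D τ : ℝ} {S : Set E}

/-- The derivative of a quadratic form along a local group extends from a dense set. -/
theorem hasDerivAt_of_dense (hB : IsRealForm B K) (hB' : IsRealForm B' K')
    (hD0 : 0 ≤ D) (hD : ∀ s f, ‖T s f‖ ≤ D * ‖f‖) (hS : Dense S)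
    (hder : ∀ F ∈ S, ∀ s, |s| < τ →
      HasDerivAt (fun s => B (T s F) (T s F)) (B' (T s F) (T s F)) s) (F : E) {s : ℝ}
    (hs : |s| < τ) : HasDerivAt (fun s => B (T s F) (T s F)) (B' (T s F) (T s F)) s := by
  obtain ⟨F', hF', hlim⟩ := mem_closure_iff_seq_limit.1 (hS F)
  -- The operators T_s are bounded uniformly in s, so the derivatives along approximating orbits
  -- converge uniformly on |s| < τ.
  refine hasDerivAt_of_tendstoUniformlyOn (s := {s : ℝ | |s| < τ}) (l := atTop)
    (f := fun n s => B (T s (F' n)) (T s (F' n))) (f' := fun n s => B' (T s (F' n)) (T s (F' n)))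
    (g := fun s => B (T s F) (T s F)) (g' := fun s => B' (T s F) (T s F))
    (isOpen_lt continuous_abs continuous_const) ?_
    (.of_forall fun n s hs => hder _ (hF' n) s hs) (fun s hs => ?_) hs
  · have hK' := hB'.nonneg
    have h1 : Tendsto (fun n => K' * (D * ‖F‖ + D * ‖F' n‖) * (D * ‖F - F' n‖)) atTop
        (𝓝 (K' * (D * ‖F‖ + D * ‖F‖) * (D * ‖F - F‖))) :=
      (((hlim.norm.const_mul D).const_add _).const_mul K').mul
        ((hlim.const_sub F).norm.const_mul D)
    rw [sub_self, norm_zero, mul_zero, mul_zero] at h1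
    refine Metric.tendstoUniformlyOn_iff.2 fun ε hε => ?_
    filter_upwards [h1.eventually (gt_mem_nhds hε)] with n hn s hs
    refine lt_of_le_of_lt ((hB'.abs_self_sub_self_le _ _).trans ?_) hn
    rw [← map_sub]
    gcongr
    · exact hD s F
    · exact hD s _
    · exact hD s _
  · exact (hB.continuous_self.tendsto _).comp (((T s).continuous.tendsto F).comp hlim)

/-- Mean value inequality. It is meant for F replaced by an increment T_s F - F, where the factor
‖F‖² is itself small. -/
theorem abs_sub_le (hB' : IsRealForm B' K')
    (hD : ∀ s f, ‖T s f‖ ≤ D * ‖f‖) (h0 : ∀ f, T 0 f = f)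
    {F : E} (hder : ∀ s, |s| < τ →
      HasDerivAt (fun s => B (T s F) (T s F)) (B' (T s F) (T s F)) s) {s : ℝ}
    (hs : |s| < τ) : |B (T s F) (T s F) - B F F| ≤ K' * D ^ 2 * ‖F‖ ^ 2 * |s| := by
  have hK' := hB'.nonneg
  have := (convex_Icc (-|s|) |s|).norm_image_sub_le_of_norm_hasDerivWithin_le
    (f := fun s => B (T s F) (T s F)) (f' := fun s => B' (T s F) (T s F))
    (C := K' * (D * ‖F‖) * (D * ‖F‖)) (x := 0) (y := s)
    (fun r hr => (hder r ((abs_le.2 hr).trans_lt hs)).hasDerivWithinAt)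
    (fun r hr => (hB'.bound _ _).trans (by
      have := (norm_nonneg _).trans (hD r F)
      gcongr
      · exact hD r F
      · exact hD r F))
    ⟨by linarith [abs_nonneg s], abs_nonneg s⟩ ⟨neg_abs_le s, le_abs_self s⟩
  rw [h0, sub_zero, Real.norm_eq_abs, Real.norm_eq_abs] at this
  exact this.trans_eq (by ring)

/-- The symmetric difference quotients of a local group, tested against the orbit through a quadratic
form, converge to the derivative of the quadratic form. -/
theorem tendsto_symm_slope (hB : IsRealForm B K) (hB' : IsRealForm B' K')
    (hD0 : 0 ≤ D) (hD : ∀ s f, ‖T s f‖ ≤ D * ‖f‖) (h0 : ∀ f, T 0 f = f) (hτ : 0 < τ)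
    (hneg : ∀ s, |s| < τ → ∀ f, T (-s) (T s f) = f)
    (hlim : ∀ f, Tendsto (fun s => T s f) (𝓝 0) (𝓝 f)) (hS : Dense S)
    (hder : ∀ F ∈ S, ∀ s, |s| < τ →
      HasDerivAt (fun s => B (T s F) (T s F)) (B' (T s F) (T s F)) s) (F : E) :
    Tendsto (fun s : ℝ => s⁻¹ * B (T s F - T (-s) F) F) (𝓝[≠] 0) (𝓝 (B' F F)) := by
  have hder' : ∀ F s, |s| < τ →
      HasDerivAt (fun s => B (T s F) (T s F)) (B' (T s F) (T s F)) s := fun F s hs =>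
    hB.hasDerivAt_of_dense hB' hD0 hD hS hder F hs
  have hK' := hB'.nonneg
  have h1 : Tendsto (fun s : ℝ => s⁻¹ * (B (T s F) (T s F) - B F F)) (𝓝[≠] 0) (𝓝 (B' F F)) := by
    have := hasDerivAt_iff_tendsto_slope_zero.1 (hder' F 0 (by simpa using hτ))
    simpa only [zero_add, h0, smul_eq_mul] using this
  have hnegT : Tendsto (fun s : ℝ => -s) (𝓝[≠] 0) (𝓝[≠] 0) := by
    refine tendsto_nhdsWithin_iff.2 ⟨?_, ?_⟩
    · have : Tendsto (fun s : ℝ => -s) (𝓝 0) (𝓝 0) := by simpa using (continuous_neg (G := ℝ)).tendsto 0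
      exact this.mono_left nhdsWithin_le_nhds
    · filter_upwards [self_mem_nhdsWithin] with s hs
      simpa using hs
  have h2 := h1.comp hnegT
  -- The central cancellation. The quadratic remainder B(T_s F - F, T_s F - F) need not be o(s), but
  -- T_{-s} maps T_s F - F to F - T_{-s} F, so the remainders at s and -s differ by at most a
  -- constant times |s| ‖T_s F - F‖², which is o(s).
  have h3 : Tendsto (fun s : ℝ => s⁻¹ * (B (T (-s) (T s F - F)) (T (-s) (T s F - F))
      - B (T s F - F) (T s F - F))) (𝓝[≠] 0) (𝓝 0) := by
    have hz : Tendsto (fun s : ℝ => K' * D ^ 2 * ‖T s F - F‖ ^ 2) (𝓝[≠] 0)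
        (𝓝 (K' * D ^ 2 * ‖F - F‖ ^ 2)) :=
      ((((hlim F).mono_left nhdsWithin_le_nhds).sub_const F).norm.pow 2).const_mul _
    rw [sub_self, norm_zero, zero_pow two_ne_zero, mul_zero] at hz
    refine squeeze_zero_norm' ?_ hz
    have hτ' : ∀ᶠ r in 𝓝 (0 : ℝ), |r| < τ :=
      (isOpen_lt continuous_abs continuous_const).mem_nhds (by simpa using hτ)
    filter_upwards [nhdsWithin_le_nhds hτ'] with s hs
    have hs' : |-s| < τ := by rwa [abs_neg]
    have h4 := hB'.abs_sub_le hD h0 (hder' (T s F - F)) hs'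
    rw [abs_neg] at h4
    rw [norm_mul, norm_inv, Real.norm_eq_abs, Real.norm_eq_abs]
    calc _ ≤ |s|⁻¹ * (K' * D ^ 2 * ‖T s F - F‖ ^ 2 * |s|) := by gcongr
      _ = (|s|⁻¹ * |s|) * (K' * D ^ 2 * ‖T s F - F‖ ^ 2) := by ring
      _ ≤ 1 * (K' * D ^ 2 * ‖T s F - F‖ ^ 2) := by gcongr; exact inv_mul_le_one
      _ = _ := one_mul _
  -- In the sum of the forward quotient, the backward quotient and the difference of remainders all
  -- diagonal terms cancel, leaving twice the symmetric quotient.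
  have h5 := ((h1.add h2).add h3).const_mul (1 / 2)
  have e5 : 1 / 2 * (B' F F + B' F F + 0) = B' F F := by ring
  rw [e5] at h5
  refine h5.congr' ?_
  have hτ' : ∀ᶠ r in 𝓝 (0 : ℝ), |r| < τ :=
    (isOpen_lt continuous_abs continuous_const).mem_nhds (by simpa using hτ)
  filter_upwards [nhdsWithin_le_nhds hτ'] with s hs
  have e6 : T (-s) (T s F - F) = F - T (-s) F := by rw [map_sub, hneg s hs]
  have e7 : B (T s F) F = B F (T s F) := hB.symm _ _
  have e8 : B (T (-s) F) F = B F (T (-s) F) := hB.symm _ _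
  rw [e6]
  simp only [Function.comp_apply, hB.sub_left, hB.sub_right, e7, e8, inv_neg]
  ring

end IsRealForm

end RealForm

/-! ### The weak divergence of V∇χ and integrals along the flow -/

open ContinuousLinearMap in
theorem pd_mollify (φ : ContDiffBump (0 : R3)) {G : R3 → ℝ} (hG : ContDiff ℝ 1 G)
    (hs : HasCompactSupport G) (i : Fin 3) : pd i (mollify φ G) = mollify φ (pd i G) := by
  funext x
  have h1 : LocallyIntegrable (φ.normed volume) volume :=
    (continuous_normed φ).locallyIntegrable
  have h := hs.hasFDerivAt_convolution_right (lsmul ℝ ℝ) h1 hG x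
  have h2 : fderiv ℝ (mollify φ G) x = _ := h.fderiv
  rw [pd, h2, convolution_precompR_apply _ h1 (hs.fderiv ℝ) (hG.continuous_fderiv one_ne_zero)]
  rfl

/-- Dominated convergence, with (M + 1)|V| on K as the eventual bound. -/
theorem tendsto_integral_mul_of_uniform {V : R3 → ℝ} (hV : LocallyIntegrable V volume)
    {a : ℕ → R3 → ℝ} {b : R3 → ℝ} (ha : ∀ n, Continuous (a n)) (hb : Continuous b)
    (hbs : HasCompactSupport b) {K : Set R3} (hK : IsCompact K)
    (hsup : ∀ n, Function.support (a n) ⊆ K)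
    (hu : ∀ ε > 0, ∀ᶠ n in atTop, ∀ x, dist (a n x) (b x) ≤ ε) :
    Tendsto (fun n => ∫ x, V x * a n x) atTop (𝓝 (∫ x, V x * b x)) := by
  obtain ⟨M, hM⟩ := hbs.exists_bound_of_continuous hb
  refine tendsto_integral_filter_of_dominated_convergence
    (fun x => K.indicator (fun x => ‖V x‖ * (M + 1)) x)
    (.of_forall fun n => hV.aestronglyMeasurable.mul (ha n).aestronglyMeasurable) ?_ ?_ ?_
  · filter_upwards [hu 1 one_pos] with n hn
    refine .of_forall fun x => ?_
    by_cases hx : x ∈ K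
    · rw [indicator_of_mem hx, norm_mul]
      gcongr
      calc ‖a n x‖ ≤ ‖a n x - b x‖ + ‖b x‖ := by
            simpa using norm_add_le (a n x - b x) (b x)
        _ ≤ 1 + M := add_le_add (by simpa [dist_eq_norm] using hn x) (hM x)
        _ = M + 1 := add_comm _ _
    · rw [indicator_of_notMem hx, Function.notMem_support.1 fun h => hx (hsup n h)]
      simp
  · rw [integrable_indicator_iff hK.measurableSet]
    exact (hV.integrableOn_isCompact hK).norm.mul_const _
  · refine .of_forall fun x => ?_
    refine Tendsto.const_mul _ (Metric.tendsto_nhds.2 fun ε hε => ?_)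
    filter_upwards [hu (ε / 2) (by positivity)] with n hn
    exact (hn x).trans_lt (by linarith)

/-- `U` represents `-∇·(V∇χ)` in the sense of distributions. -/
structure IsWeakDiv (χ V U : R3 → ℝ) : Prop where
  locallyIntegrable : LocallyIntegrable V volume
  locallyIntegrable' : LocallyIntegrable U volume
  eq : ∀ φ : R3 → ℝ, IsTestFunction φ →
    ∫ x, V x * ∑ i, pd i χ x * pd i φ x = ∫ x, U x * φ x

theorem continuous_pd {f : R3 → ℝ} (hf : ContDiff ℝ 1 f) (i : Fin 3) : Continuous (pd i f) :=
  (hf.continuous_fderiv (by simp)).clm_apply continuous_const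

theorem hasCompactSupport_pd {f : R3 → ℝ} (hs : HasCompactSupport f) (i : Fin 3) :
    HasCompactSupport (pd i f) := hs.fderiv_apply ℝ _

theorem isTestFunction_mollify (n : ℕ) {f : R3 → ℝ} (hf : Continuous f)
    (hs : HasCompactSupport f) : IsTestFunction (mollify (bump n) f) :=
  ⟨contDiff_mollify _ hf.locallyIntegrable, hasCompactSupport_mollify _ hs⟩

/-- The defining identity of `IsWeakDiv` extends to test functions of class `C¹`. -/
theorem IsWeakDiv.eq_of_contDiff {χ V U : R3 → ℝ} (h : IsWeakDiv χ V U) (hχ : IsTestFunction χ)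
    {G : R3 → ℝ} (hG : ContDiff ℝ 1 G) (hs : HasCompactSupport G) :
    ∫ x, V x * ∑ i, pd i χ x * pd i G x = ∫ x, U x * G x := by
  -- G is mollified. Test functions of class C¹ are needed because the identity will be used for
  -- functions composed with the flow, whose regularity is recorded only as C¹.
  obtain ⟨K, hK, -, hKn⟩ := exists_compact_mollify hs
  have h1 := tendsto_integral_mul_of_uniform h.locallyIntegrable'
    (fun n => (isTestFunction_mollify n hG.continuous hs).1.continuous) hG.continuous hs hK hKn
    fun ε hε => tendstoUniformly_mollify_bump hG.continuous hs hε
  obtain ⟨M, hM0, hM⟩ : ∃ M : ℝ, 0 ≤ M ∧ ∀ i x, |pd i χ x| ≤ M := by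
    choose M hM using fun i => (hχ.pd i).2.exists_bound_of_continuous (hχ.pd i).1.continuous
    refine ⟨∑ i, M i, Finset.sum_nonneg fun i _ => (norm_nonneg _).trans (hM i 0), fun i x => ?_⟩
    exact (hM i x).trans (Finset.single_le_sum (f := M)
      (fun j _ => (norm_nonneg _).trans (hM j 0)) (Finset.mem_univ i))
  have hcont : ∀ f : R3 → ℝ, ContDiff ℝ 1 f → Continuous fun x => ∑ i, pd i χ x * pd i f x :=
    fun f hf => continuous_finsetSum _ fun i _ =>
      (hχ.pd i).1.continuous.mul (continuous_pd hf i)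
  -- The factors ∂_iχ confine this integral to the support of χ, so uniform convergence of the
  -- mollified partial derivatives is enough.
  have h2 := tendsto_integral_mul_of_uniform h.locallyIntegrable (K := tsupport χ)
    (a := fun n x => ∑ i, pd i χ x * pd i (mollify (bump n) G) x)
    (b := fun x => ∑ i, pd i χ x * pd i G x)
    (fun n => hcont _ ((isTestFunction_mollify n hG.continuous hs).1.of_le (by simp)))
    (hcont _ hG) (HasCompactSupport.intro hχ.2 fun x hx => by
      have := gradField_eq_zero hx
      exact Finset.sum_eq_zero fun i _ => by
        rw [← gradField_apply, this]
        simp) hχ.2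
    (fun n x hx => by
      by_contra hx'
      have := gradField_eq_zero hx'
      refine hx (Finset.sum_eq_zero fun i _ => ?_)
      rw [← gradField_apply, this]
      simp)
    (fun ε hε => by
      have hε' : 0 < ε / (3 * (M + 1)) := by positivity
      have := eventually_all.2 fun i => tendstoUniformly_mollify_bump (continuous_pd hG i)
        (hasCompactSupport_pd hs i) hε'
      filter_upwards [this] with n hn x
      rw [dist_eq_norm, ← Finset.sum_sub_distrib]
      calc _ ≤ ∑ i : Fin 3, M * (ε / (3 * (M + 1))) := norm_sum_le_of_le _ fun i _ => by
            rw [← mul_sub, norm_mul]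
            have := hn i x
            rw [dist_eq_norm, ← pd_mollify _ hG hs] at this
            gcongr
            exact hM i x
        _ = M / (M + 1) * ε := by
            simp
            field_simp
        _ ≤ 1 * ε := by
            gcongr
            rw [div_le_one (by positivity)]
            linarith
        _ = ε := one_mul _)
  refine tendsto_nhds_unique h2 (h1.congr fun n => ?_)
  exact (h.eq _ (isTestFunction_mollify n hG.continuous hs)).symm

theorem fderiv_eq_sum_pd (f : R3 → ℝ) (x v : R3) :
    fderiv ℝ f x v = ∑ i, v i * pd i f x := by
  conv_lhs => rw [← sum_smul_basisVec v, map_sum]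
  simp [pd]

theorem integrable_mul_of_locallyIntegrable {V : R3 → ℝ} (hV : LocallyIntegrable V volume)
    {G : R3 → ℝ} (hG : Continuous G) (hs : HasCompactSupport G) :
    Integrable (fun x => V x * G x) := by
  simpa [mul_comm] using hV.integrable_smul_left_of_hasCompactSupport hG hs

namespace IsLocalFlow

variable {χ V U : R3 → ℝ} {Φ : ℝ → R3 → R3} {τ C s : ℝ} {c : ℝ≥0∞}

/-- Differentiation of `∫ V G∘Φ_s` along the flow. -/
theorem hasDerivAt_integral (h : IsLocalFlow χ Φ τ C c) (hχ : IsTestFunction χ)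
    (hU : IsWeakDiv χ V U) {G : R3 → ℝ} (hG : ContDiff ℝ 1 G) (hsG : HasCompactSupport G)
    (hs : |s| < τ) :
    HasDerivAt (fun s => ∫ x, V x * G (Φ s x)) (∫ x, U x * G (Φ s x)) s := by
  have hV := hU.locallyIntegrable
  have hcX : Continuous fun x => fderiv ℝ G x (gradField χ x) :=
    (hG.continuous_fderiv (by simp)).clm_apply hχ.contDiff_gradField.continuous
  have hsX : HasCompactSupport fun x => fderiv ℝ G x (gradField χ x) :=
    HasCompactSupport.intro hχ.2 fun x hx => by rw [gradField_eq_zero hx, map_zero]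
  obtain ⟨M, hM⟩ := hsX.exists_bound_of_continuous hcX
  have hopen : {s : ℝ | |s| < τ} ∈ 𝓝 s := (isOpen_lt continuous_abs continuous_const).mem_nhds hs
  -- Points outside the support of χ do not move, so the derivative of the integrand is dominated by
  -- a multiple of |V| on that compact set.
  have key := (hasDerivAt_integral_of_dominated_loc_of_deriv_le (μ := volume)
    (F := fun s x => V x * G (Φ s x)) (x₀ := s) (s := {s : ℝ | |s| < τ})
    (F' := fun s x => V x * fderiv ℝ G (Φ s x) (gradField χ (Φ s x)))
    (bound := (tsupport χ).indicator fun x => ‖V x‖ * M) hopen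
    (by
      filter_upwards [hopen] with r hr
      exact hV.aestronglyMeasurable.mul
        (hG.continuous.comp (h.continuous hr)).aestronglyMeasurable)
    (integrable_mul_of_locallyIntegrable hV (hG.continuous.comp (h.continuous hs))
      (h.hasCompactSupport_comp hχ.2 s hsG))
    (hV.aestronglyMeasurable.mul (hcX.comp (h.continuous hs)).aestronglyMeasurable)
    (.of_forall fun x r _ => by
      by_cases hx : x ∈ tsupport χ
      · rw [indicator_of_mem hx, norm_mul]
        gcongr
        exact hM _
      · rw [indicator_of_notMem hx, h.eq_self r x hx, gradField_eq_zero hx]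
        simp)
    (by
      rw [integrable_indicator_iff (isClosed_tsupport χ).measurableSet]
      exact (hV.integrableOn_isCompact hχ.2).norm.mul_const _)
    (.of_forall fun x r _ => (h.hasDerivAt_comp hG x r).const_mul (V x))).2
  refine key.congr_deriv ?_
  rw [← hU.eq_of_contDiff hχ (h.contDiff_comp hs hG) (h.hasCompactSupport_comp hχ.2 s hsG)]
  refine integral_congr_ae (.of_forall fun x => ?_)
  show V x * _ = V x * _
  congr 1
  -- Since G∘Φ_{s+r} = (G∘Φ_s)∘Φ_r, the derivative at time s equals ∇χ·∇(G∘Φ_s) at x, so the weak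
  -- identity applies with test function G∘Φ_s.
  have h1 := h.hasDerivAt_comp hG x s
  have h2 := h.hasDerivAt_comp (h.contDiff_comp hs hG) x 0
  rw [h.isFlow.zero] at h2
  have h3 : (fun r => G (Φ s (Φ r x))) = fun r => G (Φ (s + r) x) := by
    funext r
    rw [h.add]
  rw [h3] at h2
  have h4 : HasDerivAt (fun r => G (Φ (s + r) x)) (fderiv ℝ G (Φ s x) (gradField χ (Φ s x))) 0 :=
    HasDerivAt.comp_const_add s 0 (by simpa using h1)
  have h5 := h4.unique h2
  rw [h5, fderiv_eq_sum_pd]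
  rfl

end IsLocalFlow

/-! ### Derivatives along the flow of the mass, potential and Dirichlet forms -/

theorem ofC1_congr {f g : R3 → ℂ} (e : f = g) {hf : ContDiff ℝ 1 f} {hs : HasCompactSupport f}
    {hg : ContDiff ℝ 1 g} {hs' : HasCompactSupport g} : ofC1 f hf hs = ofC1 g hg hs' := by
  subst e
  rfl

/-- The Laplacian of `χ` as a sum of iterated partial derivatives. -/
def lapl (χ : R3 → ℝ) (x : R3) : ℝ := ∑ i, pd i (pd i χ) x

theorem IsTestFunction.lapl {χ : R3 → ℝ} (hχ : IsTestFunction χ) : IsTestFunction (lapl χ) :=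
  IsTestFunction.sum fun i => (hχ.pd i).pd i

theorem isRealForm_inner {G : Type*} [NormedAddCommGroup G] [InnerProductSpace ℂ G] :
    IsRealForm (fun f g : G => (⟪f, g⟫_ℂ).re) 1 where
  nonneg := zero_le_one
  add_left f g h := by rw [inner_add_left, Complex.add_re]
  symm f g := by
    rw [← inner_conj_symm, Complex.conj_re]
  bound f g := by
    rw [one_mul]
    exact (Complex.abs_re_le_norm _).trans (norm_inner_le_norm f g)

theorem isRealForm_neg_inner_mulL (a : R3 →ᵇ ℝ) :
    IsRealForm (fun f g : L2 => -(⟪f, mulL a g⟫_ℂ).re) ‖a‖ where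
  nonneg := norm_nonneg a
  add_left f g h := by
    rw [inner_add_left, Complex.add_re]
    ring
  symm f g := by
    rw [← inner_conj_symm, Complex.conj_re, inner_mulL_left]
  bound f g := by
    rw [abs_neg]
    refine (Complex.abs_re_le_norm _).trans ((norm_inner_le_norm _ _).trans ?_)
    have := norm_mulL_le a g
    calc ‖f‖ * ‖mulL a g‖ ≤ ‖f‖ * (‖a‖ * ‖g‖) := by gcongr
      _ = _ := by ring

theorem isRealForm_form {w : R3 → ℝ} (hw : FormBounded w) :
    ∃ K, IsRealForm (fun f g : H1 => (form hw f g).re) K := by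
  obtain ⟨K, hK, hb⟩ := exists_form_bound hw
  exact ⟨K, hK, fun f g k => by rw [form_add_left, Complex.add_re],
    fun f g => by rw [← form_conj_symm, Complex.conj_re],
    fun f g => (Complex.abs_re_le_norm _).trans (hb f g)⟩

theorem integral_lapl_mul {χ φ : R3 → ℝ} (hχ : IsTestFunction χ) (hφ : IsTestFunction φ) :
    ∫ x, ∑ i, pd i χ x * pd i φ x = -∫ x, lapl χ x * φ x := by
  have hint1 : ∀ i, Integrable fun x => pd i χ x * pd i φ x := fun i =>
    ((hχ.pd i).mul (hφ.pd i).1).1.continuous.integrable_of_hasCompactSupport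
      ((hχ.pd i).mul (hφ.pd i).1).2
  have hint2 : ∀ i, Integrable fun x => pd i (pd i χ) x * φ x := fun i =>
    (((hχ.pd i).pd i).mul hφ.1).1.continuous.integrable_of_hasCompactSupport
      (((hχ.pd i).pd i).mul hφ.1).2
  simp only [lapl, Finset.sum_mul]
  rw [integral_finsetSum _ fun i _ => hint1 i, integral_finsetSum _ fun i _ => hint2 i,
    ← Finset.sum_neg_distrib]
  refine Finset.sum_congr rfl fun i _ => ?_
  have h := integral_fderiv_eq_zero (((hχ.pd i).mul hφ.1).1.of_le (by simp))
    ((hχ.pd i).mul hφ.1).2 (basisVec i)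
  have e : ∀ x, fderiv ℝ (fun x => pd i χ x * φ x) x (basisVec i)
      = pd i (pd i χ) x * φ x + pd i χ x * pd i φ x := fun x =>
    pd_mul ((hχ.pd i).1.differentiable (by simp)) (hφ.1.differentiable (by simp)) i x
  simp only [e] at h
  rw [integral_add (hint2 i) (hint1 i)] at h
  linarith

/-- The case V = 1 lets the L² norm, and later |v|⁴, be treated by the same identities as the
potential. -/
theorem isWeakDiv_one {χ : R3 → ℝ} (hχ : IsTestFunction χ) :
    IsWeakDiv χ (fun _ => 1) (fun x => -lapl χ x) where
  locallyIntegrable := locallyIntegrable_const 1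
  locallyIntegrable' := hχ.lapl.1.continuous.neg.locallyIntegrable
  eq φ hφ := by
    simp only [one_mul, neg_mul]
    rw [integral_lapl_mul hχ hφ, integral_neg]

theorem contDiff_norm_sq {f : R3 → ℂ} (hf : ContDiff ℝ 1 f) : ContDiff ℝ 1 fun x => ‖f x‖ ^ 2 :=
  hf.norm_sq ℝ

theorem hasCompactSupport_norm_sq {f : R3 → ℂ} (hs : HasCompactSupport f) :
    HasCompactSupport fun x => ‖f x‖ ^ 2 :=
  hs.norm.comp_left (g := fun r : ℝ => r ^ 2) (by simp)

theorem inner_self_of_ae {f : L2} {f' : R3 → ℂ} (hf : f =ᵐ[volume] f') :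
    (⟪f, f⟫_ℂ).re = ∫ x, ‖f' x‖ ^ 2 := by
  have h := inner_mulL_self 1 f
  rw [mulL_one] at h
  rw [h, Complex.ofReal_re]
  refine integral_congr_ae ?_
  filter_upwards [hf] with x hx
  simp [hx]

theorem inner_mulL_self_of_ae (a : R3 →ᵇ ℝ) {f : L2} {f' : R3 → ℂ} (hf : f =ᵐ[volume] f') :
    (⟪f, mulL a f⟫_ℂ).re = ∫ x, a x * ‖f' x‖ ^ 2 := by
  rw [inner_mulL_self, Complex.ofReal_re]
  refine integral_congr_ae ?_
  filter_upwards [hf] with x hx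
  rw [hx]

theorem form_self_of_ae {w : R3 → ℝ} (hw : FormBounded w) {F : H1} {f' : R3 → ℂ}
    (hf : valL F =ᵐ[volume] f') : (form hw F F).re = ∫ x, w x * ‖f' x‖ ^ 2 := by
  rw [form_self, Complex.ofReal_re]
  refine integral_congr_ae ?_
  filter_upwards [hf] with x hx
  rw [hx]

namespace IsLocalFlow

variable {χ V U : R3 → ℝ} {Φ : ℝ → R3 → R3} {τ C s : ℝ} {c : ℝ≥0∞}

theorem flowH1_zero (h : IsLocalFlow χ Φ τ C c) (hχ : HasCompactSupport χ) (f : H1) :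
    h.flowH1 0 f = f := by
  refine (dense_smoothH1.induction (P := fun f : H1 => h.flowH1 0 f = f)
    ?_ (isClosed_eq (h.flowH1 0).continuous continuous_id)) f
  rintro _ ⟨f, hf, hsf, rfl⟩
  rw [h.flowH1_ofC1 hχ h.zero_lt]
  exact ofC1_congr (funext fun x => congrArg f (h.isFlow.zero x))

/-- For smooth f the form along the orbit is ∫ V G∘Φ_s with G = |f|². -/
theorem hasDerivAt_form (h : IsLocalFlow χ Φ τ C c) (hχ : IsTestFunction χ)
    (hV : FormBounded V) (hU : FormBounded U) (hw : IsWeakDiv χ V U) {F : H1}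
    (hF : F ∈ smoothH1) (hs : |s| < τ) :
    HasDerivAt (fun s => (form hV (h.flowH1 s F) (h.flowH1 s F)).re)
      (form hU (h.flowH1 s F) (h.flowH1 s F)).re s := by
  obtain ⟨f, hf, hsf, rfl⟩ := hF
  have hf1 : ContDiff ℝ 1 f := hf.of_le (by simp)
  have hae : ∀ r, |r| < τ → valL (h.flowH1 r (ofC1 f hf1 hsf)) =ᵐ[volume] fun x => f (Φ r x) :=
    fun r hr => by
      rw [h.valL_flowH1 hr]
      exact h.coeFn_flowL_of_ae hr (coeFn_valL_ofC1 hf1 hsf)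
  have key := h.hasDerivAt_integral hχ hw (contDiff_norm_sq hf1) (hasCompactSupport_norm_sq hsf) hs
  rw [← form_self_of_ae hU (hae s hs)] at key
  refine key.congr_of_eventuallyEq ?_
  filter_upwards [(isOpen_lt continuous_abs continuous_const).mem_nhds hs] with r hr
  exact form_self_of_ae hV (hae r hr)

theorem tendsto_form_symm_slope (h : IsLocalFlow χ Φ τ C c) (hχ : IsTestFunction χ)
    (hV : FormBounded V) (hU : FormBounded U) (hw : IsWeakDiv χ V U) (F : H1) :
    Tendsto (fun s : ℝ => s⁻¹ * (form hV (h.flowH1 s F - h.flowH1 (-s) F) F).re)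
      (𝓝[≠] 0) (𝓝 (form hU F F).re) := by
  have h1 := isRealForm_form hV
  have h2 := isRealForm_form hU
  have h3 := h.exists_norm_flowH1_le
  obtain ⟨K, hK⟩ := h1
  obtain ⟨K', hK'⟩ := h2
  obtain ⟨D, hD0, hD⟩ := h3
  exact hK.tendsto_symm_slope (T := h.flowH1) (S := smoothH1) hK' hD0 hD (h.flowH1_zero hχ.2) h.pos
    (fun _ hs f => h.flowH1_neg hχ.2 hs f) (h.tendsto_flowH1 hχ) dense_smoothH1
    (fun _ hF _ hs => h.hasDerivAt_form hχ hV hU hw hF hs) F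

theorem hasDerivAt_inner (h : IsLocalFlow χ Φ τ C c) (hχ : IsTestFunction χ) {F : L2}
    (hF : F ∈ smoothL2) (hs : |s| < τ) :
    HasDerivAt (fun s => (⟪h.flowL s F, h.flowL s F⟫_ℂ).re)
      (-(⟪h.flowL s F, mulL hχ.lapl.bcf (h.flowL s F)⟫_ℂ).re) s := by
  obtain ⟨f, hf, hsf, rfl⟩ := hF
  have hf1 : ContDiff ℝ 1 f := hf.of_le (by simp)
  have hae : ∀ r, |r| < τ → h.flowL r (toL2 f hf.continuous hsf) =ᵐ[volume] fun x => f (Φ r x) :=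
    fun r hr => h.coeFn_flowL_of_ae hr (coeFn_toL2 _ _)
  have key := h.hasDerivAt_integral hχ (isWeakDiv_one hχ) (contDiff_norm_sq hf1)
    (hasCompactSupport_norm_sq hsf) hs
  simp only [one_mul, neg_mul, integral_neg] at key
  rw [inner_mulL_self_of_ae _ (hae s hs)]
  refine key.congr_of_eventuallyEq ?_
  filter_upwards [(isOpen_lt continuous_abs continuous_const).mem_nhds hs] with r hr
  exact inner_self_of_ae (hae r hr)

theorem tendsto_inner_symm_slope (h : IsLocalFlow χ Φ τ C c) (hχ : IsTestFunction χ) (F : L2) :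
    Tendsto (fun s : ℝ => s⁻¹ * (⟪h.flowL s F - h.flowL (-s) F, F⟫_ℂ).re)
      (𝓝[≠] 0) (𝓝 (-(⟪F, mulL hχ.lapl.bcf F⟫_ℂ).re)) :=
  isRealForm_inner.tendsto_symm_slope (T := h.flowL) (S := smoothL2)
    (isRealForm_neg_inner_mulL hχ.lapl.bcf) ENNReal.toReal_nonneg h.norm_flowL_le h.flowL_zero h.pos
    (fun _ hs f => h.flowL_neg hs f) (h.tendsto_flowL hχ) dense_smoothL2
    (fun _ hF _ hs => h.hasDerivAt_inner hχ hF hs) F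

end IsLocalFlow

namespace IsLocalFlow

variable {χ V U : R3 → ℝ} {Φ : ℝ → R3 → R3} {τ C s : ℝ} {c : ℝ≥0∞}

theorem sum_mulL_jac (h : IsLocalFlow χ Φ τ C c) (hs : |s| < τ) (j : Fin 3) (x : Fin 3 → L2) :
    ∑ i, mulL (h.jac hs j i) (x i)
      = x j + ∑ i, mulL (h.jac hs j i - if j = i then 1 else 0) (x i) := by
  have hδ : ∀ i, mulL (if j = i then 1 else 0) (x i) = if j = i then x i else 0 := by
    intro i
    split_ifs
    · exact mulL_one _
    · have := mulL_sub 0 0 (x i)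
      rwa [sub_zero, sub_self] at this
  simp only [mulL_sub, hδ, Finset.sum_sub_distrib, Finset.sum_ite_eq, Finset.mem_univ, if_true]
  abel

/-- The derivative of the Dirichlet form in the direction of the symmetric difference quotients. -/
theorem tendsto_gradient_symm_slope (h : IsLocalFlow χ Φ τ C c) (hχ : IsTestFunction χ) (j : Fin 3)
    (g : Fin 3 → L2) {A : ℝ → L2}
    (hA : ∀ s (hs : |s| < τ), A s = ∑ i, mulL (h.jac hs j i) (h.flowL s (g i))) :
    Tendsto (fun s : ℝ => s⁻¹ * (⟪A s - A (-s), g j⟫_ℂ).re) (𝓝[≠] 0)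
      (𝓝 (-(⟪g j, mulL hχ.lapl.bcf (g j)⟫_ℂ).re
        + 2 * (∑ i, ⟪mulL ((hχ.pd i).pd j).bcf (g i), g j⟫_ℂ).re)) := by
  -- The gradient of v∘Φ_s is split as (∂_j v)∘Φ_s + s R_s, with R_s tending to ∑ ∂_j∂_iχ ∂_i v. The
  -- first part is the L² case of the symmetric quotient, and R_s and R_{-s} contribute the same
  -- Hessian term, whence the factor 2.
  obtain ⟨R, hR⟩ : ∃ R : ℝ → L2, R = fun s => ∑ i, if hs : |s| < τ then
      ((s⁻¹ : ℝ) : ℂ) • mulL (h.jac hs j i - if j = i then 1 else 0) (h.flowL s (g i)) else 0 :=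
    ⟨_, rfl⟩
  have hRA : ∀ s, |s| < τ → s ≠ 0 → A s = h.flowL s (g j) + (s : ℂ) • R s := by
    intro s hs hs0
    rw [hA s hs, h.sum_mulL_jac hs, hR]
    simp only [dif_pos hs, ← Finset.smul_sum, smul_smul, ← Complex.ofReal_mul,
      mul_inv_cancel₀ hs0, Complex.ofReal_one, one_smul]
  have hRlim : Tendsto R (𝓝[≠] 0) (𝓝 (∑ i, mulL ((hχ.pd i).pd j).bcf (g i))) := by
    rw [hR]
    exact tendsto_finsetSum _ fun i _ => h.tendsto_jac_slope hχ j i (g i)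
  have hnegT : Tendsto (fun s : ℝ => -s) (𝓝[≠] 0) (𝓝[≠] 0) := by
    refine tendsto_nhdsWithin_iff.2 ⟨?_, ?_⟩
    · have : Tendsto (fun s : ℝ => -s) (𝓝 0) (𝓝 0) := by
        simpa using (continuous_neg (G := ℝ)).tendsto 0
      exact this.mono_left nhdsWithin_le_nhds
    · filter_upwards [self_mem_nhdsWithin] with s hs
      simpa using hs
  have hre : Continuous fun f : L2 => (⟪f, g j⟫_ℂ).re := by fun_prop
  have h1 := (hre.tendsto _).comp hRlim
  have h2 := h1.comp hnegT
  have h3 := ((h.tendsto_inner_symm_slope hχ (g j)).add h1).add h2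
  have e : -(⟪g j, mulL hχ.lapl.bcf (g j)⟫_ℂ).re
      + (⟪∑ i, mulL ((hχ.pd i).pd j).bcf (g i), g j⟫_ℂ).re
      + (⟪∑ i, mulL ((hχ.pd i).pd j).bcf (g i), g j⟫_ℂ).re
      = -(⟪g j, mulL hχ.lapl.bcf (g j)⟫_ℂ).re
        + 2 * (∑ i, ⟪mulL ((hχ.pd i).pd j).bcf (g i), g j⟫_ℂ).re := by
    rw [sum_inner]
    ring
  rw [e] at h3
  refine h3.congr' ?_
  filter_upwards [nhdsWithin_le_nhds h.eventually_lt, self_mem_nhdsWithin] with s hs hs0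
  have hs0 : s ≠ 0 := hs0
  rw [hRA s hs hs0, hRA (-s) (by rwa [abs_neg]) (neg_ne_zero.2 hs0)]
  simp only [Function.comp_apply, inner_sub_left, inner_add_left, inner_smul_left,
    Complex.conj_ofReal, Complex.sub_re, Complex.add_re, Complex.re_ofReal_mul]
  field_simp
  ring

theorem tendsto_valL_symm_slope (h : IsLocalFlow χ Φ τ C c) (hχ : IsTestFunction χ) (v : H1)
    (G : L2) : Tendsto (fun s : ℝ => s⁻¹ * (⟪h.flowL s (valL v) - h.flowL (-s) (valL v), G⟫_ℂ).re)
      (𝓝[≠] 0) (𝓝 (2 * (⟪dirL hχ v, G⟫_ℂ).re)) := by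
  have hnegT : Tendsto (fun s : ℝ => -s) (𝓝[≠] 0) (𝓝[≠] 0) := by
    refine tendsto_nhdsWithin_iff.2 ⟨?_, ?_⟩
    · have : Tendsto (fun s : ℝ => -s) (𝓝 0) (𝓝 0) := by
        simpa using (continuous_neg (G := ℝ)).tendsto 0
      exact this.mono_left nhdsWithin_le_nhds
    · filter_upwards [self_mem_nhdsWithin] with s hs
      simpa using hs
  have hre : Continuous fun f : L2 => (⟪f, G⟫_ℂ).re := by fun_prop
  have h1 := (hre.tendsto _).comp (h.tendsto_flowL_slope hχ v)
  have h2 := h1.add (h1.comp hnegT)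
  rw [← two_mul] at h2
  refine h2.congr fun s => ?_
  generalize valL v = f
  simp only [Function.comp_apply, inner_sub_left, inner_smul_left,
    Complex.conj_ofReal, Complex.sub_re, Complex.re_ofReal_mul, inv_neg]
  ring

end IsLocalFlow

/-! ### The virial identity for the stationary equation -Δv + Vv = G -/

theorem weak_equation_sub {E G : Type*} [NormedAddCommGroup E] [NormedSpace ℂ E]
    [NormedAddCommGroup G] [InnerProductSpace ℂ G] {val : E →L[ℂ] G} {grad : Fin 3 → E →L[ℂ] G}
    {B : E → E → ℂ} {v : E} {g : G}
    (hv : ∀ w, ∑ j, ⟪grad j w, grad j v⟫_ℂ + B w v = ⟪val w, g⟫_ℂ) (s : ℝ) {a b : E}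
    {a' b' : G} (ha : val a = a') (hb : val b = b') :
    s * (⟪a' - b', g⟫_ℂ).re = ∑ j, s * (⟪grad j a - grad j b, grad j v⟫_ℂ).re
      + s * (B (a - b) v).re := by
  have h := congrArg Complex.re (hv (a - b))
  simp only [map_sub, ha, hb] at h
  rw [← h, Complex.add_re, mul_add, Complex.re_sum, Finset.mul_sum]

/-- The virial identity for weak solutions of `-Δv + Vv = G`. -/
theorem virial_dirL {χ V U : R3 → ℝ} (hχ : IsTestFunction χ) (hV : FormBounded V)
    (hU : FormBounded U) (hw : IsWeakDiv χ V U) {v : H1} {G : L2}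
    (hv : ∀ w : H1, ∑ j, ⟪gradL j w, gradL j v⟫_ℂ + form hV w v = ⟪valL w, G⟫_ℂ) :
    ∑ j, (-(⟪gradL j v, mulL hχ.lapl.bcf (gradL j v)⟫_ℂ).re
        + 2 * (∑ i, ⟪mulL ((hχ.pd i).pd j).bcf (gradL i v), gradL j v⟫_ℂ).re)
      + (form hU v v).re = 2 * (⟪dirL hχ v, G⟫_ℂ).re := by
  have h0 := exists_isLocalFlow hχ
  obtain ⟨Φ, τ, C, c, h⟩ := h0
  have hev : ∀ᶠ s in 𝓝[≠] (0 : ℝ), |s| < τ := nhdsWithin_le_nhds h.eventually_lt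
  -- The two sides of the equation tested with (v∘Φ_s - v∘Φ_{-s})/s, each with its limit as s → 0.
  exact tendsto_nhds_unique_of_eventuallyEq
    ((tendsto_finsetSum Finset.univ fun j _ =>
      h.tendsto_gradient_symm_slope hχ j (fun i => gradL i v)
        (A := fun s => gradL j (h.flowH1 s v)) fun s hs => h.gradL_flowH1 hs j v).add
      (h.tendsto_form_symm_slope hχ hV hU hw v))
    (h.tendsto_valL_symm_slope hχ v G)
    (hev.mono fun s hs => (weak_equation_sub hv s⁻¹ (h.valL_flowH1 hs v)
      (h.valL_flowH1 (by rwa [abs_neg]) v)).symm)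

theorem IsTestFunction.re {f : R3 → ℂ} (hf : ContDiff ℝ ∞ f) (hs : HasCompactSupport f) :
    IsTestFunction fun x => (f x).re :=
  ⟨Complex.reCLM.contDiff.comp hf, hs.comp_left (g := Complex.re) rfl⟩

theorem IsTestFunction.im {f : R3 → ℂ} (hf : ContDiff ℝ ∞ f) (hs : HasCompactSupport f) :
    IsTestFunction fun x => (f x).im :=
  ⟨Complex.imCLM.contDiff.comp hf, hs.comp_left (g := Complex.im) rfl⟩

theorem pd_re {f : R3 → ℂ} (hf : ContDiff ℝ 1 f) (j : Fin 3) (x : R3) :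
    pd j (fun x => (f x).re) x = (pdc j f x).re := by
  have h : fderiv ℝ (fun x => (f x).re) x = _ :=
    (Complex.reCLM.hasFDerivAt.comp x (hf.differentiable (by simp) x).hasFDerivAt).fderiv
  rw [pd, h]
  rfl

theorem pd_im {f : R3 → ℂ} (hf : ContDiff ℝ 1 f) (j : Fin 3) (x : R3) :
    pd j (fun x => (f x).im) x = (pdc j f x).im := by
  have h : fderiv ℝ (fun x => (f x).im) x = _ :=
    (Complex.imCLM.hasFDerivAt.comp x (hf.differentiable (by simp) x).hasFDerivAt).fderiv
  rw [pd, h]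
  rfl

/-- The inner product is antilinear in its first argument, so a complex test function a + ib enters
as a - ib; this reduces complex testing to real test functions. -/
theorem inner_of_ae_re_im {F : L2} {f : R3 → ℂ} (hF : F =ᵐ[volume] f) {a b : R3 → ℝ}
    (ha : Continuous a) (has : HasCompactSupport a) (hb : Continuous b)
    (hbs : HasCompactSupport b) (hre : ∀ x, (f x).re = a x) (him : ∀ x, (f x).im = b x) (g : L2) :
    ⟪F, g⟫_ℂ = (∫ x, a x • g x) - Complex.I * ∫ x, b x • g x := by
  rw [inner_eq_of_ae hF (ae_eq_refl g), ← integral_const_mul,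
    ← integral_sub (integrable_smul_of_L2 ha has g) ((integrable_smul_of_L2 hb hbs g).const_mul _)]
  refine integral_congr_ae (.of_forall fun x => ?_)
  have e : f x = a x + b x * Complex.I := by rw [← hre, ← him, Complex.re_add_im]
  simp only [e, map_add, map_mul, Complex.conj_ofReal, Complex.conj_I, Complex.real_smul]
  ring

theorem inner_valL_ofC1 {f : R3 → ℂ} (hf : ContDiff ℝ ∞ f) (hs : HasCompactSupport f)
    (hf1 : ContDiff ℝ 1 f) (g : L2) :
    ⟪valL (ofC1 f hf1 hs), g⟫_ℂ
      = (∫ x, (f x).re • g x) - Complex.I * ∫ x, (f x).im • g x :=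
  have h1 := IsTestFunction.re hf hs
  have h2 := IsTestFunction.im hf hs
  inner_of_ae_re_im (coeFn_valL_ofC1 hf1 hs) h1.1.continuous h1.2 h2.1.continuous h2.2
    (fun _ => rfl) (fun _ => rfl) g

theorem inner_gradL_ofC1 {f : R3 → ℂ} (hf : ContDiff ℝ ∞ f) (hs : HasCompactSupport f)
    (hf1 : ContDiff ℝ 1 f) (j : Fin 3) (g : L2) :
    ⟪gradL j (ofC1 f hf1 hs), g⟫_ℂ
      = (∫ x, pd j (fun x => (f x).re) x • g x)
        - Complex.I * ∫ x, pd j (fun x => (f x).im) x • g x :=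
  have h1 := IsTestFunction.re hf hs
  have h2 := IsTestFunction.im hf hs
  inner_of_ae_re_im (coeFn_gradL_ofC1 hf1 hs j) (h1.continuous_pd j) (h1.hasCompactSupport_pd j)
    (h2.continuous_pd j) (h2.hasCompactSupport_pd j) (fun x => (pd_re hf1 j x).symm)
    (fun x => (pd_im hf1 j x).symm) g

theorem eq_of_dense_inner {E G : Type*} [NormedAddCommGroup E] [NormedSpace ℂ E]
    [NormedAddCommGroup G] [InnerProductSpace ℂ G] {S : Set E} (hS : Dense S) {A B : E →L[ℂ] G}
    {g g' : G} (h : ∀ w ∈ S, ⟪A w, g⟫_ℂ = -⟪B w, g'⟫_ℂ) (w : E) : ⟪A w, g⟫_ℂ = -⟪B w, g'⟫_ℂ := by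
  have : (fun w => ⟪A w, g⟫_ℂ) = fun w => -⟪B w, g'⟫_ℂ :=
    Continuous.ext_on hS (by fun_prop) (by fun_prop) h
  exact congrFun this w

/-- Integration by parts in `H¹`. -/
theorem inner_valL_gradL (w v : H1) (j : Fin 3) :
    ⟪valL w, gradL j v⟫_ℂ = -⟪gradL j w, valL v⟫_ℂ := by
  refine eq_of_dense_inner dense_smoothH1 ?_ w
  rintro _ ⟨f, hf, hs, rfl⟩
  have hf1 : ContDiff ℝ 1 f := hf.of_le (by simp)
  have h1 := H1.weak v (IsTestFunction.re hf hs) j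
  have h2 := H1.weak v (IsTestFunction.im hf hs) j
  refine (inner_valL_ofC1 hf hs hf1 _).trans (Eq.trans ?_
    (congrArg Neg.neg (inner_gradL_ofC1 hf hs hf1 j _)).symm)
  rw [h1, h2]
  ring

/-- The weak form of 2 Re(a f̄ ∂f) = a ∂|f|²: here g is the derivative of f, b that of a, and
integration by parts has been applied to F = a f. -/
theorem re_inner_mulL_of_eq {a b : R3 →ᵇ ℝ} {f g F G : L2} (hF : F = mulL a f)
    (hG : G = mulL a g + mulL b f) (h : ⟪F, g⟫_ℂ = -⟪G, f⟫_ℂ) :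
    2 * (⟪mulL a f, g⟫_ℂ).re = -(⟪f, mulL b f⟫_ℂ).re := by
  subst hF hG
  have h3 : (⟪mulL a g, f⟫_ℂ).re = (⟪mulL a f, g⟫_ℂ).re := by
    rw [← inner_conj_symm, Complex.conj_re, inner_mulL_left]
  have h4 := congrArg Complex.re h
  rw [inner_add_left, Complex.neg_re, Complex.add_re, h3, inner_mulL_left b] at h4
  linarith

theorem re_inner_mulL_gradL {ψ : R3 → ℝ} (hψ : IsTestFunction ψ) (v : H1) (j : Fin 3) :
    2 * (⟪mulL hψ.bcf (valL v), gradL j v⟫_ℂ).re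
      = -(⟪valL v, mulL (hψ.pd j).bcf (valL v)⟫_ℂ).re :=
  re_inner_mulL_of_eq (valL_mulH1 hψ v) (gradL_mulH1 hψ j v) (inner_valL_gradL (mulH1 hψ v) v j)

theorem FormBounded.neg {w : R3 → ℝ} (hw : FormBounded w) : FormBounded fun x => -w x :=
  ⟨hw.1.neg, fun f => by simpa using (hw.2 f).neg⟩

theorem ae_eq_of_eq_mulL {a : R3 →ᵇ ℝ} {F f : L2} (hF : F = mulL a f) :
    F =ᵐ[volume] fun x => a x • f x := by
  subst hF
  exact coeFn_mulL a f

theorem mul_conj_smul_self (w p : ℝ) (z : ℂ) :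
    (w : ℂ) * z * (starRingEnd ℂ) (p • z) = ((w * p * ‖z‖ ^ 2 : ℝ) : ℂ) := by
  rw [Complex.real_smul, map_mul, Complex.conj_ofReal]
  have := Complex.mul_conj z
  rw [Complex.normSq_eq_norm_sq] at this
  push_cast at this ⊢
  rw [← this]
  ring

theorem form_mulH1_self {w ψ : R3 → ℝ} (hw : FormBounded w) (hψ : IsTestFunction ψ) (v : H1) :
    form hw (mulH1 hψ v) v = ((∫ x, w x * ψ x * ‖valL v x‖ ^ 2 : ℝ) : ℂ) := by
  refine (form_eq hw _ _).trans (Eq.trans (integral_congr_ae ?_) integral_complex_ofReal)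
  filter_upwards [ae_eq_of_eq_mulL (valL_mulH1 hψ v)] with x hx
  rw [hx]
  exact mul_conj_smul_self _ _ _

/-- The product rule ∇·(V∇χ) = ∇χ·∇V + VΔχ, read in the sense of distributions. -/
theorem IsWeakGradDot.isWeakDiv {χ V W : R3 → ℝ} (h : IsWeakGradDot χ V W) (hχ : IsTestFunction χ)
    (hV : LocallyIntegrable V volume) :
    IsWeakDiv χ V fun x => -(W x + V x * lapl χ x) := by
  have hVl : ∀ K, IsCompact K → IntegrableOn (fun x => V x * lapl χ x) K := fun K hK =>
    (hV.integrableOn_isCompact hK).mul_continuousOn hχ.lapl.1.continuous.continuousOn hK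
  have hVl' : LocallyIntegrable (fun x => V x * lapl χ x) volume :=
    locallyIntegrable_iff.2 hVl
  refine ⟨hV, (h.1.add hVl').neg, fun φ hφ => ?_⟩
  have e : ∀ x, ∑ i, pd i (fun y => φ y * pd i χ y) x
      = ∑ i, pd i χ x * pd i φ x + lapl χ x * φ x := by
    intro x
    rw [lapl, Finset.sum_mul, ← Finset.sum_add_distrib]
    refine Finset.sum_congr rfl fun i _ => ?_
    rw [pd_mul (hφ.1.differentiable (by simp)) ((hχ.pd i).1.differentiable (by simp))]
    ring
  have h1 := h.2 φ hφ
  have hint1 : Integrable fun x => V x * ∑ i, pd i χ x * pd i φ x :=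
    have ht : IsTestFunction fun x => ∑ i, pd i χ x * pd i φ x :=
      IsTestFunction.sum fun i => (hχ.pd i).mul (hφ.pd i).1
    integrable_mul_of_locallyIntegrable hV ht.1.continuous ht.2
  have hint2 : Integrable fun x => V x * (lapl χ x * φ x) :=
    have ht : IsTestFunction fun x => lapl χ x * φ x := hχ.lapl.mul hφ.1
    integrable_mul_of_locallyIntegrable hV ht.1.continuous ht.2
  have hint3 : Integrable fun x => W x * φ x :=
    integrable_mul_of_locallyIntegrable h.1 hφ.1.continuous hφ.2
  simp only [e, mul_add] at h1
  rw [integral_add hint1 hint2] at h1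
  have e2 : ∀ x, -(W x + V x * lapl χ x) * φ x = -(W x * φ x + V x * (lapl χ x * φ x)) :=
    fun x => by ring
  simp only [e2]
  rw [integral_neg, integral_add hint3 hint2]
  linarith

/-- The part of the quadratic form of the virial identity not involving the potential. -/
def virialQ {χ : R3 → ℝ} (hχ : IsTestFunction χ) (f : L2) (g : Fin 3 → L2) : ℝ :=
  ∑ j, (∑ i, ⟪mulL ((hχ.pd i).pd j).bcf (g i), g j⟫_ℂ).re
    - 1 / 4 * (⟪f, mulL hχ.lapl.lapl.bcf f⟫_ℂ).re

/-- The quadratic form of the virial identity. -/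
def virialForm {χ W : R3 → ℝ} (hχ : IsTestFunction χ) (hW : FormBounded W) (v : H1) : ℝ :=
  virialQ hχ (valL v) (fun i => gradL i v) - 1 / 2 * (form hW v v).re

theorem sum_inner_mulL_pd_pd {ψ : R3 → ℝ} (hψ : IsTestFunction ψ) (f : L2) :
    ∑ j, (⟪f, mulL ((hψ.pd j).pd j).bcf f⟫_ℂ).re = (⟪f, mulL hψ.lapl.bcf f⟫_ℂ).re := by
  have e : hψ.lapl.bcf
      = ((hψ.pd 0).pd 0).bcf + ((hψ.pd 1).pd 1).bcf + ((hψ.pd 2).pd 2).bcf := by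
    ext x
    simp [lapl, Fin.sum_univ_three]
  rw [e, mulL_add, mulL_add, Fin.sum_univ_three, inner_add_right, inner_add_right, Complex.add_re,
    Complex.add_re]

theorem re_form_self {w : R3 → ℝ} (hw : FormBounded w) (v : H1) :
    (form hw v v).re = ∫ x, w x * ‖valL v x‖ ^ 2 :=
  (congrArg Complex.re (form_self hw v)).trans (Complex.ofReal_re _)

theorem re_form_neg_add {V W a : R3 → ℝ} (hW : FormBounded W)
    (hVa : FormBounded fun x => V x * a x) (hU : FormBounded fun x => -(W x + V x * a x)) (v : H1) :
    (form hU v v).re = -(form hW v v).re - (∫ x, V x * a x * ‖valL v x‖ ^ 2) := by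
  have h1 := hW.2 v
  have h2 := hVa.2 v
  refine (re_form_self hU v).trans (Eq.trans ?_
    (congrArg (fun r : ℝ => -r - ∫ x, V x * a x * ‖valL v x‖ ^ 2) (re_form_self hW v)).symm)
  refine Eq.trans ?_ (integral_add h1 h2 ▸ (neg_add' _ _))
  rw [← integral_neg]
  refine integral_congr_ae (.of_forall fun x => ?_)
  show -(W x + V x * a x) * _ = -(_ + _)
  ring

/-- Real part of the equation tested with Δχ v. The cross terms are Re(v̄ ∂_j v) weighted by ∂_jΔχ;
integrating by parts turns them into -½ ∂_j²Δχ |v|², which sum to -½ Δ²χ |v|². -/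
theorem virial_lapl_aux {χ : R3 → ℝ} (hχ : IsTestFunction χ) {f G F : L2} {g g' : Fin 3 → L2}
    {r : ℝ} {z : ℂ} (hz : z = r) (h : ∑ j, ⟪g' j, g j⟫_ℂ + z = ⟪F, G⟫_ℂ)
    (hF : F = mulL hχ.lapl.bcf f)
    (hg : ∀ j, g' j = mulL hχ.lapl.bcf (g j) + mulL (hχ.lapl.pd j).bcf f)
    (h4 : ∀ j, 2 * (⟪mulL (hχ.lapl.pd j).bcf f, g j⟫_ℂ).re
      = -(⟪f, mulL ((hχ.lapl.pd j).pd j).bcf f⟫_ℂ).re) :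
    ∑ j, (⟪g j, mulL hχ.lapl.bcf (g j)⟫_ℂ).re
      - 1 / 2 * (⟪f, mulL hχ.lapl.lapl.bcf f⟫_ℂ).re + r = (⟪mulL hχ.lapl.bcf f, G⟫_ℂ).re := by
  have h := congrArg Complex.re h
  have e5 := sum_inner_mulL_pd_pd hχ.lapl f
  simp only [hF, hg, hz, Complex.add_re, Complex.re_sum, inner_add_left, Complex.ofReal_re,
    Finset.sum_add_distrib] at h
  rw [← h, ← e5, Finset.mul_sum]
  have e6 : ∀ j, (⟪mulL hχ.lapl.bcf (g j), g j⟫_ℂ).re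
      = (⟪g j, mulL hχ.lapl.bcf (g j)⟫_ℂ).re := fun j => by rw [inner_mulL_left]
  simp only [e6]
  have e7 : ∀ j, (⟪mulL (hχ.lapl.pd j).bcf f, g j⟫_ℂ).re
      = -(1 / 2 * (⟪f, mulL ((hχ.lapl.pd j).pd j).bcf f⟫_ℂ).re) := fun j => by
    linarith [h4 j]
  simp only [e7, Finset.sum_neg_distrib]
  ring

/-- Half of this identity, added to half of `virial_dirL`, cancels the terms with Δχ|∇v|² and
VΔχ|v|². -/
theorem virial_lapl {χ V : R3 → ℝ} (hχ : IsTestFunction χ) (hV : FormBounded V) {v : H1} {G : L2}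
    (hv : ∀ w : H1, ∑ j, ⟪gradL j w, gradL j v⟫_ℂ + form hV w v = ⟪valL w, G⟫_ℂ) :
    ∑ j, (⟪gradL j v, mulL hχ.lapl.bcf (gradL j v)⟫_ℂ).re
      - 1 / 2 * (⟪valL v, mulL hχ.lapl.lapl.bcf (valL v)⟫_ℂ).re
      + (∫ x, V x * lapl χ x * ‖valL v x‖ ^ 2) = (⟪mulL hχ.lapl.bcf (valL v), G⟫_ℂ).re :=
  virial_lapl_aux hχ (form_mulH1_self hV hχ.lapl v) (hv (mulH1 hχ.lapl v)) (valL_mulH1 hχ.lapl v)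
    (fun j => gradL_mulH1 hχ.lapl j v) fun j => re_inner_mulL_gradL (hχ.lapl.pd j) v j

theorem virial_stationary_aux {χ : R3 → ℝ} (hχ : IsTestFunction χ) {f : L2} {g : Fin 3 → L2}
    {a b k l m : ℝ}
    (h1 : ∑ j, (-(⟪g j, mulL hχ.lapl.bcf (g j)⟫_ℂ).re
        + 2 * (∑ i, ⟪mulL ((hχ.pd i).pd j).bcf (g i), g j⟫_ℂ).re) + m = 2 * a)
    (h2 : ∑ j, (⟪g j, mulL hχ.lapl.bcf (g j)⟫_ℂ).re
      - 1 / 2 * (⟪f, mulL hχ.lapl.lapl.bcf f⟫_ℂ).re + l = b)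
    (h3 : m = -k - l) : a + 1 / 2 * b = virialQ hχ f g - 1 / 2 * k := by
  rw [h3, Finset.sum_add_distrib, Finset.sum_neg_distrib, ← Finset.mul_sum] at h1
  rw [← h2, virialQ]
  linarith

/-- The virial identity for weak solutions of `-Δv + Vv = G`, in symmetrized form. -/
theorem virial_stationary {χ V W : R3 → ℝ} (hχ : IsTestFunction χ) (hV : FormBounded V)
    (hVl : LocallyIntegrable V volume) (hW : FormBounded W) (h : IsWeakGradDot χ V W) {v : H1}
    {G : L2}
    (hv : ∀ w : H1, ∑ j, ⟪gradL j w, gradL j v⟫_ℂ + form hV w v = ⟪valL w, G⟫_ℂ) :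
    (⟪dirL hχ v, G⟫_ℂ).re + 1 / 2 * (⟪mulL hχ.lapl.bcf (valL v), G⟫_ℂ).re
      = virialForm hχ hW v := by
  have hVa := formBounded_mul hχ.lapl.1.continuous hχ.lapl.2 hV
  have hU := (hW.add hVa).neg
  exact virial_stationary_aux hχ (virial_dirL hχ hV hU (h.isWeakDiv hχ hVl) hv)
    (virial_lapl hχ hV hv) (re_form_neg_add hW hVa hU v)

/-! ### Steklov averages in time -/

section Steklov

variable {F : Type*} [NormedAddCommGroup F] [NormedSpace ℝ F]

/-- The Steklov average of a curve over the interval from `t` to `t + δ`. -/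
def steklov (u : ℝ → F) (δ t : ℝ) : F := ∫ σ in (0 : ℝ)..1, u (t + δ * σ)

/-- Averaging over σ ∈ [0, 1] with increment δσ makes sense at δ = 0, so the limit δ → 0 is plain
joint continuity. -/
theorem continuous_steklov {u : ℝ → F} (hu : Continuous u) :
    Continuous fun p : ℝ × ℝ => steklov u p.1 p.2 := by
  refine intervalIntegral.continuous_parametric_intervalIntegral_of_continuous'
    (f := fun (p : ℝ × ℝ) σ => u (p.2 + p.1 * σ)) ?_ 0 1
  refine hu.comp ?_
  fun_prop

theorem smul_steklov (u : ℝ → F) (δ t : ℝ) : δ • steklov u δ t = ∫ r in t..(t + δ), u r := by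
  rw [steklov, intervalIntegral.smul_integral_comp_add_mul]
  simp

variable [CompleteSpace F]

theorem steklov_zero (u : ℝ → F) (t : ℝ) : steklov u 0 t = u t := by
  simp [steklov]

theorem hasDerivAt_steklov {u : ℝ → F} (hu : Continuous u) {δ : ℝ} (hδ : δ ≠ 0) (t : ℝ) :
    HasDerivAt (steklov u δ) (δ⁻¹ • (u (t + δ) - u t)) t := by
  have h1 : ∀ a, HasDerivAt (fun t => ∫ r in (0 : ℝ)..t, u r) (u a) a := fun a =>
    (hu.integral_hasStrictDerivAt 0 a).hasDerivAt
  have h2 := (((h1 (t + δ)).comp_add_const t δ).sub (h1 t)).const_smul δ⁻¹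
  refine h2.congr_of_eventuallyEq (.of_forall fun s => ?_)
  have h3 := smul_steklov u δ s
  have h4 : (∫ r in (0 : ℝ)..(s + δ), u r) - ∫ r in (0 : ℝ)..s, u r = ∫ r in s..(s + δ), u r :=
    intervalIntegral.integral_interval_sub_left (hu.intervalIntegrable _ _)
      (hu.intervalIntegrable _ _)
  show steklov u δ s = δ⁻¹ • ((∫ r in (0 : ℝ)..(s + δ), u r) - ∫ r in (0 : ℝ)..s, u r)
  rw [h4, ← h3, smul_smul, inv_mul_cancel₀ hδ, one_smul]

end Steklov

/-! ### Quadratic functionals along weak solutions -/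

section Evolution

variable {E G : Type*} [NormedAddCommGroup E] [NormedSpace ℂ E] [CompleteSpace E]
  [NormedAddCommGroup G] [InnerProductSpace ℂ G] [CompleteSpace G]
  {val : E →L[ℂ] G} {Λ : E → E →L[ℂ] ℂ} {S : Set E} {u : ℝ → E} {n : ℝ → G} {J : Set ℝ}

/-- The Steklov averages of a weak solution satisfy the equation tested against the whole energy
space. -/
theorem weak_steklov (hS : Dense S) (hΛ : ∀ v, Continuous fun w => Λ w v)
    (hu : Continuous u) (hn : Continuous n)
    (hw : ∀ w ∈ S, ∀ t ∈ J, HasDerivAt (fun s => ⟪val w, val (u s)⟫_ℂ)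
      (-Complex.I * (Λ w (u t) - ⟪val w, n t⟫_ℂ)) t) {δ t : ℝ} (hδ : δ ≠ 0)
    (hJ : uIcc t (t + δ) ⊆ J) (w : E) :
    Λ w (steklov u δ t)
      = ⟪val w, Complex.I • val (δ⁻¹ • (u (t + δ) - u t)) + steklov n δ t⟫_ℂ := by
  have hcl : ∀ g : G, Continuous fun w => ⟪val w, g⟫_ℂ := fun g => by fun_prop
  -- Both sides are continuous in w, so only test elements of the dense set, for which the
  -- differential equation is assumed, have to be considered.
  refine congrFun (Continuous.ext_on hS (hΛ _) (hcl _) fun w hwS => ?_) w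
  have hc1 : Continuous fun r => Λ w (u r) := (Λ w).continuous.comp hu
  have hc2 : Continuous fun r => ⟪val w, n r⟫_ℂ := continuous_const.inner hn
  -- The equation is integrated from t to t + δ; the functionals Λ w and ⟪val w, ·⟫ commute with the
  -- time integral and turn it into averages.
  have h1 := intervalIntegral.integral_eq_sub_of_hasDerivAt
    (fun r hr => hw w hwS r (hJ hr))
    ((continuous_const.mul (hc1.sub hc2)).intervalIntegrable t (t + δ))
  have h2 : ∫ r in t..(t + δ), Λ w (u r) = δ * Λ w (steklov u δ t) := by
    have := (Λ w).intervalIntegral_comp_comm (hu.intervalIntegrable (μ := volume) t (t + δ))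
    rw [this, ← smul_steklov, ← Complex.coe_smul, map_smul, smul_eq_mul]
  have h3 : ∫ r in t..(t + δ), ⟪val w, n r⟫_ℂ = δ * ⟪val w, steklov n δ t⟫_ℂ := by
    have := (innerSL ℂ (val w)).intervalIntegral_comp_comm
      (hn.intervalIntegrable (μ := volume) t (t + δ))
    simp only [innerSL_apply_apply] at this
    rw [this, ← smul_steklov, ← Complex.coe_smul, inner_smul_right]
  rw [intervalIntegral.integral_const_mul, intervalIntegral.integral_sub
    (hc1.intervalIntegrable _ _) (hc2.intervalIntegrable _ _), h2, h3, ← inner_sub_right,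
    ← map_sub] at h1
  have hδ' : (δ : ℂ) ≠ 0 := Complex.ofReal_ne_zero.2 hδ
  have hI : Complex.I * Complex.I = -1 := Complex.I_mul_I
  rw [← Complex.coe_smul, map_smul, inner_add_right, inner_smul_right, inner_smul_right, ← h1,
    Complex.ofReal_inv]
  field_simp
  linear_combination (Λ w (steklov u δ t) - ⟪val w, steklov n δ t⟫_ℂ) * hI

/-- Differentiation of a quadratic functional along a weak solution of an evolution equation. -/
theorem hasDerivAt_of_weak_evolution {ι : Type*} [Fintype ι] {L M : ι → E →L[ℂ] G}
    {R : E → G → ℝ} (hS : Dense S) (hΛ : ∀ v, Continuous fun w => Λ w v)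
    (hu : Continuous u) (hn : Continuous n)
    (hw : ∀ w ∈ S, ∀ t ∈ J, HasDerivAt (fun s => ⟪val w, val (u s)⟫_ℂ)
      (-Complex.I * (Λ w (u t) - ⟪val w, n t⟫_ℂ)) t) (hJ : IsOpen J)
    (hR : Continuous fun x : E × G => R x.1 x.2)
    (key : ∀ v v' g, (∀ w, Λ w v = ⟪val w, Complex.I • val v' + g⟫_ℂ) →
      (∑ k, (⟪L k v, M k v'⟫_ℂ + ⟪L k v', M k v⟫_ℂ)).re = R v g) {t : ℝ} (ht : t ∈ J) :
    HasDerivAt (fun s => (∑ k, ⟪L k (u s), M k (u s)⟫_ℂ).re) (R (u t) (n t)) t := by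
  obtain ⟨r, hr, hrJ⟩ := Metric.isOpen_iff.1 hJ t ht
  obtain ⟨p, hp⟩ : ∃ p : E → ℝ, p = fun v => (∑ k, ⟪L k v, M k v⟫_ℂ).re := ⟨_, rfl⟩
  have hpc : Continuous p := by
    rw [hp]
    refine Complex.continuous_re.comp (continuous_finsetSum _ fun k _ => ?_)
    exact (L k).continuous.inner (M k).continuous
  have hdp : ∀ (c : ℝ → E) c' x, HasDerivAt c c' x → HasDerivAt (fun s => p (c s))
      (∑ k, (⟪L k (c x), M k c'⟫_ℂ + ⟪L k c', M k (c x)⟫_ℂ)).re x := by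
    intro c c' x hc
    rw [hp]
    have h1 : ∀ k, HasDerivAt (fun s => ⟪L k (c s), M k (c s)⟫_ℂ)
        (⟪L k (c x), M k c'⟫_ℂ + ⟪L k c', M k (c x)⟫_ℂ) x := fun k =>
      (((L k).restrictScalars ℝ).hasFDerivAt.comp_hasDerivAt x hc).inner ℂ
        (((M k).restrictScalars ℝ).hasFDerivAt.comp_hasDerivAt x hc)
    have h2 := HasDerivAt.fun_sum (u := Finset.univ) fun k _ => h1 k
    exact Complex.reCLM.hasFDerivAt.comp_hasDerivAt x h2
  have hRc : Continuous fun q : ℝ × ℝ => R (steklov u q.1 q.2) (steklov n q.1 q.2) :=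
    hR.comp ((continuous_steklov hu).prodMk (continuous_steklov hn))
  have hball : ∀ x, |x - t| < r → x ∈ J := fun x hx => hrJ (by
    rwa [Metric.mem_ball, Real.dist_eq])
  -- The average is differentiable with values in E, so the product rule applies. Its derivative
  -- plays the role of v' in `key`, which removes it from the result. The radius r/2 keeps the
  -- averaging interval inside J.
  have hδ : ∀ δ, δ ≠ 0 → |δ| < r / 2 → ∀ x, |x - t| < r / 2 →
      HasDerivAt (fun s => p (steklov u δ s)) (R (steklov u δ x) (steklov n δ x)) x := by
    intro δ hδ0 hδr x hx
    refine (hdp _ _ x (hasDerivAt_steklov hu hδ0 x)).congr_deriv ?_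
    refine key _ _ _ (weak_steklov hS hΛ hu hn hw hδ0 fun y hy => hball y ?_)
    have hyx : |y - x| ≤ |δ| := by
      have := abs_sub_left_of_mem_uIcc hy
      simpa using this
    calc |y - t| = |(y - x) + (x - t)| := by ring_nf
      _ ≤ |y - x| + |x - t| := abs_add_le _ _
      _ < r := by linarith
  -- The limit δ → 0 is taken in the time-integrated identity, where only continuity of p and R is
  -- used.
  have hint : ∀ s, |s - t| < r / 2 → p (u s) - p (u t) = ∫ x in t..s, R (u x) (n x) := by
    intro s hs
    have hpar : Continuous fun δ => ∫ x in t..s, R (steklov u δ x) (steklov n δ x) :=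
      intervalIntegral.continuous_parametric_intervalIntegral_of_continuous'
        (f := fun δ x => R (steklov u δ x) (steklov n δ x)) hRc t s
    have hst : ∀ y, Continuous fun δ => p (steklov u δ y) := fun y =>
      hpc.comp ((continuous_steklov hu).comp (continuous_id.prodMk continuous_const))
    have e : ∀ᶠ δ in 𝓝[≠] (0 : ℝ), p (steklov u δ s) - p (steklov u δ t)
        = ∫ x in t..s, R (steklov u δ x) (steklov n δ x) := by
      have h2 : ∀ᶠ δ in 𝓝 (0 : ℝ), |δ| < r / 2 :=
        (isOpen_lt continuous_abs continuous_const).mem_nhds (by simpa using hr)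
      filter_upwards [nhdsWithin_le_nhds h2, self_mem_nhdsWithin] with δ h1 h2
      refine (intervalIntegral.integral_eq_sub_of_hasDerivAt (fun x hx => hδ δ h2 h1 x ?_)
        ((hRc.comp (continuous_const.prodMk continuous_id)).intervalIntegrable _ _)).symm
      exact (abs_sub_left_of_mem_uIcc hx).trans_lt hs
    have h3 := tendsto_nhds_unique_of_eventuallyEq
      ((((hst s).sub (hst t)).tendsto 0).mono_left nhdsWithin_le_nhds)
      ((hpar.tendsto 0).mono_left nhdsWithin_le_nhds) e
    simpa only [Pi.sub_apply, steklov_zero] using h3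
  have hRu : Continuous fun x => R (u x) (n x) := hR.comp (hu.prodMk hn)
  have hmain := ((hRu.integral_hasStrictDerivAt t t).hasDerivAt).add_const (p (u t))
  have hev : (fun s => (∑ k, ⟪L k (u s), M k (u s)⟫_ℂ).re) =ᶠ[𝓝 t]
      fun s => (∫ x in t..s, R (u x) (n x)) + p (u t) := by
    have h2 : ∀ᶠ s in 𝓝 t, |s - t| < r / 2 :=
      (isOpen_lt (by fun_prop) continuous_const).mem_nhds (by simpa using hr)
    filter_upwards [h2] with s hs
    rw [← hint s hs, sub_add_cancel, hp]
  exact hmain.congr_of_eventuallyEq hev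

end Evolution

/-! ### Localization to the open time interval -/

section Evolution

/-- The curve is frozen at its end values outside a compact interval around t. The averages are then
defined for all times, and the derivative at t is unaffected. -/
theorem exists_continuous_extension {E : Type*} [TopologicalSpace E] {u : ℝ → E} {I : Set ℝ}
    (hI : IsOpen I) (hu : ContinuousOn u I) {t : ℝ} (ht : t ∈ I) :
    ∃ v : ℝ → E, Continuous v ∧ ∃ J, IsOpen J ∧ t ∈ J ∧ J ⊆ I ∧ EqOn u v J := by
  obtain ⟨r, hr, hrI⟩ := Metric.nhds_basis_closedBall.mem_iff.1 (hI.mem_nhds ht)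
  rw [Real.closedBall_eq_Icc] at hrI
  have hab : t - r ≤ t + r := by linarith
  refine ⟨IccExtend hab ((Icc (t - r) (t + r)).domRestrict u),
    Continuous.Icc_extend' (hu.mono hrI).domRestrict, Ioo (t - r) (t + r), isOpen_Ioo,
    ⟨by linarith, by linarith⟩, Ioo_subset_Icc_self.trans hrI, fun s hs => ?_⟩
  rw [IccExtend_of_mem hab _ (Ioo_subset_Icc_self hs)]
  rfl

variable {E G : Type*} [NormedAddCommGroup E] [NormedSpace ℂ E] [CompleteSpace E]
  [NormedAddCommGroup G] [InnerProductSpace ℂ G] [CompleteSpace G]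
  {val : E →L[ℂ] G} {Λ : E → E →L[ℂ] ℂ} {S : Set E} {u : ℝ → E} {I : Set ℝ}

/-- Differentiation of a quadratic functional along a weak solution on an open time interval. -/
theorem hasDerivAt_of_weak_equation {ι : Type*} [Fintype ι] {L M : ι → E →L[ℂ] G}
    {R : E → G → ℝ} {N : E → G} (hS : Dense S) (hΛ : ∀ v, Continuous fun w => Λ w v)
    (hI : IsOpen I) (hu : ContinuousOn u I) (hN : Continuous N)
    (hw : ∀ w ∈ S, ∀ t ∈ I, HasDerivAt (fun s => ⟪val w, val (u s)⟫_ℂ)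
      (-Complex.I * (Λ w (u t) - ⟪val w, N (u t)⟫_ℂ)) t)
    (hR : Continuous fun x : E × G => R x.1 x.2)
    (key : ∀ v v' g, (∀ w, Λ w v = ⟪val w, Complex.I • val v' + g⟫_ℂ) →
      (∑ k, (⟪L k v, M k v'⟫_ℂ + ⟪L k v', M k v⟫_ℂ)).re = R v g) {t : ℝ} (ht : t ∈ I) :
    HasDerivAt (fun s => (∑ k, ⟪L k (u s), M k (u s)⟫_ℂ).re) (R (u t) (N (u t))) t := by
  obtain ⟨v, hv, J, hJ, htJ, hJI, huv⟩ := exists_continuous_extension hI hu ht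
  have hev : ∀ s ∈ J, u =ᶠ[𝓝 s] v := fun s hs => huv.eventuallyEq_of_mem (hJ.mem_nhds hs)
  have h := hasDerivAt_of_weak_evolution (L := L) (M := M) (R := R) hS hΛ hv (hN.comp hv)
    (J := J) (fun w hwS s hs => ?_) hJ hR key htJ
  · rw [huv htJ]
    refine h.congr_of_eventuallyEq ?_
    filter_upwards [hev t htJ] with s hs
    rw [hs]
  · have h1 := hw w hwS s (hJI hs)
    rw [huv hs] at h1
    refine h1.congr_of_eventuallyEq ?_
    filter_upwards [hev s hs] with r hr
    rw [hr]

end Evolution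

/-! ### The Schrödinger form, and the equation tested with complex functions -/

theorem sum_innerSL_comp_add_apply {ι E G : Type*} [Fintype ι] [NormedAddCommGroup E]
    [NormedSpace ℂ E] [NormedAddCommGroup G] [InnerProductSpace ℂ G] (A : ι → G)
    (B : ι → E →L[ℂ] G) (a : G) (b : E →L[ℂ] G) (v : E) :
    (∑ j, (innerSL ℂ (A j)).comp (B j) + (innerSL ℂ a).comp b) v
      = ∑ j, ⟪A j, B j v⟫_ℂ + ⟪a, b v⟫_ℂ := by
  rw [add_apply, sum_apply]
  rfl

/-- The sesquilinear form of the Schrödinger operator `-Δ + V`. -/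
def energyL {V : R3 → ℝ} (hV : FormBounded V) (w : H1) : H1 →L[ℂ] ℂ :=
  ∑ j, (innerSL ℂ (gradL j w)).comp (gradL j)
    + (innerSL ℂ (multiplier _ hV.memLp_sqrt w)).comp (multiplier _ hV.memLp_div_sqrt)

theorem energyL_apply {V : R3 → ℝ} (hV : FormBounded V) (w v : H1) :
    energyL hV w v = ∑ j, ⟪gradL j w, gradL j v⟫_ℂ + form hV w v :=
  sum_innerSL_comp_add_apply _ _ _ _ v

attribute [irreducible] energyL

/-- Continuity in the antilinear argument, which extends the equation from smooth test functions to
all of H¹. -/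
theorem continuous_energyL {V : R3 → ℝ} (hV : FormBounded V) (v : H1) :
    Continuous fun w => energyL hV w v := by
  have h1 : ∀ j, Continuous fun w : H1 => ⟪gradL j w, gradL j v⟫_ℂ := fun j =>
    (gradL j).continuous.inner continuous_const
  have h2 : Continuous fun w : H1 => form hV w v :=
    (continuous_form hV).comp (continuous_id.prodMk continuous_const)
  exact ((continuous_finsetSum _ fun j _ => h1 j).add h2).congr fun w => (energyL_apply hV w v).symm

theorem smul_cubic_eq (r : ℝ) {z z' : ℂ} (h : z = z') :
    r • (((‖z‖ ^ 2 : ℝ) : ℂ) * z) = (r * ‖z'‖ ^ 2) • z' := by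
  rw [h, Complex.real_smul, Complex.real_smul, Complex.ofReal_mul, mul_assoc]

theorem mul_mul_conj_ofReal (V r : ℝ) (z : ℂ) :
    (V : ℂ) * z * (starRingEnd ℂ) (r : ℂ) = (r * V) • z := by
  rw [Complex.conj_ofReal, Complex.real_smul, Complex.ofReal_mul]
  ring

theorem mul_mul_conj_re_im (V : ℝ) (z w : ℂ) :
    (V : ℂ) * z * (starRingEnd ℂ) w
      = (w.re * V) • z - Complex.I * ((w.im * V) • z) := by
  have e : (starRingEnd ℂ) w = w.re - w.im * Complex.I := by
    apply Complex.ext <;> simp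
  rw [e, Complex.real_smul, Complex.real_smul, Complex.ofReal_mul, Complex.ofReal_mul]
  ring

/-- The weak form of the right-hand side of the equation, tested against a real function. -/
def weakRhs (V φ : R3 → ℝ) (v : H1) : ℂ :=
  (∑ j, ∫ x, pd j φ x • gradL j v x) + (∫ x, (φ x * V x) • valL v x) - ∫ x, φ x • cubic v x

theorem weakRhs_eq {V φ : R3 → ℝ} (hφ : IsTestFunction φ) (v : H1) :
    weakRhs V φ v = (∫ x, ∑ i, pd i φ x • H1.grad v i x)
        + (∫ x, (φ x * V x) • H1.val v x)
        - ∫ x, (φ x * ‖H1.val v x‖ ^ 2) • H1.val v x := by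
  have e1 : ∑ j, ∫ x, pd j φ x • gradL j v x = ∫ x, ∑ i, pd i φ x • H1.grad v i x :=
    (integral_finsetSum _ fun j _ => integrable_smul_of_L2 (hφ.continuous_pd j)
      (hφ.hasCompactSupport_pd j) (gradL j v)).symm.trans
      (integral_congr_ae (.of_forall fun x => Finset.sum_congr rfl fun j _ =>
        congrArg (fun z => pd j φ x • z) (congrFun (coe_gradL j v) x)))
  have e2 : ∫ x, (φ x * V x) • valL v x = ∫ x, (φ x * V x) • H1.val v x :=
    integral_congr_ae (.of_forall fun x =>
      congrArg (fun z => (φ x * V x) • z) (congrFun (coe_valL v) x))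
  have e3 : ∫ x, φ x • cubic v x = ∫ x, (φ x * ‖H1.val v x‖ ^ 2) • H1.val v x := by
    refine integral_congr_ae ?_
    filter_upwards [coeFn_cubic v] with x hx
    exact (congrArg (fun z => φ x • z) hx).trans
      (smul_cubic_eq (φ x) (congrFun (coe_valL v) x))
  exact congrArg₂ (· - ·) (congrArg₂ (· + ·) e1 e2) e3

theorem integrable_test_mul {V φ : R3 → ℝ} (hV : FormBounded V) (hφ : IsTestFunction φ) (v : H1) :
    Integrable fun x => (φ x * V x) • valL v x := by
  have hc : ContDiff ℝ 1 fun x => (φ x : ℂ) := (Complex.ofRealCLM.contDiff.comp hφ.1).of_le (by simp)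
  have hs : HasCompactSupport fun x => (φ x : ℂ) := hφ.2.comp_left (g := Complex.ofReal) rfl
  refine (form_integrable hV (ofC1 _ hc hs) v).congr ?_
  filter_upwards [coeFn_valL_ofC1 hc hs] with x hx
  exact (congrArg (fun y => (V x : ℂ) * valL v x * (starRingEnd ℂ) y) hx).trans
    (mul_mul_conj_ofReal _ _ _)

theorem form_ofC1 {V : R3 → ℝ} (hV : FormBounded V) {f : R3 → ℂ} (hf : ContDiff ℝ ∞ f)
    (hs : HasCompactSupport f) (hf1 : ContDiff ℝ 1 f) (v : H1) :
    form hV (ofC1 f hf1 hs) v = (∫ x, ((f x).re * V x) • valL v x)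
      - Complex.I * ∫ x, ((f x).im * V x) • valL v x := by
  refine (form_eq hV _ _).trans ?_
  rw [← integral_const_mul, ← integral_sub (integrable_test_mul hV (IsTestFunction.re hf hs) v)
    ((integrable_test_mul hV (IsTestFunction.im hf hs) v).const_mul _)]
  refine integral_congr_ae ?_
  filter_upwards [coeFn_valL_ofC1 hf1 hs] with x hx
  exact (congrArg (fun y => (V x : ℂ) * valL v x * (starRingEnd ℂ) y) hx).trans
    (mul_mul_conj_re_im _ _ _)

theorem energyL_sub_inner_cubic {V : R3 → ℝ} (hV : FormBounded V) {f : R3 → ℂ}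
    (hf : ContDiff ℝ ∞ f) (hs : HasCompactSupport f) (hf1 : ContDiff ℝ 1 f) (v : H1) :
    energyL hV (ofC1 f hf1 hs) v - ⟪valL (ofC1 f hf1 hs), cubic v⟫_ℂ
      = weakRhs V (fun x => (f x).re) v - Complex.I * weakRhs V (fun x => (f x).im) v := by
  have e1 := energyL_apply hV (ofC1 f hf1 hs) v
  have e2 := inner_valL_ofC1 hf hs hf1 (cubic v)
  have e3 := form_ofC1 hV hf hs hf1 v
  have e4 : ∑ j, ⟪gradL j (ofC1 f hf1 hs), gradL j v⟫_ℂ = ∑ j, _ :=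
    Finset.sum_congr rfl fun j _ => inner_gradL_ofC1 hf hs hf1 j (gradL j v)
  rw [Finset.sum_sub_distrib, ← Finset.mul_sum] at e4
  refine (congrArg₂ (· - ·) (e1.trans (congrArg₂ (· + ·) e4 e3)) e2).trans ?_
  simp only [weakRhs]
  ring

/-- The equation tested against smooth complex functions. -/
theorem IsSolution.hasDerivAt_inner {V : R3 → ℝ} (hV : FormBounded V) {I : Set ℝ} {u₀ : H1}
    {u : ℝ → H1} (hu : IsSolution V I u₀ u) (w : H1) (hw : w ∈ smoothH1) (t : ℝ) (ht : t ∈ I) :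
    HasDerivAt (fun s => ⟪valL w, valL (u s)⟫_ℂ)
      (-Complex.I * (energyL hV w (u t) - ⟪valL w, cubic (u t)⟫_ℂ)) t := by
  obtain ⟨f, hf, hs, rfl⟩ := hw
  have hf1 : ContDiff ℝ 1 f := hf.of_le (by simp)
  have h : ∀ φ : R3 → ℝ, IsTestFunction φ → HasDerivAt (fun s => ∫ x, φ x • valL (u s) x)
      (-Complex.I * weakRhs V φ (u t)) t := fun φ hφ =>
    ((hu.equation φ hφ t ht).congr_deriv
      (congrArg (fun z => -Complex.I * z) (weakRhs_eq hφ (u t)).symm)).congr_of_eventuallyEq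
      (.of_forall fun s => integral_congr_ae (.of_forall fun x =>
        congrArg (fun z => φ x • z) (congrFun (coe_valL (u s)) x)))
  have h1 := (h _ (IsTestFunction.re hf hs)).sub
    ((h _ (IsTestFunction.im hf hs)).const_mul Complex.I)
  refine (h1.congr_deriv ?_).congr_of_eventuallyEq (.of_forall fun s =>
    inner_valL_ofC1 hf hs hf1 (valL (u s)))
  refine Eq.trans ?_ (congrArg (fun z => -Complex.I * z)
    (energyL_sub_inner_cubic hV hf hs hf1 (u t))).symm
  ring

/-! ### The cubic nonlinearity in the virial identity -/

theorem pd_quartic {f : R3 → ℂ} (hf : ContDiff ℝ 1 f) (x v : R3) :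
    fderiv ℝ (fun x => (‖f x‖ ^ 2) ^ 2) x v
      = 4 * ((((‖f x‖ ^ 2 : ℝ) : ℂ) * f x) * (starRingEnd ℂ) (fderiv ℝ f x v)).re := by
  have h := (((hf.differentiable (by simp) x).hasFDerivAt.norm_sq).pow 2).fderiv
  rw [h]
  have e : ⟪f x, fderiv ℝ f x v⟫_ℝ = (f x * (starRingEnd ℂ) (fderiv ℝ f x v)).re := by
    rw [Complex.inner, ← Complex.conj_re, map_mul, Complex.conj_conj, mul_comm]
  rw [mul_assoc, Complex.re_ofReal_mul, ← e]
  simp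
  ring

/-- Pointwise 4 Re(|f|²f ∇χ·∇f̄) = ∇χ·∇|f|⁴, and ∇χ is integrated by parts against the C¹ function
|f|⁴. -/
theorem re_inner_dirL_of_ae {χ : R3 → ℝ} (hχ : IsTestFunction χ) {f : R3 → ℂ}
    (hf : ContDiff ℝ 1 f) (hs : HasCompactSupport f) {D N F : L2}
    (hD : D =ᵐ[volume] fun x => fderiv ℝ f x (gradField χ x)) (hF : F =ᵐ[volume] f)
    (hN : N =ᵐ[volume] fun x => ((‖F x‖ ^ 2 : ℝ) : ℂ) * F x) :
    4 * (⟪D, N⟫_ℂ).re = -(⟪mulL hχ.lapl.bcf F, N⟫_ℂ).re := by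
  have hN' : N =ᵐ[volume] fun x => ((‖f x‖ ^ 2 : ℝ) : ℂ) * f x := by
    filter_upwards [hN, hF] with x h1 h2
    rw [h1, h2]
  have hL : mulL hχ.lapl.bcf F =ᵐ[volume] fun x => lapl χ x • f x := by
    filter_upwards [coeFn_mulL hχ.lapl.bcf F, hF] with x h1 h2
    rw [h1, h2, IsTestFunction.bcf_apply]
  have hG : ContDiff ℝ 1 fun x => (‖f x‖ ^ 2) ^ 2 := (contDiff_norm_sq hf).pow 2
  have hGs : HasCompactSupport fun x => (‖f x‖ ^ 2) ^ 2 :=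
    (hasCompactSupport_norm_sq hs).comp_left (g := fun r : ℝ => r ^ 2) (by simp)
  have key := (isWeakDiv_one hχ).eq_of_contDiff hχ hG hGs
  have i1 := (integrable_inner_of_ae hD hN').re
  have i2 := (integrable_inner_of_ae hL hN').re
  have r1 : (⟪D, N⟫_ℂ).re = ∫ x, ((((‖f x‖ ^ 2 : ℝ) : ℂ) * f x)
      * (starRingEnd ℂ) (fderiv ℝ f x (gradField χ x))).re := by
    rw [inner_eq_of_ae hD hN']
    exact (integral_re (integrable_inner_of_ae hD hN')).symm
  have r2 : (⟪mulL hχ.lapl.bcf F, N⟫_ℂ).re = ∫ x, lapl χ x * (‖f x‖ ^ 2) ^ 2 := by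
    rw [inner_eq_of_ae hL hN']
    refine (integral_re (integrable_inner_of_ae hL hN')).symm.trans
      (integral_congr_ae (.of_forall fun x => ?_))
    have := Complex.mul_conj (f x)
    rw [Complex.normSq_eq_norm_sq] at this
    show ((((‖f x‖ ^ 2 : ℝ) : ℂ) * f x) * (starRingEnd ℂ) (lapl χ x • f x)).re = _
    rw [Complex.real_smul, map_mul, Complex.conj_ofReal, mul_mul_mul_comm, this,
      ← Complex.ofReal_mul, ← Complex.ofReal_mul, Complex.ofReal_re]
    ring
  rw [r1, r2, ← integral_const_mul, ← integral_neg]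
  simp only [one_mul, neg_mul] at key
  rw [← key]
  refine integral_congr_ae (.of_forall fun x => ?_)
  show 4 * _ = _
  rw [← pd_quartic hf, fderiv_eq_sum_pd]
  rfl

theorem continuous_re_inner_clm {E G : Type*} [TopologicalSpace E] [AddCommGroup E] [Module ℂ E]
    [NormedAddCommGroup G] [InnerProductSpace ℂ G] (A : E →L[ℂ] G) {N : E → G}
    (hN : Continuous N) : Continuous fun v => (⟪A v, N v⟫_ℂ).re :=
  Complex.continuous_re.comp (A.continuous.inner hN)

theorem eq_of_dense_real {E : Type*} [TopologicalSpace E] {S : Set E} (hS : Dense S)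
    {a b : E → ℝ} (ha : Continuous a) (hb : Continuous b)
    (h : ∀ w ∈ S, 4 * a w = -b w) (w : E) : 4 * a w = -b w :=
  congrFun (Continuous.ext_on hS (ha.const_mul 4) hb.neg h) w

/-- The interaction of the virial vector field with the cubic nonlinearity. -/
theorem re_inner_dirL_cubic {χ : R3 → ℝ} (hχ : IsTestFunction χ) (v : H1) :
    4 * (⟪dirL hχ v, cubic v⟫_ℂ).re = -(⟪mulL hχ.lapl.bcf (valL v), cubic v⟫_ℂ).re := by
  refine eq_of_dense_real dense_smoothH1
    (continuous_re_inner_clm (dirL hχ) continuous_cubic)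
    (continuous_re_inner_clm ((mulL hχ.lapl.bcf).comp valL) continuous_cubic) ?_ v
  rintro _ ⟨f, hf, hs, rfl⟩
  have hf1 : ContDiff ℝ 1 f := hf.of_le (by simp)
  exact re_inner_dirL_of_ae hχ hf1 hs (coeFn_dirL_ofC1 hχ hf1 hs) (coeFn_valL_ofC1 hf1 hs)
    (coeFn_cubic _)

theorem inner_mulL_cubic_of_ae (a : R3 →ᵇ ℝ) {f N : L2}
    (hN : N =ᵐ[volume] fun x => ((‖f x‖ ^ 2 : ℝ) : ℂ) * f x) :
    Integrable (fun x => a x * ‖f x‖ ^ 4) ∧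
      ⟪mulL a f, N⟫_ℂ = ((∫ x, a x * ‖f x‖ ^ 4 : ℝ) : ℂ) := by
  have e : ∀ x, (((‖f x‖ ^ 2 : ℝ) : ℂ) * f x) * (starRingEnd ℂ) (a x • f x)
      = ((a x * ‖f x‖ ^ 4 : ℝ) : ℂ) := fun x => by
    have := Complex.mul_conj (f x)
    rw [Complex.normSq_eq_norm_sq] at this
    rw [Complex.real_smul, map_mul, Complex.conj_ofReal, mul_mul_mul_comm, this,
      ← Complex.ofReal_mul, ← Complex.ofReal_mul]
    congr 1
    ring
  have h1 := integrable_inner_of_ae (coeFn_mulL a f) hN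
  simp only [e] at h1
  refine ⟨h1.re, ?_⟩
  rw [inner_eq_of_ae (coeFn_mulL a f) hN, ← integral_complex_ofReal]
  simp only [e]

theorem inner_mulL_cubic (a : R3 →ᵇ ℝ) (v : H1) :
    Integrable (fun x => a x * ‖valL v x‖ ^ 4) ∧
      ⟪mulL a (valL v), cubic v⟫_ℂ = ((∫ x, a x * ‖valL v x‖ ^ 4 : ℝ) : ℂ) :=
  inner_mulL_cubic_of_ae a (coeFn_cubic v)

theorem im_inner_mulL_self (a : R3 →ᵇ ℝ) (f : L2) : (⟪mulL a f, f⟫_ℂ).im = 0 := by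
  rw [inner_mulL_left, inner_mulL_self, Complex.ofReal_im]

theorem sum_mulL_pd_pd {ψ : R3 → ℝ} (hψ : IsTestFunction ψ) (f : L2) :
    ∑ j, mulL ((hψ.pd j).pd j).bcf f = mulL hψ.lapl.bcf f := by
  have e : hψ.lapl.bcf
      = ((hψ.pd 0).pd 0).bcf + ((hψ.pd 1).pd 1).bcf + ((hψ.pd 2).pd 2).bcf := by
    ext x
    simp [lapl, Fin.sum_univ_three]
  rw [e, mulL_add, mulL_add, Fin.sum_univ_three]

/-! ### Mass and momentum fluxes -/

/-- The flux of the mass density weighted with `χ`. -/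
def massFlux {χ : R3 → ℝ} (hχ : IsTestFunction χ) (v : H1) (g : L2) : ℝ :=
  2 * (∑ j, ⟪mulL (hχ.pd j).bcf (valL v), gradL j v⟫_ℂ).im
    - 2 * (⟪mulL hχ.bcf (valL v), g⟫_ℂ).im

theorem continuous_massFlux {χ : R3 → ℝ} (hχ : IsTestFunction χ) :
    Continuous fun x : H1 × L2 => massFlux hχ x.1 x.2 := by
  have h1 : ∀ j, Continuous fun x : H1 × L2 =>
      ⟪mulL (hχ.pd j).bcf (valL x.1), gradL j x.1⟫_ℂ := fun j =>
    (((mulL (hχ.pd j).bcf).comp valL).continuous.comp continuous_fst).inner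
      ((gradL j).continuous.comp continuous_fst)
  have h2 : Continuous fun x : H1 × L2 => ⟪mulL hχ.bcf (valL x.1), x.2⟫_ℂ :=
    (((mulL hχ.bcf).comp valL).continuous.comp continuous_fst).inner continuous_snd
  exact ((Complex.continuous_im.comp (continuous_finsetSum _ fun j _ => h1 j)).const_mul 2).sub
    ((Complex.continuous_im.comp h2).const_mul 2)

/-- Imaginary part of the equation tested with χf: the potential term and the terms χ|∂_j f|² are
real and drop out, and the imaginary part of i⟨χf, f'⟩ is half the derivative sought. -/
theorem mass_symm {χ : R3 → ℝ} (hχ : IsTestFunction χ) {f f' g F : L2} {G H : Fin 3 → L2} {r : ℝ}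
    {z : ℂ} (hz : z = r) (hF : F = mulL hχ.bcf f)
    (hH : ∀ j, H j = mulL hχ.bcf (G j) + mulL (hχ.pd j).bcf f)
    (h : ∑ j, ⟪H j, G j⟫_ℂ + z = ⟪F, Complex.I • f' + g⟫_ℂ) :
    (⟪f, mulL hχ.bcf f'⟫_ℂ + ⟪f', mulL hχ.bcf f⟫_ℂ).re
      = 2 * (∑ j, ⟪mulL (hχ.pd j).bcf f, G j⟫_ℂ).im - 2 * (⟪mulL hχ.bcf f, g⟫_ℂ).im := by
  have h := congrArg Complex.im h
  simp only [hF, hH, hz, inner_add_left, inner_add_right, inner_smul_right, Complex.add_im,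
    Complex.im_sum, Finset.sum_add_distrib, im_inner_mulL_self, Finset.sum_const_zero, zero_add,
    Complex.ofReal_im, add_zero, Complex.I_mul_im] at h
  have e : (⟪f', mulL hχ.bcf f⟫_ℂ).re = (⟪mulL hχ.bcf f, f'⟫_ℂ).re := by
    rw [← inner_conj_symm, Complex.conj_re]
  rw [Complex.add_re, e, ← inner_mulL_left, Complex.im_sum]
  linarith

/-- The functional appearing as the second derivative of the weighted mass. -/
def virialFlux {χ W : R3 → ℝ} (hχ : IsTestFunction χ) (hW : FormBounded W) (v : H1) (g : L2) : ℝ :=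
  4 * virialForm hχ hW v - 4 * (⟪dirL hχ v, g⟫_ℂ).re - 2 * (⟪mulL hχ.lapl.bcf (valL v), g⟫_ℂ).re

theorem continuous_virialForm {χ W : R3 → ℝ} (hχ : IsTestFunction χ) (hW : FormBounded W) :
    Continuous fun v => virialForm hχ hW v := by
  have h1 : ∀ j i, Continuous fun v : H1 =>
      ⟪mulL ((hχ.pd i).pd j).bcf (gradL i v), gradL j v⟫_ℂ := fun j i =>
    ((mulL ((hχ.pd i).pd j).bcf).comp (gradL i)).continuous.inner (gradL j).continuous
  have h2 : Continuous fun v : H1 => ⟪valL v, mulL hχ.lapl.lapl.bcf (valL v)⟫_ℂ :=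
    valL.continuous.inner ((mulL hχ.lapl.lapl.bcf).comp valL).continuous
  have h3 : Continuous fun v : H1 => form hW v v :=
    (continuous_form hW).comp (continuous_id.prodMk continuous_id)
  exact ((continuous_finsetSum _ fun j _ =>
    Complex.continuous_re.comp (continuous_finsetSum _ fun i _ => h1 j i)).sub
      ((Complex.continuous_re.comp h2).const_mul _)).sub
        ((Complex.continuous_re.comp h3).const_mul _)

theorem continuous_virialFlux {χ W : R3 → ℝ} (hχ : IsTestFunction χ) (hW : FormBounded W) :
    Continuous fun x : H1 × L2 => virialFlux hχ hW x.1 x.2 := by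
  have h1 : Continuous fun x : H1 × L2 => ⟪dirL hχ x.1, x.2⟫_ℂ :=
    ((dirL hχ).continuous.comp continuous_fst).inner continuous_snd
  have h2 : Continuous fun x : H1 × L2 => ⟪mulL hχ.lapl.bcf (valL x.1), x.2⟫_ℂ :=
    (((mulL hχ.lapl.bcf).comp valL).continuous.comp continuous_fst).inner continuous_snd
  exact ((((continuous_virialForm hχ hW).comp continuous_fst).const_mul 4).sub
    ((Complex.continuous_re.comp h1).const_mul 4)).sub ((Complex.continuous_re.comp h2).const_mul 2)

/-- Integrating by parts moves ∂_j off the time derivative f', and the derivative of the functional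
becomes 4 Re⟨D + ½Δχ f, i f'⟩. The stationary identity for the source i f' + g then expresses it
without f'; the terms in g are those subtracted on the right. -/
theorem virial_symm {χ : R3 → ℝ} (hχ : IsTestFunction χ) {f f' g D : L2} {G G' : Fin 3 → L2}
    {F : Fin 3 → L2} {H : Fin 3 → L2} {q : ℝ} (hD : D = ∑ j, mulL (hχ.pd j).bcf (G j))
    (hF : ∀ j, F j = mulL (hχ.pd j).bcf f)
    (hH : ∀ j, H j = mulL (hχ.pd j).bcf (G j) + mulL ((hχ.pd j).pd j).bcf f)
    (hp : ∀ j, ⟪F j, G' j⟫_ℂ = -⟪H j, f'⟫_ℂ)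
    (h : (⟪D, Complex.I • f' + g⟫_ℂ).re
      + 1 / 2 * (⟪mulL hχ.lapl.bcf f, Complex.I • f' + g⟫_ℂ).re = q) :
    (∑ j, (⟪mulL (hχ.pd j).bcf f, (-2 * Complex.I) • G' j⟫_ℂ
        + ⟪mulL (hχ.pd j).bcf f', (-2 * Complex.I) • G j⟫_ℂ)).re
      = 4 * q - 4 * (⟪D, g⟫_ℂ).re - 2 * (⟪mulL hχ.lapl.bcf f, g⟫_ℂ).re := by
  have e : ∑ j, (⟪mulL (hχ.pd j).bcf f, (-2 * Complex.I) • G' j⟫_ℂ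
        + ⟪mulL (hχ.pd j).bcf f', (-2 * Complex.I) • G j⟫_ℂ)
      = -2 * Complex.I * (-⟪D, f'⟫_ℂ - ⟪mulL hχ.lapl.bcf f, f'⟫_ℂ + ⟪f', D⟫_ℂ) := by
    rw [hD, ← sum_mulL_pd_pd hχ, sum_inner, sum_inner, inner_sum, ← Finset.sum_neg_distrib,
      ← Finset.sum_sub_distrib, ← Finset.sum_add_distrib, Finset.mul_sum]
    refine Finset.sum_congr rfl fun j _ => ?_
    rw [inner_smul_right, inner_smul_right, ← hF, hp, hH, inner_add_left, inner_mulL_left _ f']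
    ring
  have e2 : (⟪f', D⟫_ℂ).im = -(⟪D, f'⟫_ℂ).im := by
    rw [← inner_conj_symm, Complex.conj_im]
  rw [e, ← h]
  simp only [inner_add_right, inner_smul_right, Complex.add_re, Complex.I_mul_re, mul_assoc]
  have e3 : ∀ w : ℂ, (-2 * (Complex.I * w)).re = 2 * w.im := fun w => by simp
  rw [e3, Complex.add_im, Complex.sub_im, Complex.neg_im, e2]
  ring

section Flux

variable {χ V W : R3 → ℝ} {I : Set ℝ} {u₀ : H1} {u : ℝ → H1}

theorem hasDerivAt_mass (hχ : IsTestFunction χ) (hV : FormBounded V) (hu : IsSolution V I u₀ u)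
    {t : ℝ} (ht : t ∈ I) :
    HasDerivAt (fun s => (∑ _k : Unit, ⟪valL (u s), mulL hχ.bcf (valL (u s))⟫_ℂ).re)
      (massFlux hχ (u t) (cubic (u t))) t :=
  hasDerivAt_of_weak_equation (ι := Unit) (L := fun _ => valL)
    (M := fun _ => (mulL hχ.bcf).comp valL) dense_smoothH1 (continuous_energyL hV) hu.isOpen
    hu.continuousOn continuous_cubic (hu.hasDerivAt_inner hV) (continuous_massFlux hχ)
    (fun v _ _ h => (congrArg Complex.re (Fintype.sum_unique _)).trans
      (mass_symm hχ (form_mulH1_self hV hχ v) (valL_mulH1 hχ v) (fun j => gradL_mulH1 hχ j v)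
        ((energyL_apply hV _ v).symm.trans (h (mulH1 hχ v))))) ht

theorem hasDerivAt_flux (hχ : IsTestFunction χ) (hV : FormBounded V)
    (hVl : LocallyIntegrable V volume) (hW : FormBounded W) (h : IsWeakGradDot χ V W)
    (hu : IsSolution V I u₀ u) {t : ℝ} (ht : t ∈ I) :
    HasDerivAt (fun s => (∑ j, ⟪mulL (hχ.pd j).bcf (valL (u s)),
        (-2 * Complex.I) • gradL j (u s)⟫_ℂ).re) (virialFlux hχ hW (u t) (cubic (u t))) t :=
  hasDerivAt_of_weak_equation (ι := Fin 3) (L := fun j => (mulL (hχ.pd j).bcf).comp valL)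
    (M := fun j => (-2 * Complex.I) • gradL j) dense_smoothH1 (continuous_energyL hV) hu.isOpen
    hu.continuousOn continuous_cubic (hu.hasDerivAt_inner hV) (continuous_virialFlux hχ hW)
    (fun v v' _ hv => virial_symm hχ (dirL_apply hχ v) (fun j => valL_mulH1 (hχ.pd j) v)
      (fun j => gradL_mulH1 (hχ.pd j) j v)
      (fun j => inner_valL_gradL (mulH1 (hχ.pd j) v) v' j)
      (virial_stationary hχ hV hVl hW h fun w => (energyL_apply hV w v).symm.trans (hv w))) ht

end Flux

/-! ### Fluxes written as integrals -/

theorem pd_pd_eq {χ : R3 → ℝ} (hχ : IsTestFunction χ) (i j : Fin 3) (x : R3) :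
    pd i (pd j χ) x = fderiv ℝ (fderiv ℝ χ) x (basisVec i) (basisVec j) := by
  have h : HasFDerivAt (fderiv ℝ χ) (fderiv ℝ (fderiv ℝ χ) x) x :=
    ((hχ.1.fderiv_right (m := ∞) (by simp)).differentiable (by simp) x).hasFDerivAt
  have h2 : fderiv ℝ (pd j χ) x = _ := (h.clm_apply (hasFDerivAt_const (basisVec j) x)).fderiv
  rw [pd, h2]
  simp

theorem laplacian_eq_lapl {χ : R3 → ℝ} (hχ : IsTestFunction χ) :
    Laplacian.laplacian χ = lapl χ := by
  rw [InnerProductSpace.laplacian_eq_iteratedFDeriv_orthonormalBasis χ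
    (EuclideanSpace.basisFun (Fin 3) ℝ)]
  funext x
  refine Finset.sum_congr rfl fun i _ => ?_
  rw [iteratedFDeriv_two_apply, pd_pd_eq hχ]
  simp

theorem integral_pd_mul_conj {χ : R3 → ℝ} (hχ : IsTestFunction χ) (f : L2) (G : Fin 3 → L2) :
    Integrable (fun x => (∑ i, (pd i χ x : ℂ) * G i x) * (starRingEnd ℂ) (f x)) ∧
      ∫ x, (∑ i, (pd i χ x : ℂ) * G i x) * (starRingEnd ℂ) (f x)
        = ∑ j, ⟪mulL (hχ.pd j).bcf f, G j⟫_ℂ := by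
  have h : ∀ j, Integrable fun x => (pd j χ x • G j x) * (starRingEnd ℂ) (f x) := fun j =>
    integrable_inner_of_ae (ae_eq_refl f) (coeFn_mulL (hχ.pd j).bcf (G j))
  have e : (fun x => (∑ i, (pd i χ x : ℂ) * G i x) * (starRingEnd ℂ) (f x))
      = fun x => ∑ i, (pd i χ x • G i x) * (starRingEnd ℂ) (f x) :=
    funext fun x => by simp only [Finset.sum_mul, Complex.real_smul]
  rw [e]
  refine ⟨integrable_finsetSum _ fun j _ => h j, ?_⟩
  rw [integral_finsetSum _ fun j _ => h j]
  refine Finset.sum_congr rfl fun j _ => ?_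
  rw [inner_mulL_left, inner_eq_of_ae (ae_eq_refl f) (coeFn_mulL (hχ.pd j).bcf (G j))]
  rfl

theorem integral_mul_mul_conj (a : R3 →ᵇ ℝ) (f g : L2) :
    Integrable (fun x => (a x : ℂ) * g x * (starRingEnd ℂ) (f x)) ∧
      ∫ x, (a x : ℂ) * g x * (starRingEnd ℂ) (f x) = ⟪mulL a f, g⟫_ℂ := by
  rw [inner_mulL_left, inner_eq_of_ae (ae_eq_refl f) (coeFn_mulL a g)]
  exact ⟨integrable_inner_of_ae (ae_eq_refl f) (coeFn_mulL a g), rfl⟩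

/-- The cubic term tested with χv is the integral of χ|v|⁴, a real number, and does not change the
mass. -/
theorem massFlux_cubic {χ : R3 → ℝ} (hχ : IsTestFunction χ) (v : H1) :
    massFlux hχ v (cubic v) = 2 * (∑ j, ⟪mulL (hχ.pd j).bcf (valL v), gradL j v⟫_ℂ).im := by
  have h := congrArg Complex.im (inner_mulL_cubic hχ.bcf v).2
  rw [Complex.ofReal_im] at h
  have h2 : 2 * (⟪mulL hχ.bcf (valL v), cubic v⟫_ℂ).im = 0 := by linarith
  exact (congrArg (fun r => 2 * (∑ j, ⟪mulL (hχ.pd j).bcf (valL v), gradL j v⟫_ℂ).im - r) h2).trans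
    (sub_zero _)

theorem re_sum_inner_smul (a : Fin 3 → R3 →ᵇ ℝ) (f : L2) (G : Fin 3 → L2) :
    (∑ j, ⟪mulL (a j) f, (-2 * Complex.I) • G j⟫_ℂ).re
      = 2 * (∑ j, ⟪mulL (a j) f, G j⟫_ℂ).im := by
  simp only [inner_smul_right, ← Finset.mul_sum]
  simp

/-- The coefficient of the quartic term: -4d contributes +l and the last summand -2l, leaving -l.
The Hessian sums differ only by a swap of the summation indices. -/
theorem virialFlux_aux {χ : R3 → ℝ} (hχ : IsTestFunction χ) {f : L2} {G : Fin 3 → L2}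
    {d l k q w : ℝ} (hd : 4 * d = -l) (hl : l = q) (hk : k = w) :
    4 * (virialQ hχ f G - 1 / 2 * k) - 4 * d - 2 * l
      = 4 * (∑ i, ∑ j, (∫ x, (pd i (pd j χ) x : ℂ) * G i x * (starRingEnd ℂ) (G j x)).re)
        - q - (∫ x, lapl (lapl χ) x * ‖f x‖ ^ 2) - 2 * w := by
  have e : ∀ i j, ∫ x, (pd i (pd j χ) x : ℂ) * G i x * (starRingEnd ℂ) (G j x)
      = ⟪mulL ((hχ.pd j).pd i).bcf (G j), G i⟫_ℂ := fun i j =>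
    (integral_mul_mul_conj ((hχ.pd j).pd i).bcf (G j) (G i)).2
  simp only [e, virialQ, inner_mulL_self, Complex.ofReal_re, IsTestFunction.bcf_apply,
    Complex.re_sum]
  rw [hd, hl, hk]
  ring

theorem virialFlux_cubic {χ W : R3 → ℝ} (hχ : IsTestFunction χ) (hW : FormBounded W) (v : H1) :
    virialFlux hχ hW v (cubic v)
      = 4 * (∑ i, ∑ j, (∫ x, (pd i (pd j χ) x : ℂ) * gradL i v x *
            (starRingEnd ℂ) (gradL j v x)).re)
        - (∫ x, lapl χ x * ‖valL v x‖ ^ 4) - (∫ x, lapl (lapl χ) x * ‖valL v x‖ ^ 2)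
        - 2 * ∫ x, W x * ‖valL v x‖ ^ 2 :=
  virialFlux_aux hχ (re_inner_dirL_cubic hχ v)
    ((congrArg Complex.re (inner_mulL_cubic hχ.lapl.bcf v).2).trans (Complex.ofReal_re _))
    (re_form_self hW v)

theorem re_sum_inner_mulL (a : R3 →ᵇ ℝ) (f : L2) :
    ∫ x, a x * ‖f x‖ ^ 2 = (∑ _k : Unit, ⟪f, mulL a f⟫_ℂ).re := by
  rw [Fintype.sum_unique, inner_mulL_self, Complex.ofReal_re]

/-! ### The localized virial identities -/

section Virial

variable {χ V W : R3 → ℝ} {I : Set ℝ} {u₀ : H1} {u : ℝ → H1}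

/-- The first localized virial identity. -/
theorem hasDerivAt_integral_mul_sq (hχ : IsTestFunction χ) (hV : FormBounded V)
    (hu : IsSolution V I u₀ u) {t : ℝ} (ht : t ∈ I) :
    HasDerivAt (fun s => ∫ x, χ x * ‖valL (u s) x‖ ^ 2)
      (2 * (∑ j, ⟪mulL (hχ.pd j).bcf (valL (u t)), gradL j (u t)⟫_ℂ).im) t :=
  ((hasDerivAt_mass hχ hV hu ht).congr_deriv (massFlux_cubic hχ (u t))).congr_of_eventuallyEq
    (.of_forall fun s => re_sum_inner_mulL hχ.bcf (valL (u s)))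

/-- The second localized virial identity. -/
theorem hasDerivAt_deriv_integral_mul_sq (hχ : IsTestFunction χ) (hV : FormBounded V)
    (hVl : LocallyIntegrable V volume) (hW : FormBounded W) (h : IsWeakGradDot χ V W)
    (hu : IsSolution V I u₀ u) {t : ℝ} (ht : t ∈ I) :
    HasDerivAt (deriv fun s => ∫ x, χ x * ‖valL (u s) x‖ ^ 2)
      (4 * (∑ i, ∑ j, (∫ x, (pd i (pd j χ) x : ℂ) * gradL i (u t) x *
            (starRingEnd ℂ) (gradL j (u t) x)).re)
        - (∫ x, lapl χ x * ‖valL (u t) x‖ ^ 4) - (∫ x, lapl (lapl χ) x * ‖valL (u t) x‖ ^ 2)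
        - 2 * ∫ x, W x * ‖valL (u t) x‖ ^ 2) t :=
  ((hasDerivAt_flux hχ hV hVl hW h hu ht).congr_deriv
    (virialFlux_cubic hχ hW (u t))).congr_of_eventuallyEq
      -- Since I is open, the first identity holds at all times near t and identifies the derivative
      -- there with the momentum functional that has just been differentiated.
      ((hu.isOpen.eventually_mem ht).mono fun s hs =>
        (hasDerivAt_integral_mul_sq hχ hV hu hs).deriv.trans
          (re_sum_inner_smul (fun j => (hχ.pd j).bcf) (valL (u s)) (fun j => gradL j (u s))).symm)

/-- Both identities, with the integrability of all the terms. -/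
theorem virial_identities (hχ : IsTestFunction χ) (hV : FormBounded V)
    (hVl : LocallyIntegrable V volume) (hu : IsSolution V I u₀ u) {val : H1 → R3 → ℂ}
    {grad : H1 → Fin 3 → R3 → ℂ} (hval : val = fun f => (valL f : R3 → ℂ))
    (hgrad : grad = fun f i => (gradL i f : R3 → ℂ)) :
    (∀ t ∈ I,
      Integrable (fun x => χ x * ‖val (u t) x‖ ^ 2) ∧
      Integrable (fun x =>
        (∑ i, (pd i χ x : ℂ) * grad (u t) i x) * (starRingEnd ℂ) (val (u t) x)) ∧
      HasDerivAt (fun s => ∫ x, χ x * ‖val (u s) x‖ ^ 2)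
        (2 * (∫ x, (∑ i, (pd i χ x : ℂ) * grad (u t) i x) *
          (starRingEnd ℂ) (val (u t) x)).im) t) ∧
    (∀ W : R3 → ℝ, IsWeakGradDot χ V W →
      (∀ f : H1, Integrable (fun x => W x * ‖val f x‖ ^ 2)) →
      ∀ t ∈ I,
        (∀ i j : Fin 3, Integrable (fun x =>
          (pd i (pd j χ) x : ℂ) * grad (u t) i x * (starRingEnd ℂ) (grad (u t) j x))) ∧
        Integrable (fun x => lapl χ x * ‖val (u t) x‖ ^ 4) ∧
        Integrable (fun x => lapl (lapl χ) x * ‖val (u t) x‖ ^ 2) ∧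
        HasDerivAt (deriv (fun s => ∫ x, χ x * ‖val (u s) x‖ ^ 2))
          (4 * (∑ i, ∑ j, (∫ x, (pd i (pd j χ) x : ℂ) * grad (u t) i x *
              (starRingEnd ℂ) (grad (u t) j x)).re)
            - (∫ x, lapl χ x * ‖val (u t) x‖ ^ 4)
            - (∫ x, lapl (lapl χ) x * ‖val (u t) x‖ ^ 2)
            - 2 * ∫ x, W x * ‖val (u t) x‖ ^ 2) t) := by
  subst hval hgrad
  refine ⟨fun t ht => ?_, fun W hW hWint t ht => ?_⟩
  · have h := integral_pd_mul_conj hχ (valL (u t)) (fun j => gradL j (u t))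
    exact ⟨integrable_bcf_mul_sq hχ.bcf (valL (u t)), h.1,
      (hasDerivAt_integral_mul_sq hχ hV hu ht).congr_deriv
        (congrArg (fun z : ℂ => 2 * z.im) h.2.symm)⟩
  · have hFW : FormBounded W := ⟨hW.1.aestronglyMeasurable, hWint⟩
    exact ⟨fun i j => (integral_mul_mul_conj ((hχ.pd j).pd i).bcf
        (gradL j (u t)) (gradL i (u t))).1,
      (inner_mulL_cubic hχ.lapl.bcf (u t)).1,
      integrable_bcf_mul_sq hχ.lapl.lapl.bcf (valL (u t)),
      hasDerivAt_deriv_integral_mul_sq hχ hV hVl hFW hW hu ht⟩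

end Virial

end

end NLSVirial

open NLSVirial in
theorem proposition7p1 (V : R3 → ℝ) (hV : IsAdmissiblePotential V)
    (I : Set ℝ) (u₀ : H1) (u : ℝ → H1) (hu : IsSolution V I u₀ u)
    (χ : R3 → ℝ) (hχ : IsTestFunction χ) :
    -- the first identity
    (∀ t ∈ I,
      Integrable (fun x => χ x * ‖H1.val (u t) x‖ ^ 2) ∧
      Integrable (fun x =>
        (∑ i, (pd i χ x : ℂ) * H1.grad (u t) i x) * (starRingEnd ℂ) (H1.val (u t) x)) ∧
      HasDerivAt (fun s => ∫ x, χ x * ‖H1.val (u s) x‖ ^ 2)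
        (2 * (∫ x, (∑ i, (pd i χ x : ℂ) * H1.grad (u t) i x) *
          (starRingEnd ℂ) (H1.val (u t) x)).im) t) ∧
    -- the second identity, for `∇χ · ∇V` a function `W` whose integral against `|f|²` makes sense
    -- for all `f` in `H¹`
    (∀ W : R3 → ℝ, IsWeakGradDot χ V W →
      (∀ f : H1, Integrable (fun x => W x * ‖H1.val f x‖ ^ 2)) →
      ∀ t ∈ I,
        (∀ i j : Fin 3, Integrable (fun x =>
          (pd i (pd j χ) x : ℂ) * H1.grad (u t) i x * (starRingEnd ℂ) (H1.grad (u t) j x))) ∧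
        Integrable (fun x => Laplacian.laplacian χ x * ‖H1.val (u t) x‖ ^ 4) ∧
        Integrable (fun x =>
          Laplacian.laplacian (Laplacian.laplacian χ) x * ‖H1.val (u t) x‖ ^ 2) ∧
        HasDerivAt (deriv (fun s => ∫ x, χ x * ‖H1.val (u s) x‖ ^ 2))
          (4 * (∑ i, ∑ j, (∫ x, (pd i (pd j χ) x : ℂ) * H1.grad (u t) i x *
              (starRingEnd ℂ) (H1.grad (u t) j x)).re)
            - (∫ x, Laplacian.laplacian χ x * ‖H1.val (u t) x‖ ^ 4)
            - (∫ x, Laplacian.laplacian (Laplacian.laplacian χ) x * ‖H1.val (u t) x‖ ^ 2)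
            - 2 * ∫ x, W x * ‖H1.val (u t) x‖ ^ 2) t) := by
  rw [laplacian_eq_lapl hχ, laplacian_eq_lapl hχ.lapl]
  exact virial_identities hχ (formBounded_of_memLp hV.memLp)
    (hV.memLp.locallyIntegrable (by
      rw [ENNReal.le_div_iff_mul_le (by simp) (by simp)]
      norm_num)) hu
    (funext fun f => (coe_valL f).symm) (funext fun f => funext fun i => (coe_gradL i f).symm)
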